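/- **Setting.** Let $R$ be a commutative ring and let $(A,d_A,\wedge_A)$, $(B,d_B,\wedge_B)$ be two differential graded commutative algebras (dgcas) over $R$ ($\mathbb Z$-graded, not necessarily unital, differentials of degree $+1$). A *$C_\infty$ morphism* $(p_1,p_2,\dots)$ from $A$ to $B$ consists of linear maps $p_n:A^{\otimes n}\to B$ of degree $1-n$ with $$\partial p_n=\sum_{i=1}^{n-1}(-1)^{i-1}\Big(p_{n-1}(1^{\otimes i-1}\otimes\wedge_A\otimes1^{\otimes n-i-1})-\wedge_B(p_i\otimes p_{n-i})\Big)\qquad(n\ge1),$$ $$\sum_{\sigma\ (q,r)\text{-shuffle}}\operatorname{sgn}(\sigma)\,\varepsilon(\sigma;a)\;p_{q+r}(a_{\sigma^{-1}(1)},\dots,a_{\sigma^{-1}(q+r)})=0\qquad(q,r\ge1),$$ where $\varepsilon$ denotes the Koszul sign, and $\partial f=d_B f-(-1)^{|f|}\sum_i f(1^{\otimes i-1}\otimes d_A\otimes 1^{\otimes n-i})$ is the differential of $\mathrm{Hom}(A^{\otimes n},B)$. Let $p=p_1$. The *cumulants* of $p$ are $$k_n(a_1,\dots,a_n)=\sum_{\pi}(-1)^{|\pi|-1}(|\pi|-1)!\;\pm\prod_{b\in\pi}p\Big(\prod_{i\in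 b}a_i\Big),$$ the sum being over all partitions $\pi$ of $\{1,\dots,n\}$, with $\pm$ the Koszul sign. **Maps built from $p_1,\dots,p_m$.** For $n\ge1$ let $c_n$ be the chain complex of $R$-modules generated by the formal products $$w=\prod_{t}p_{j_t}(x_{t,1},\dots,x_{t,j_t}),$$ where the arguments $x_{t,s}$ are nonempty products of variables and each of $a_1,\dots,a_n$ occurs exactly once in $w$. The dimension of $w$ is $\sum_t(j_t-1)$. The generators are subject to the following identifications: variables inside an argument commute; factors commute with the sign $(-1)^{(j-1)(j'-1)}$; and each $p_j$ vanishes on signed shuffles of its arguments. The boundary is given by the graded Leibniz rule and $$\partial\, p_j(x_1,\dots,x_j)=\sum_{i=1}^{j-1}(-1)^{i-1}\big(p_{j-1}(x_1,\dots,x_ix_{i+1},\dots,x_j)-p_i(x_1,\dots,x_i)\,p_{j-i}(x_{i+1},\dots,x_j)\big).$$ An element of $c_n$ is *built from $p_1,\dots,p_m$* if it is a combination of products $w$ with all $j_t\le m$. By the *formal cumulant* we mean the combination of vertices of $c_n$ given by the formula for $k_n$. A *cycle* of dimension $k$ is an element of dimension $k$ with zero boundary, and, if $k=0$, with coefficients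 adding up to zero. **Theorem.** Let $(p,p_2,p_3,\dots)$ be a $C_\infty$ morphism from $A$ to $B$. 0. For every $n\ge1$, interpreting the products $w$ by the maps $p_j$ and the products of $A$ and $B$ (with Koszul signs) respects the identifications. It sends an element of dimension $k$ to a linear map $A^{\otimes n}\to B$ of degree $-k$, it intertwines the boundary of $c_n$ with $\partial$ on $\mathrm{Hom}(A^{\otimes n},B)$, and it sends the formal cumulant to $k_n$. In (i)–(iii), an equation in $c_n$ is asserted together with the resulting equation between maps $A^{\otimes n}\to B$. 1. (i) $\partial p_2=k_2$. For every $n\ge2$ there is a 1-dimensional $h$ built from $p_1,p_2$ whose boundary in $c_n$ is the formal cumulant. Hence the map $h:A^{\otimes n}\to B$ satisfies $\partial h=k_n$. 2. (ii) For every $n\ge2$, any two such null-homotopies $h,h'$ of $k_n$ built from $p_1,p_2$ are homotopic to each other through a 2-dimensional $g$ built from $p_1,p_2,p_3$, that is, $\partial g=h-h'$. (For $n=3$, $g$ is a combination of copies of $p_3$ with permuted inputs.) 3. (iii) In general, for all $n\ge1$, $m\ge0$ and $k\ge0$, every cycle of dimension $k$ in $c_n$ built from $p_1,\dots,p_m$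 is the boundary of an element of dimension $k+1$ built from $p_1,\dots,p_{m+1}$. So the corresponding map $A^{\otimes n}\to B$ is null-homotopic through a map built from $p_1,\dots,p_{m+1}$. -/

import Mathlib

open scoped BigOperators

noncomputable section

namespace CInf

/-! ### Differential graded commutative algebras -/

/-- A differential graded commutative algebra structure on the (not necessarily unital)
`R`-algebra `A`: a `ℤ`-grading, and a differential of degree `+1` which is a graded derivation. -/
structure DGCA (R : Type*) [CommRing R] (A : Type*) [NonUnitalRing A] [Module R A]
    [IsScalarTower R A A] [SMulCommClass R A A] where
  gr : ℤ → Submodule R A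
  isInternal : DirectSum.IsInternal gr
  mul_mem : ∀ {i j : ℤ} {x y : A}, x ∈ gr i → y ∈ gr j → x * y ∈ gr (i + j)
  d : A →ₗ[R] A
  d_mem : ∀ {i : ℤ} {x : A}, x ∈ gr i → d x ∈ gr (i + 1)
  d_d : ∀ x : A, d (d x) = 0
  leibniz : ∀ {i : ℤ} {x : A}, x ∈ gr i → ∀ y : A, d (x * y) = d x * y + i.negOnePow • (x * d y)
  comm : ∀ {i j : ℤ} {x y : A}, x ∈ gr i → y ∈ gr j → x * y = (i * j).negOnePow • (y * x)

/-- The product `x₁ x₂ ⋯ xᵣ` of a nonempty list in an algebra that need not have a unit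
(the value at the empty list is never used). -/
def nprod {A : Type*} [NonUnitalRing A] : List A → A
  | [] => 0
  | [x] => x
  | x :: y :: l => x * nprod (y :: l)

/-- Koszul sign of the rearrangement of `a₁ a₂ ⋯` (of degrees `e`) into the order listed by `L`:
a factor `(-1) ^ (e i * e j)` for every pair `j < i` such that `i` stands before `j` in `L`. -/
def koszulSign {n : ℕ} (e : Fin n → ℤ) : List (Fin n) → ℤˣ
  | [] => 1
  | i :: L => ((L.filter (fun j => j < i)).map (fun j => (e i * e j).negOnePow)).prod * koszulSign e L

section Hom

variable {R : Type*} [CommRing R]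
  {A : Type*} [NonUnitalRing A] [Module R A] [IsScalarTower R A A] [SMulCommClass R A A]
  {B : Type*} [NonUnitalRing B] [Module R B] [IsScalarTower R B B] [SMulCommClass R B B]

/-- `a₁, …, aₙ` are homogeneous of degrees `e₁, …, eₙ`. -/
def DGCA.Homog (DA : DGCA R A) {n : ℕ} (e : Fin n → ℤ) (a : Fin n → A) : Prop :=
  ∀ i, a i ∈ DA.gr (e i)

/-- Operations `A^{⊗ n} → B`, given by their values at homogeneous elements `a₁, …, aₙ` of
degrees `e₁, …, eₙ`; `f e a` is only meaningful when `DA.Homog e a`. -/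
abbrev Operation (n : ℕ) (A B : Type*) := (Fin n → ℤ) → (Fin n → A) → B

/-- Two operations agree, i.e. define the same map `A^{⊗ n} → B`. -/
def Agree (DA : DGCA R A) {n : ℕ} (f g : Operation n A B) : Prop :=
  ∀ e a, DA.Homog e a → f e a = g e a

/-- `f` is an `R`-linear map `A^{⊗ n} → B` of degree `k`. -/
def IsGradedMap (DA : DGCA R A) (DB : DGCA R B) {n : ℕ} (k : ℤ) (f : Operation n A B) : Prop :=
  ∀ e : Fin n → ℤ,
    (∃ F : MultilinearMap R (fun i => DA.gr (e i)) B, ∀ a, F a = f e (fun i => (a i : A))) ∧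
    ∀ a, DA.Homog e a → f e a ∈ DB.gr (∑ i, e i + k)

/-- The differential of the complex `Hom(A^{⊗ n}, B)` at an operation `f` of degree `k`:
`∂ f = d ∘ f - (-1)^k ∑ᵢ f ∘ (1 ⊗ ⋯ ⊗ d ⊗ ⋯ ⊗ 1)`. -/
def homDiff (DA : DGCA R A) (DB : DGCA R B) {n : ℕ} (k : ℤ) (f : Operation n A B) :
    Operation n A B := fun e a =>
  DB.d (f e a) - k.negOnePow • ∑ i : Fin n, (∑ j ∈ Finset.Iio i, e j).negOnePow •
    f (Function.update e i (e i + 1)) (Function.update a i (DA.d (a i)))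

/-- `h` is a linear map of degree `k` with `∂ h = f`. For `f = g - g'` this says that `h` is a
homotopy between `g` and `g'`, and in general that `h` is a null-homotopy of `f`. -/
def IsNullHomotopy (DA : DGCA R A) (DB : DGCA R B) {n : ℕ} (k : ℤ) (h f : Operation n A B) :
    Prop :=
  IsGradedMap DA DB k h ∧ Agree DA (homDiff DA DB k h) f

end Hom

/-! ### `C_∞` morphisms -/

/-- `(q, r)`-shuffles: permutations that are increasing on the first `q` and on the last `r`
indices. -/
def shuffles (q r : ℕ) : Finset (Equiv.Perm (Fin (q + r))) :=
  Finset.univ.filter fun σ =>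
    (∀ i j : Fin q, i ≤ j → σ (Fin.castAdd r i) ≤ σ (Fin.castAdd r j)) ∧
    (∀ i j : Fin r, i ≤ j → σ (Fin.natAdd q i) ≤ σ (Fin.natAdd q j))

section Morphism

variable {R : Type*} [CommRing R]
  {A : Type*} [NonUnitalRing A] [Module R A] [IsScalarTower R A A] [SMulCommClass R A A]
  {B : Type*} [NonUnitalRing B] [Module R B] [IsScalarTower R B B] [SMulCommClass R B B]

/-- A `C_∞` morphism between two dgcas: maps `p n : A^{⊗ n} → B` (`n ≥ 1`) of degree `1 - n` with
`∂ p_n = ∑_{i=1}^{n-1} (-1)^{i-1} (p_{n-1} (1^{⊗ i-1} ⊗ m_A ⊗ 1^{⊗ n-i-1}) - m_B (p_i ⊗ p_{n-i}))`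
that vanish on signed shuffles. (The component `p 0` plays no role.) -/
structure CInfMorphism (DA : DGCA R A) (DB : DGCA R B) where
  p : (n : ℕ) → MultilinearMap R (fun _ : Fin n => A) B
  map_mem : ∀ (n : ℕ), 1 ≤ n → ∀ (e : Fin n → ℤ) (a : Fin n → A), DA.Homog e a →
    p n a ∈ DB.gr (∑ i, e i + (1 - n))
  relation : ∀ (n : ℕ) (e : Fin (n + 1) → ℤ) (a : Fin (n + 1) → A), DA.Homog e a →
    homDiff DA DB (-n) (fun _ x => p (n + 1) x) e a =
      ∑ i : Fin n, ((i : ℕ) : ℤ).negOnePow •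
        (p n (i.castSucc.contractNth (· * ·) a) -
          (((n : ℤ) - (i : ℕ) - 1) * ∑ j ∈ Finset.Iic i.castSucc, e j).negOnePow •
            (p (i + 1) (fun k => a ⟨k, by omega⟩) *
              p (n - i) (fun k => a ⟨i + 1 + k, by omega⟩)))
  shuffle : ∀ (q r : ℕ), 1 ≤ q → 1 ≤ r → ∀ (e : Fin (q + r) → ℤ) (a : Fin (q + r) → A),
    DA.Homog e a →
    ∑ σ ∈ shuffles q r,
      (Equiv.Perm.sign σ * koszulSign e (List.ofFn fun i => σ⁻¹ i)) •
        p (q + r) (fun i => a (σ⁻¹ i)) = 0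

/-- The component `p_j` applied to a list of length `j`. -/
def CInfMorphism.app {DA : DGCA R A} {DB : DGCA R B} (P : CInfMorphism DA DB) (l : List A) : B :=
  P.p l.length l.get

end Morphism

/-! ### Cumulants -/

/-- The blocks of a set partition of `{1, …, n}`, in the order of their least elements, each
listed increasingly. -/
def blocks {n : ℕ} (π : Finpartition (Finset.univ : Finset (Fin n))) : List (List (Fin n)) :=
  ((List.finRange n).filter fun i => ∀ j ∈ π.part i, i ≤ j).map fun i => (π.part i).sort (· ≤ ·)

/-- The coefficient `(-1)^{|π|-1} (|π|-1)!`. -/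
def cumulantCoeff {n : ℕ} (π : Finpartition (Finset.univ : Finset (Fin n))) : ℤ :=
  (-1) ^ (π.parts.card - 1) * (π.parts.card - 1).factorial

/-- The `n`-th cumulant of a linear map `p`,
`k_n (a₁, …, aₙ) = ∑_π (-1)^{|π|-1} (|π|-1)! ± ∏_{b ∈ π} p (∏_{i ∈ b} aᵢ)`,
where `±` is the Koszul sign. -/
def cumulant {A B : Type*} [NonUnitalRing A] [NonUnitalRing B] (p : A → B) (n : ℕ) :
    Operation n A B := fun e a =>
  ∑ π : Finpartition (Finset.univ : Finset (Fin n)),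
    cumulantCoeff π • koszulSign e (blocks π).flatten •
      nprod ((blocks π).map fun b => p (nprod (b.map a)))

/-! ### Operations built from the components of a `C_∞` morphism -/

/-- Formal products `∏ₜ p_{jₜ} (x_{t,1}, …, x_{t,jₜ})` where each `x_{t,s}` is a product of
variables among `a₁, …, aₙ`: a word is the list of its factors `p_j (x_1, …, x_j)`, a factor is
the list of its arguments, and an argument is a list of variables. -/
abbrev Word (n : ℕ) := List (List (List (Fin n)))

namespace Word

/-- Every variable occurs exactly once, and there are no empty factors or arguments. -/
def IsCell {n : ℕ} (w : Word n) : Prop :=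
  w.flatten.flatten.Perm (List.finRange n) ∧ (∀ b ∈ w, b ≠ []) ∧ ∀ b ∈ w, ∀ x ∈ b, x ≠ []

/-- The dimension `∑ₜ (jₜ - 1)` of the cube that the word represents. -/
def dim {n : ℕ} (w : Word n) : ℕ := (w.map fun b => b.length - 1).sum

/-- The sign in `(p_{j₁} ⊗ p_{j₂} ⊗ ⋯) (x₁ ⊗ x₂ ⊗ ⋯) = ± p_{j₁}(x₁) p_{j₂}(x₂) ⋯`. -/
def tensorSign {n : ℕ} (e : Fin n → ℤ) : Word n → ℤˣ
  | [] => 1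
  | b :: w => ((dim w : ℤ) * (b.flatten.map e).sum).negOnePow * tensorSign e w

end Word

section Formal

variable (R : Type*) [CommRing R]

/-- Formal `R`-linear combinations of words. -/
abbrev Chain (n : ℕ) := Word n →₀ R

/-- Chains of dimension `k` in `n` variables that are built from `p_1, …, p_m` and the two
products. -/
def builtFrom (n m k : ℕ) : Submodule R (Chain R n) :=
  Finsupp.supported R R {w | w.IsCell ∧ w.dim = k ∧ ∀ b ∈ w, b.length ≤ m}

variable {R} in
/-- Multilinear insertion of a chain between the words `u` and `v`. -/
def insertChain {n : ℕ} (u v : Word n) (z : Chain R n) : Chain R n :=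
  z.mapDomain fun w => u ++ w ++ v

/-- Boundary of a single factor `p_j (x_1, …, x_j)`:
`∑_{i=1}^{j-1} (-1)^{i-1} (p_{j-1} (x_1, …, x_i x_{i+1}, …, x_j)
  - p_i (x_1, …, x_i) p_{j-i} (x_{i+1}, …, x_j))`. -/
def factorBoundary {n : ℕ} (b : List (List (Fin n))) : Chain R n :=
  ∑ i ∈ Finset.range (b.length - 1), (-1 : R) ^ i •
    (Finsupp.single [b.take i ++ ((b.drop i).take 2).flatten :: b.drop (i + 2)] 1 -
      Finsupp.single [b.take (i + 1), b.drop (i + 1)] 1)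

/-- Boundary of a product of factors, by the graded Leibniz rule. -/
def wordBoundary {n : ℕ} : Word n → Chain R n
  | [] => 0
  | b :: w => insertChain [] w (factorBoundary R b) +
      (-1 : R) ^ (b.length - 1) • insertChain [b] [] (wordBoundary w)

/-- The boundary of chains. -/
def boundary (n : ℕ) : Chain R n →ₗ[R] Chain R n := Finsupp.linearCombination R (wordBoundary R)

/-- The identifications of cells: the variables inside an argument commute, the factors commute in
the graded sense (`p_j (…)` has dimension `j - 1`), and factors vanish on signed shuffles. -/
inductive Relator (n : ℕ) : Chain R n → Prop
  | commA (u v : Word n) (b c : List (List (Fin n))) (s t : List (Fin n)) (i j : Fin n) :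
      (u ++ [b ++ [s ++ i :: j :: t] ++ c] ++ v).IsCell →
      Relator n (Finsupp.single (u ++ [b ++ [s ++ i :: j :: t] ++ c] ++ v) 1 -
        Finsupp.single (u ++ [b ++ [s ++ j :: i :: t] ++ c] ++ v) 1)
  | commB (u v : Word n) (b c : List (List (Fin n))) :
      (u ++ [b, c] ++ v).IsCell →
      Relator n (Finsupp.single (u ++ [b, c] ++ v) 1 -
        (-1 : R) ^ ((b.length - 1) * (c.length - 1)) • Finsupp.single (u ++ [c, b] ++ v) 1)
  | shuffle (u v : Word n) (q r : ℕ) (x : Fin (q + r) → List (Fin n)) :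
      1 ≤ q → 1 ≤ r → (u ++ [List.ofFn x] ++ v).IsCell →
      Relator n (∑ σ ∈ shuffles q r,
        Equiv.Perm.sign σ • Finsupp.single (u ++ [List.ofFn fun i => x (σ⁻¹ i)] ++ v) 1)

/-- The submodule spanned by the identifications. The complex of operations in `n` variables is
the quotient of the chains by it. -/
def relations (n : ℕ) : Submodule R (Chain R n) := Submodule.span R {z | Relator R n z}

/-- Two chains represent the same element of the complex of operations. -/
def Same {n : ℕ} (z z' : Chain R n) : Prop := z - z' ∈ relations R n

/-- `z`, of dimension `k`, is a (reduced) cycle of the complex of operations: its boundary is zero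
and, if it is a combination of vertices, its coefficients add up to zero. -/
def IsCycle {n : ℕ} (k : ℕ) (z : Chain R n) : Prop :=
  Same R (boundary R n z) 0 ∧ (k = 0 → z.sum (fun _ c => c) = 0)

/-- The `n`-th cumulant as a formal combination of vertices `∏_{b ∈ π} p_1 (∏_{i ∈ b} aᵢ)`. -/
def cumulantChain (n : ℕ) : Chain R n :=
  ∑ π : Finpartition (Finset.univ : Finset (Fin n)),
    cumulantCoeff π • Finsupp.single ((blocks π).map fun b => [b]) 1

end Formal

section Realize

variable {R : Type*} [CommRing R]
  {A : Type*} [NonUnitalRing A] [Module R A] [IsScalarTower R A A] [SMulCommClass R A A]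
  {B : Type*} [NonUnitalRing B] [Module R B] [IsScalarTower R B B] [SMulCommClass R B B]
  {DA : DGCA R A} {DB : DGCA R B}

/-- The operation `A^{⊗ n} → B` that a word denotes, for a given `C_∞` morphism. -/
def CInfMorphism.realizeWord (P : CInfMorphism DA DB) {n : ℕ} (w : Word n) : Operation n A B :=
  fun e a => (koszulSign e w.flatten.flatten * w.tensorSign e) •
    nprod (w.map fun b => P.app (b.map fun x => nprod (x.map a)))

/-- The operation `A^{⊗ n} → B` that a chain denotes, for a given `C_∞` morphism. -/
def CInfMorphism.realize (P : CInfMorphism DA DB) {n : ℕ} (z : Chain R n) : Operation n A B :=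
  fun e a => z.sum fun w c => c • P.realizeWord w e a

end Realize

end CInf

end

/-! Everything rests on (iii), the acyclicity of the complex of operations, which holds because one
variable at a time can be split off. Regard a factor as a word in odd letters, a letter being a
multiset of variables, and products of factors as elements of a free algebra (`Cells`). The boundary
`bd` is the odd derivation that merges neighbouring letters and cuts a word in two.

Fix a variable `a`. On one factor, `detach a` takes `a` out of a larger letter and shuffles it, as a
letter of its own, into the part of the word further right. Merging restores the word, up to a
shuffle with the letter `{a}`, which is zero in the quotient (`merge_detach_add_detach_merge`). In
cutting, the shuffles again disappear, and what survives is the cut that leaves `a` alone on the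
right (`cut_detach_add_detachPair_cut`). Extended to an odd derivation `contr a`, this has an
anticommutator with `bd` that is an even derivation, so it is known once it is known on factors. The
outcome, `bdContr_word_sub_mem`, is `bd ∘ contr a + contr a ∘ bd = id - forget a (·) * p_1(a)`
modulo the identifications, on words in which `a` occurs once and no letter is empty. Here `forget
a` deletes the variable. It is multiplicative, preserves the identifications and commutes with `bd`
on such words (`forget_mem_relIdeal`, `forget_bd`).

So if `z` is a cycle, `forget a z` is a cycle in one variable fewer, by induction the boundary of
some `y`, and `contr a z + y * p_1(a)` has boundary `z` (`exists_bd_sub_mem`). With no variables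
left only multiples of the empty product remain, and these are excluded by the condition on the sum
of coefficients. Since `contr a` lengthens one factor by one letter, `p_{m+1}` is all that has to be
added. The coefficients of the homotopy are integers, so the ring is arbitrary; neither `bd ∘ bd =
0` nor the invariance of the identifications under `bd` enters.

For (i), the cumulant is a reduced cycle because its coefficients add up to zero: they are the
linear coefficients of the falling factorials whose sum over all partitions is `X ^ n`
(`sum_cumulantCoeff`). For (ii), the difference of two null-homotopies is a 1-dimensional cycle.

The passage to actual maps is a matter of signs. Merging and cutting never change the order in which
a word lists the variables, so all terms of a boundary share one Koszul sign. The rest is the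
Leibniz rule (`d_wordVal`), together with the graded commutativity of `A` and `B` and the shuffle
relation for the morphism (`realize_eq_zero`). -/

namespace CInf
noncomputable section

/-! ### Tensors in odd letters and the signed shuffle product -/

section ShuffleAlgebra

variable {R : Type*} [CommRing R] {X : Type*}

variable (R X) in
/-- The tensor module on a set of letters: linear combinations of lists of letters. -/
abbrev Tens := List X →₀ R

@[elab_as_elim]
theorem Tens.induction {p : Tens R X → Prop} (t : Tens R X) (zero : p 0)
    (add : ∀ s t, p s → p t → p (s + t)) (smul : ∀ (r : R) t, p t → p (r • t))
    (word : ∀ l, p (Finsupp.single l 1)) : p t := by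
  induction t using Finsupp.induction_linear with
  | zero => exact zero
  | add f g hf hg => exact add f g hf hg
  | single l r => simpa using smul r _ (word l)

/-- Left multiplication by a letter. -/
def consL (y : X) : Tens R X →ₗ[R] Tens R X := Finsupp.lmapDomain R R (List.cons y)

@[simp] theorem consL_single (y : X) (l : List X) (r : R) :
    consL y (Finsupp.single l r) = Finsupp.single (y :: l) r := by
  simp [consL, Finsupp.lmapDomain_apply, Finsupp.mapDomain_single]

/-- The sign `(-1) ^ length`. -/
def alt : Tens R X →ₗ[R] Tens R X :=
  Finsupp.linearCombination R fun l => (-1 : R) ^ l.length • Finsupp.single l 1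

@[simp] theorem alt_single (l : List X) (r : R) :
    alt (Finsupp.single l r) = (-1 : R) ^ l.length • Finsupp.single l r := by
  simp [alt, mul_comm]

@[simp] theorem alt_consL (y : X) (t : Tens R X) : alt (consL y t) = -consL y (alt t) := by
  induction t using Tens.induction with
  | zero => simp
  | add s t hs ht => simp only [map_add, hs, ht]; abel
  | smul r t ht => simp [ht]
  | word l => simp [pow_succ]

@[simp] theorem alt_alt (t : Tens R X) : alt (alt t) = t := by
  induction t using Tens.induction with
  | zero => simp
  | add s t hs ht => simp only [map_add, hs, ht]
  | smul r t ht => simp [ht]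
  | word l => simp [← mul_pow]

variable (R) in
/-- The signed shuffle product of two words, letters being odd. -/
def shuffleWords : List X → List X → Tens R X
  | [], v => Finsupp.single v 1
  | x :: u, [] => Finsupp.single (x :: u) 1
  | x :: u, y :: v => consL x (shuffleWords u (y :: v)) +
      (-1 : R) ^ (u.length + 1) • consL y (shuffleWords (x :: u) v)
termination_by u v => u.length + v.length

@[simp] theorem shuffleWords_nil_left (v : List X) :
    shuffleWords R [] v = Finsupp.single v 1 := by rw [shuffleWords]

@[simp] theorem shuffleWords_nil_right (u : List X) :
    shuffleWords R u [] = Finsupp.single u 1 := by cases u <;> rw [shuffleWords]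

/-- The signed shuffle product. -/
def shuffle : Tens R X →ₗ[R] Tens R X →ₗ[R] Tens R X :=
  Finsupp.linearCombination R fun u => Finsupp.linearCombination R fun v => shuffleWords R u v

@[simp] theorem shuffle_single (u v : List X) :
    shuffle (Finsupp.single u (1 : R)) (Finsupp.single v 1) = shuffleWords R u v := by
  simp [shuffle]

@[simp] theorem shuffle_nil_left (t : Tens R X) : shuffle (Finsupp.single [] 1) t = t := by
  induction t using Tens.induction with
  | zero => simp
  | add s t hs ht => simp only [map_add, hs, ht]
  | smul r t ht => simp [ht]
  | word l => simp

@[simp] theorem shuffle_nil_right (t : Tens R X) : shuffle t (Finsupp.single [] 1) = t := by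
  induction t using Tens.induction with
  | zero => simp
  | add s t hs ht => simp only [map_add, LinearMap.add_apply, hs, ht]
  | smul r t ht => simp [ht]
  | word l => simp

/-- The sign for carrying `y` past `x` and `s` is expressed through `alt`. This makes the recursion
linear in both arguments, so that it applies to tensors and not only to words. -/
theorem shuffle_consL (x y : X) (s t : Tens R X) :
    shuffle (consL x s) (consL y t) =
      consL x (shuffle s (consL y t)) - consL y (shuffle (consL x (alt s)) t) := by
  induction s using Tens.induction with
  | zero => simp
  | add s s' hs ht => simp only [map_add, LinearMap.add_apply, hs, ht]; abel
  | smul r s hs => simp [hs, smul_sub]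
  | word u =>
    induction t using Tens.induction with
    | zero => simp
    | add s t hs ht => simp only [map_add, hs, ht]; abel
    | smul r t ht => simp only [map_smul, ht, smul_sub]
    | word v =>
      simp only [consL_single, shuffle_single, alt_single, map_smul, LinearMap.smul_apply]
      rw [shuffleWords, pow_succ]
      simp [sub_eq_add_neg]

theorem alt_shuffleWords (u v : List X) :
    alt (shuffleWords R u v) = (-1 : R) ^ (u.length + v.length) • shuffleWords R u v := by
  match u, v with
  | [], v => simp
  | x :: u, [] => simp
  | x :: u, y :: v =>
    rw [shuffleWords, map_add, map_smul, alt_consL, alt_consL, alt_shuffleWords u (y :: v),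
      alt_shuffleWords (x :: u) v]
    simp only [map_smul, List.length_cons, smul_add, smul_neg, smul_smul]
    module
termination_by u.length + v.length

theorem alt_shuffle (s t : Tens R X) : alt (shuffle s t) = shuffle (alt s) (alt t) := by
  induction s using Tens.induction with
  | zero => simp
  | add s s' hs ht => simp only [map_add, LinearMap.add_apply, hs, ht]
  | smul r s hs => simp [hs]
  | word u =>
    induction t using Tens.induction with
    | zero => simp
    | add s t hs ht => simp only [map_add, hs, ht]
    | smul r t ht => simp only [map_smul, ht]
    | word v =>
      rw [alt_single, alt_single, shuffle_single, alt_shuffleWords]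
      simp only [map_smul, LinearMap.smul_apply, shuffle_single, smul_smul, pow_add, mul_comm]

/-- Induction on the total length, comparing the terms by their leading letter `x`, `y` or `z`. -/
theorem shuffle_assoc_words (u v w : List X) :
    shuffle (shuffle (Finsupp.single u (1 : R)) (Finsupp.single v 1)) (Finsupp.single w 1) =
      shuffle (Finsupp.single u 1) (shuffle (Finsupp.single v 1) (Finsupp.single w 1)) := by
  match u, v, w with
  | [], v, w => simp
  | x :: u, [], w => simp
  | x :: u, y :: v, [] => simp
  | x :: u, y :: v, z :: w =>
    have h1 := shuffle_assoc_words u (y :: v) (z :: w)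
    have h2 := shuffle_assoc_words (x :: u) v (z :: w)
    have h3 := shuffle_assoc_words (x :: u) (y :: v) w
    simp only [← consL_single] at h1 h2 h3 ⊢
    -- The terms led by `z` come from two places, according to whether `x` or `y` leads the inner
    -- product. Read backwards, the recursion recombines them into the product of the two full
    -- words, to which `h3` applies.
    have e : consL x (alt (shuffle (Finsupp.single u (1 : R)) (consL y (Finsupp.single v 1)))) -
        consL y (alt (shuffle (consL x (alt (Finsupp.single u (1 : R)))) (Finsupp.single v 1)))
        = - shuffle (alt (consL x (Finsupp.single u 1))) (alt (consL y (Finsupp.single v 1))) := by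
      rw [← alt_shuffle, shuffle_consL, map_sub, alt_consL, alt_consL]
      abel
    have e' := congrArg (fun t => consL z (shuffle t (Finsupp.single w (1 : R)))) e
    simp only [map_sub, LinearMap.sub_apply, map_neg, LinearMap.neg_apply] at e'
    rw [shuffle_consL x y, map_sub, LinearMap.sub_apply, shuffle_consL, shuffle_consL,
      shuffle_consL y z, map_sub, shuffle_consL, shuffle_consL, h1, shuffle_consL y z, map_sub,
      map_sub]
    simp only [alt_single, alt_consL, map_smul, map_neg, LinearMap.neg_apply, LinearMap.smul_apply,
      h2, h3] at e' ⊢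
    linear_combination (norm := module) -e'
termination_by u.length + v.length + w.length

theorem shuffle_assoc (s t r : Tens R X) :
    shuffle (shuffle s t) r = shuffle s (shuffle t r) := by
  induction s using Tens.induction with
  | zero => simp
  | add s s' hs ht => simp only [map_add, LinearMap.add_apply, hs, ht]
  | smul r s hs => simp [hs]
  | word u =>
    induction t using Tens.induction with
    | zero => simp
    | add s t hs ht => simp only [map_add, LinearMap.add_apply, hs, ht]
    | smul r t ht => simp only [map_smul, LinearMap.smul_apply, ht]
    | word v =>
      induction r using Tens.induction with
      | zero => simp
      | add s t hs ht => simp only [map_add, hs, ht]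
      | smul r t ht => simp only [map_smul, ht]
      | word w => exact shuffle_assoc_words u v w

/-- Shuffling a letter into a tensor. -/
def ins (a : X) : Tens R X →ₗ[R] Tens R X := shuffle (Finsupp.single [a] 1)

@[simp] theorem ins_nil (a : X) : ins a (Finsupp.single [] (1 : R)) = Finsupp.single [a] 1 := by
  simp [ins]

theorem ins_consL (a y : X) (t : Tens R X) :
    ins a (consL y t) = consL a (consL y t) - consL y (ins a t) := by
  rw [ins, ← consL_single, shuffle_consL]
  simp

theorem alt_ins (a : X) (t : Tens R X) : alt (ins a t) = -ins a (alt t) := by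
  simp [ins, alt_shuffle]

theorem ins_shuffle (a : X) (s t : Tens R X) :
    ins a (shuffle s t) = shuffle (ins a s) t := (shuffle_assoc _ _ _).symm

/-- The one case of graded commutativity of shuffles that is needed; `alt` records the cost of
carrying an odd letter across `t`. -/
theorem shuffle_letter (a : X) (t : Tens R X) :
    shuffle t (Finsupp.single [a] 1) = ins a (alt t) := by
  induction t using Tens.induction with
  | zero => simp
  | add s s' hs ht => simp only [map_add, LinearMap.add_apply, hs, ht]
  | smul r s hs => simp [hs]
  | word u =>
    induction u with
    | nil => simp
    | cons y u ih =>
      rw [← consL_single, alt_consL, map_neg, ins_consL, ← consL_single a, shuffle_consL,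
        consL_single a, ih]
      simp

theorem ins_shuffle_right (a : X) (s t : Tens R X) :
    ins a (shuffle s t) = shuffle (alt s) (ins a t) := by
  rw [ins, ← shuffle_assoc, ← shuffle_assoc, shuffle_letter, alt_alt]
  rfl

variable (R X) in
/-- The span of the signed shuffles of nonempty words. -/
def shuffleSpan : Submodule R (Tens R X) :=
  Submodule.span R {t | ∃ u v : List X, u ≠ [] ∧ v ≠ [] ∧ t = shuffleWords R u v}

theorem ins_mem_shuffleSpan (a : X) (l : List X) (hl : l ≠ []) :
    ins a (Finsupp.single l (1 : R)) ∈ shuffleSpan R X :=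
  Submodule.subset_span ⟨[a], l, by simp, hl, by simp [ins]⟩

end ShuffleAlgebra
-- Merging neighbouring letters
section Merge

variable {R : Type*} [CommRing R] {X : Type*} [AddCommMonoid X]

/-- Add `y` to the first letter. -/
def mergeFirst (y : X) : Tens R X →ₗ[R] Tens R X :=
  Finsupp.linearCombination R fun l => match l with
    | [] => 0
    | z :: l => Finsupp.single ((y + z) :: l) 1

@[simp] theorem mergeFirst_nil (y : X) : mergeFirst y (Finsupp.single [] (1 : R)) = 0 := by
  simp [mergeFirst]

@[simp] theorem mergeFirst_consL (y z : X) (t : Tens R X) :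
    mergeFirst y (consL z t) = consL (y + z) t := by
  induction t using Tens.induction with
  | zero => simp
  | add s s' hs ht => simp only [map_add, hs, ht]
  | smul r s hs => simp [hs]
  | word u => simp [mergeFirst]

variable (R) in
/-- The alternating sum of the words obtained by adding two neighbouring letters. -/
def mergeWord : List X → Tens R X
  | [] => 0
  | y :: l => mergeFirst y (Finsupp.single l 1) - consL y (mergeWord l)

/-- The linear extension of `mergeWord`. -/
def merge : Tens R X →ₗ[R] Tens R X := Finsupp.linearCombination R (mergeWord R)

@[simp] theorem merge_nil : merge (Finsupp.single ([] : List X) (1 : R)) = 0 := by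
  simp [merge, mergeWord]

theorem merge_consL (y : X) (t : Tens R X) :
    merge (consL y t) = mergeFirst y t - consL y (merge t) := by
  induction t using Tens.induction with
  | zero => simp
  | add s s' hs ht => simp only [map_add, hs, ht]; abel
  | smul r s hs => simp [hs, smul_sub]
  | word u => simp [merge, mergeWord]

/-- The letter `a` is inserted both before and after each letter `y`, with opposite signs, and `a +
y = y + a`, so all mergers that involve `a` cancel. Those between letters of `t` remain. -/
theorem merge_ins (a : X) (t : Tens R X) : merge (ins a t) = -ins a (merge t) := by
  induction t using Tens.induction with
  | zero => simp
  | add s s' hs ht => simp only [map_add, hs, ht]; abel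
  | smul r s hs => simp [hs]
  | word u =>
    induction u with
    | nil =>
      rw [ins_nil, ← consL_single, merge_consL]
      simp
    | cons y u ih =>
      cases u with
      | nil =>
        simp only [← consL_single, ins_consL, map_sub, merge_consL, mergeFirst_consL,
          ins_nil, add_comm a y]
        simp
      | cons z u =>
        have e := congrArg (consL y) ih
        simp only [← consL_single, ins_consL, map_sub, merge_consL, mergeFirst_consL, map_neg,
          add_comm a y] at e ⊢
        linear_combination (norm := module) e

end Merge

/-! ### Detaching a variable: the contracting homotopy on one factor -/

section Detach

/-- This is where nonempty letters are needed: a merged letter is never a lone variable, so a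
variable in it can always be detached. -/
theorem add_ne_singleton {α : Type*} {a : α} {y z : Multiset α} (hy : y ≠ 0) (hz : z ≠ 0) :
    y + z ≠ {a} := by
  intro h
  have h1 := congrArg Multiset.card h
  have h2 := Multiset.card_pos.2 hy
  have h3 := Multiset.card_pos.2 hz
  simp at h1
  omega

variable {R : Type*} [CommRing R] {α : Type*} [DecidableEq α]

variable (R) in
/-- Left multiplication by `y - {a}`, if this is a proper nonempty part of `y`. -/
def pull (a : α) (y : Multiset α) : Tens R (Multiset α) →ₗ[R] Tens R (Multiset α) :=
  if a ∈ y ∧ y ≠ {a} then consL (y.erase a) else 0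

theorem pull_of_notMem {a : α} {y : Multiset α} (h : a ∉ y) : pull R a y = 0 := by
  simp [pull, h]

@[simp] theorem pull_self (a : α) : pull R a {a} = 0 := by
  simp [pull]

theorem pull_of_mem {a : α} {y : Multiset α} (h : a ∈ y) (h' : y ≠ {a}) :
    pull R a y = consL (y.erase a) := by
  simp [pull, h, h']

theorem alt_pull (a : α) (y : Multiset α) (t : Tens R (Multiset α)) :
    alt (pull R a y t) = -pull R a y (alt t) := by
  unfold pull
  split_ifs <;> simp

theorem shuffle_pull_consL (a : α) (y z : Multiset α) (s t : Tens R (Multiset α)) :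
    shuffle (pull R a y s) (consL z t) =
      pull R a y (shuffle s (consL z t)) - consL z (shuffle (pull R a y (alt s)) t) := by
  unfold pull
  split_ifs <;> simp [shuffle_consL]

theorem shuffle_consL_pull (a : α) (y z : Multiset α) (s t : Tens R (Multiset α)) :
    shuffle (consL y s) (pull R a z t) =
      consL y (shuffle s (pull R a z t)) - pull R a z (shuffle (consL y (alt s)) t) := by
  unfold pull
  split_ifs <;> simp [shuffle_consL]

variable (R) in
/-- The sum, over the occurrences of `a` in a letter `y ≠ {a}`, of the words in which this `a` is
removed from `y` and inserted as a letter at some place further to the right. -/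
def detachWord (a : α) : List (Multiset α) → Tens R (Multiset α)
  | [] => 0
  | y :: l => pull R a y (ins {a} (Finsupp.single l 1)) - consL y (detachWord a l)

/-- The linear extension of `detachWord`. -/
def detach (a : α) : Tens R (Multiset α) →ₗ[R] Tens R (Multiset α) :=
  Finsupp.linearCombination R (detachWord R a)

@[simp] theorem detach_nil (a : α) : detach a (Finsupp.single [] (1 : R)) = 0 := by
  simp [detach, detachWord]

theorem detach_consL (a : α) (y : Multiset α) (t : Tens R (Multiset α)) :
    detach a (consL y t) = pull R a y (ins {a} t) - consL y (detach a t) := by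
  induction t using Tens.induction with
  | zero => simp
  | add s s' hs ht => simp only [map_add, hs, ht]; abel
  | smul r s hs => simp [hs, smul_sub]
  | word u => simp [detach, detachWord]

theorem alt_detach (a : α) (t : Tens R (Multiset α)) :
    alt (detach a t) = -detach a (alt t) := by
  induction t using Tens.induction with
  | zero => simp
  | add s s' hs ht => simp only [map_add, hs, ht]; abel
  | smul r s hs => simp [hs]
  | word u =>
    induction u with
    | nil => simp
    | cons y u ih =>
      simp only [← consL_single, detach_consL, map_sub, alt_consL, map_neg, ih, alt_pull, alt_ins]
      abel

/-- Compare leading letters. If `a` is detached from the leading letter, it is inserted into the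
shuffle of everything else. By associativity this insertion can be moved into the word that the
letter came from, with a sign if that is the second one. -/
theorem detach_shuffleWords (a : α) (u w : List (Multiset α)) :
    detach a (shuffle (Finsupp.single u (1 : R)) (Finsupp.single w 1)) =
      shuffle (detach a (Finsupp.single u 1)) (Finsupp.single w 1) +
        shuffle (alt (Finsupp.single u 1)) (detach a (Finsupp.single w 1)) := by
  match u, w with
  | [], w => simp
  | y :: u, [] => simp
  | y :: u, z :: w =>
    have h1 := detach_shuffleWords a u (z :: w)
    have h2 := detach_shuffleWords a (y :: u) w
    simp only [← consL_single] at h1 h2 ⊢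
    -- On a word `alt` is a scalar, so the inductive hypothesis carries over to `alt u`.
    have h2' : detach a (shuffle (consL y (alt (Finsupp.single u (1 : R)))) (Finsupp.single w 1)) =
      shuffle (detach a (consL y (alt (Finsupp.single u 1)))) (Finsupp.single w 1) +
        shuffle (alt (consL y (alt (Finsupp.single u 1)))) (detach a (Finsupp.single w 1)) := by
      simp only [alt_single, map_smul, LinearMap.smul_apply, h2, smul_add]
    rw [shuffle_consL, map_sub, detach_consL, detach_consL, h1, h2']
    simp only [alt_consL, map_sub, LinearMap.sub_apply, map_neg, LinearMap.neg_apply, detach_consL,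
      shuffle_pull_consL, shuffle_consL_pull, shuffle_consL, ins_shuffle, map_add,
      alt_ins, alt_alt, alt_detach]
    rw [← ins_shuffle, ← ins_shuffle, ins_shuffle_right _ (consL y _)]
    simp only [alt_consL, map_neg, LinearMap.neg_apply, alt_alt]
    abel

theorem detach_shuffle (a : α) (s t : Tens R (Multiset α)) :
    detach a (shuffle s t) = shuffle (detach a s) t + shuffle (alt s) (detach a t) := by
  induction s using Tens.induction with
  | zero => simp
  | add s s' hs ht => simp only [map_add, LinearMap.add_apply, hs, ht]; abel
  | smul r s hs => simp [hs]
  | word u =>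
    induction t using Tens.induction with
    | zero => simp
    | add s s' hs ht => simp only [map_add, hs, ht]; abel
    | smul r s hs => simp only [map_smul, hs, smul_add]
    | word w => exact detach_shuffleWords a u w

theorem detach_eq_zero {a : α} {l : List (Multiset α)} (h : a ∉ l.sum) :
    detach a (Finsupp.single l (1 : R)) = 0 := by
  induction l with
  | nil => simp
  | cons y l ih =>
    simp only [List.sum_cons, Multiset.mem_add, not_or] at h
    rw [← consL_single, detach_consL, ih h.2, pull_of_notMem h.1]
    simp

theorem detach_merge_eq_zero {a : α} {l : List (Multiset α)} (h : a ∉ l.sum) :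
    detach a (merge (Finsupp.single l (1 : R))) = 0 := by
  induction l with
  | nil => simp
  | cons y l ih =>
    simp only [List.sum_cons, Multiset.mem_add, not_or] at h
    rw [← consL_single, merge_consL, map_sub, detach_consL, ih h.2, pull_of_notMem h.1]
    cases l with
    | nil => simp
    | cons z l =>
      simp only [List.sum_cons, Multiset.mem_add, not_or] at h
      rw [← consL_single z, mergeFirst_consL, consL_single, detach_eq_zero]
      · simp
      · simp [h]

variable (R) in
/-- The correction term in `detach_merge`. -/
def leadTerm (a : α) : List (Multiset α) → Tens R (Multiset α)
  | [] => 0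
  | y :: l => if y = {a} then ins {a} (Finsupp.single l 1) else 0

/-- If `a` sits in a larger letter, putting the detached `a` back there gives the word, and all
other mergers cancel by `merge_ins` or against detaching after merging. If `{a}` is a letter with a
left neighbour, merging the two and detaching again gives the word. As first letter `{a}` can only
be merged to the right, and detaching then never returns it to the front; the defect is the whole
shuffle of `{a}` with the rest. -/
theorem merge_detach_add_detach_merge {a : α} {l : List (Multiset α)} (h : l.sum.count a = 1)
    (h0 : 0 ∉ l) :
    merge (detach a (Finsupp.single l (1 : R))) + detach a (merge (Finsupp.single l 1)) =
      Finsupp.single l 1 - leadTerm R a l := by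
  induction l with
  | nil => simp at h
  | cons y l ih =>
    rw [List.sum_cons, Multiset.count_add] at h
    rw [List.mem_cons, not_or, ← Ne, ne_comm] at h0
    by_cases hy : a ∈ y
    · have hy1 : y.count a = 1 := by
        have := Multiset.count_pos.2 hy
        omega
      have hl : a ∉ l.sum := by
        rw [← Multiset.count_eq_zero]; omega
      rw [← consL_single, merge_consL, detach_consL, detach_eq_zero hl, map_zero, sub_zero, map_sub,
        detach_consL, detach_merge_eq_zero hl]
      by_cases hya : y = {a}
      · subst hya
        simp only [pull_self, leadTerm, if_true]
        cases l with
        | nil => simp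
        | cons z l =>
          simp only [List.sum_cons, Multiset.mem_add, not_or] at hl
          have hz : {a} + z ≠ {a} := add_ne_singleton h0.1 fun h => h0.2 (by simp [h])
          have hz' : a ∈ {a} + z := by simp
          simp only [← consL_single, mergeFirst_consL, detach_consL, detach_eq_zero hl.2, ins_consL,
            pull_of_mem hz' hz]
          simp
      · rw [pull_of_mem hy hya, merge_consL, merge_ins]
        cases l with
        | nil =>
          have : y.erase a + {a} = y := by
            rw [add_comm, Multiset.singleton_add, Multiset.cons_erase hy]
          simp only [ins_nil, ← consL_single, mergeFirst_consL, this, leadTerm, if_neg hya]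
          simp
        | cons z l =>
          simp only [List.sum_cons, Multiset.mem_add, not_or] at hl
          have hz' : a ∈ y + z := by simp [hy]
          have hz : y + z ≠ {a} := add_ne_singleton h0.1 fun h => h0.2 (by simp [h])
          have e1 : y.erase a + {a} = y := by
            rw [add_comm, Multiset.singleton_add, Multiset.cons_erase hy]
          have e2 : (y + z).erase a = y.erase a + z := Multiset.erase_add_left_pos _ hy
          simp only [← consL_single, mergeFirst_consL, detach_consL, detach_eq_zero hl.2, ins_consL,
            pull_of_mem hz' hz, map_sub, e1, e2, leadTerm, if_neg hya]
          simp
    · have hl : l.sum.count a = 1 := by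
        rw [Multiset.count_eq_zero_of_notMem hy] at h; omega
      have hya : y ≠ {a} := by
        rintro rfl; simp at hy
      cases l with
      | nil => simp at hl
      | cons z l =>
        specialize ih hl h0.2
        have e := congrArg (consL y) ih
        simp only [map_add, map_sub] at e
        rw [← consL_single, merge_consL, detach_consL, pull_of_notMem hy, map_sub, map_sub,
          detach_consL _ y (merge _), pull_of_notMem hy, merge_consL y, leadTerm, if_neg hya]
        simp only [LinearMap.zero_apply, zero_sub, map_zero, sub_zero]
        -- Adding `y` to the next letter commutes with detaching unless that letter is `{a}`, which
        -- becomes detachable only through the merger. This absorbs the correction term of the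
        -- shorter word.
        have key : detach a (mergeFirst y (Finsupp.single (z :: l) (1 : R))) -
            mergeFirst y (detach a (Finsupp.single (z :: l) 1)) =
            consL y (leadTerm R a (z :: l)) := by
          rw [← consL_single, mergeFirst_consL, detach_consL, detach_consL, map_sub,
            mergeFirst_consL, leadTerm]
          by_cases hz : z = {a}
          · subst hz
            have h1 : a ∈ y + {a} := by simp
            have h2 : y + {a} ≠ {a} := add_ne_singleton h0.1 (by simp)
            rw [pull_of_mem h1 h2, pull_self]
            simp [Multiset.erase_add_right_neg _ hy]
          · rw [if_neg hz]
            by_cases haz : a ∈ z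
            · have h1 : a ∈ y + z := by simp [haz]
              have h2 : y + z ≠ {a} := add_ne_singleton h0.1 fun h => h0.2 (by simp [h])
              rw [pull_of_mem h1 h2, pull_of_mem haz hz, mergeFirst_consL,
                Multiset.erase_add_right_neg _ hy]
              simp
            · have h1 : a ∉ y + z := by simp [haz, hy]
              rw [pull_of_notMem h1, pull_of_notMem haz]
              simp
        linear_combination (norm := module) e + key

end Detach
-- Cutting a word in two
section Deconcatenation

variable {R : Type*} [CommRing R] {X : Type*}

variable (R X) in
/-- Linear combinations of pairs of words. -/
abbrev TensPair := (List X × List X) →₀ R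

/-- The pairing of two tensors. -/
def pair : Tens R X →ₗ[R] Tens R X →ₗ[R] TensPair R X :=
  Finsupp.linearCombination R fun p => Finsupp.linearCombination R fun q => Finsupp.single (p, q) 1

theorem pair_single (p q : List X) :
    pair (Finsupp.single p (1 : R)) (Finsupp.single q 1) = Finsupp.single (p, q) 1 := by
  simp [pair]

@[elab_as_elim]
theorem TensPair.induction {P : TensPair R X → Prop} (z : TensPair R X) (zero : P 0)
    (add : ∀ s t, P s → P t → P (s + t)) (pair : ∀ s t, P (pair s t)) : P z := by
  induction z using Finsupp.induction_linear with
  | zero => exact zero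
  | add f g hf hg => exact add f g hf hg
  | single l r =>
    have := pair (r • Finsupp.single l.1 1) (Finsupp.single l.2 1)
    rw [map_smul, LinearMap.smul_apply, pair_single] at this
    simpa using this

/-- Apply linear maps to both components of pairs. -/
def mapPair (f g : Tens R X →ₗ[R] Tens R X) : TensPair R X →ₗ[R] TensPair R X :=
  Finsupp.linearCombination R fun z =>
    pair (f (Finsupp.single z.1 1)) (g (Finsupp.single z.2 1))

@[simp] theorem mapPair_pair (f g : Tens R X →ₗ[R] Tens R X) (s t : Tens R X) :
    mapPair f g (pair s t) = pair (f s) (g t) := by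
  induction s using Tens.induction with
  | zero => simp
  | add s s' hs ht => simp only [map_add, LinearMap.add_apply, hs, ht]
  | smul r s hs => simp [hs]
  | word u =>
    induction t using Tens.induction with
    | zero => simp
    | add s s' hs ht => simp only [map_add, hs, ht]
    | smul r s hs => simp only [map_smul, hs]
    | word w => simp [pair_single, mapPair]

@[simp] theorem mapPair_zero (g : Tens R X →ₗ[R] Tens R X) : mapPair 0 g = 0 := by
  refine LinearMap.ext fun z => ?_
  induction z using TensPair.induction with
  | zero => simp
  | add s t hs ht => simp only [map_add, hs, ht]
  | pair s t => simp

/-- Apply a linear map to the first component of pairs. -/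
abbrev mapLeft (f : Tens R X →ₗ[R] Tens R X) : TensPair R X →ₗ[R] TensPair R X :=
  mapPair f LinearMap.id

variable (R) in
/-- The alternating sum of the ways of cutting a word into a word and a nonempty word. -/
def cutWord : List X → TensPair R X
  | [] => 0
  | y :: l => pair (Finsupp.single [] 1) (Finsupp.single (y :: l) 1) -
      mapLeft (consL y) (cutWord l)

/-- The linear extension of `cutWord`. -/
def cut : Tens R X →ₗ[R] TensPair R X := Finsupp.linearCombination R (cutWord R)

@[simp] theorem cut_nil : cut (Finsupp.single ([] : List X) (1 : R)) = 0 := by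
  simp [cut, cutWord]

/-- This recursion is the reason for allowing an empty left piece; `factorBd` subtracts that term
again. -/
theorem cut_consL (y : X) (t : Tens R X) :
    cut (consL y t) = pair (Finsupp.single [] 1) (consL y t) - mapLeft (consL y) (cut t) := by
  induction t using Tens.induction with
  | zero => simp
  | add s s' hs ht => simp only [map_add, hs, ht]; abel
  | smul r s hs => simp [hs, smul_sub]
  | word u => simp [cut, cutWord]

variable (R X) in
/-- The tensors whose second factor is a combination of shuffles. -/
def cutNull : Submodule R (TensPair R X) :=
  Submodule.span R {z | ∃ t, ∃ s ∈ shuffleSpan R X, z = pair t s}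

theorem mapLeft_mem_cutNull (f : Tens R X →ₗ[R] Tens R X) {z : TensPair R X}
    (hz : z ∈ cutNull R X) : mapLeft f z ∈ cutNull R X := by
  induction hz using Submodule.span_induction with
  | mem z h =>
    obtain ⟨t, s, hs, rfl⟩ := h
    exact Submodule.subset_span ⟨f t, s, hs, by simp⟩
  | zero => simp
  | add x y _ _ hx hy => rw [map_add]; exact add_mem hx hy
  | smul r x _ hx => rw [map_smul]; exact Submodule.smul_mem _ _ hx

theorem mapLeft_ins_mapLeft_consL (a y : X) (z : TensPair R X) :
    mapLeft (ins a) (mapLeft (consL y) z) =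
      mapLeft (consL a) (mapLeft (consL y) z) - mapLeft (consL y) (mapLeft (ins a) z) := by
  induction z using TensPair.induction with
  | zero => simp
  | pair x y => simp [ins_consL]
  | add x y hx hy => simp only [map_add, hx, hy]; abel

/-- After the cut, `a` lies in the left piece, or shuffled into a nonempty right piece, which is
null, or it is the whole right piece. The last possibility is the term that is subtracted. -/
theorem cut_ins (a : X) (l : List X) :
    cut (ins a (Finsupp.single l (1 : R))) + mapLeft (ins a) (cut (Finsupp.single l 1)) -
      pair (Finsupp.single l 1) (Finsupp.single [a] 1) ∈ cutNull R X := by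
  induction l with
  | nil =>
    rw [ins_nil, ← consL_single, cut_consL, cut_nil]
    simp [-consL_single]
  | cons y l ih =>
    have h1 := mapLeft_mem_cutNull (consL y) ih
    have h2 : pair (Finsupp.single ([] : List X) (1 : R)) (ins a (Finsupp.single (y :: l) 1)) ∈
        cutNull R X :=
      Submodule.subset_span ⟨_, _, ins_mem_shuffleSpan a (y :: l) (by simp), rfl⟩
    convert add_mem h1 h2 using 1
    simp only [← consL_single, ins_consL, map_sub, map_add, cut_consL, mapLeft_ins_mapLeft_consL,
      mapPair_pair, ins_nil]
    abel

end Deconcatenation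

/-! ### Erasing a variable; detaching versus cutting -/

section Erase
variable {R : Type*} [CommRing R] {α : Type*} [DecidableEq α]

variable (R) in
/-- Remove `a` from all letters; the result is zero if `{a}` is among the letters. -/
def eraseWord (a : α) (l : List (Multiset α)) : Tens R (Multiset α) :=
  if {a} ∈ l then 0 else Finsupp.single (l.map (Multiset.filter (· ≠ a))) 1

/-- The linear extension of `eraseWord`. -/
def eraseLetter (a : α) : Tens R (Multiset α) →ₗ[R] Tens R (Multiset α) :=
  Finsupp.linearCombination R (eraseWord R a)

theorem eraseLetter_single (a : α) (l : List (Multiset α)) :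
    eraseLetter a (Finsupp.single l (1 : R)) = eraseWord R a l := by
  simp [eraseLetter]

@[simp] theorem eraseLetter_nil (a : α) :
    eraseLetter a (Finsupp.single [] (1 : R)) = Finsupp.single [] 1 := by
  simp [eraseLetter_single, eraseWord]

theorem eraseLetter_consL_self (a : α) (t : Tens R (Multiset α)) :
    eraseLetter a (consL {a} t) = 0 := by
  induction t using Tens.induction with
  | zero => simp
  | add s s' hs ht => simp only [map_add, hs, ht, add_zero]
  | smul r s hs => simp [hs]
  | word u => simp [eraseLetter, eraseWord]

theorem eraseLetter_consL {a : α} {y : Multiset α} (hy : y ≠ {a}) (t : Tens R (Multiset α)) :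
    eraseLetter a (consL y t) = consL (y.filter (· ≠ a)) (eraseLetter a t) := by
  induction t using Tens.induction with
  | zero => simp
  | add s s' hs ht => simp only [map_add, hs, ht]
  | smul r s hs => simp [hs]
  | word u =>
    rw [consL_single, eraseLetter_single, eraseLetter_single, eraseWord, eraseWord]
    simp only [List.mem_cons, hy.symm, false_or, List.map_cons]
    split_ifs <;> simp

theorem alt_eraseLetter (a : α) (t : Tens R (Multiset α)) :
    alt (eraseLetter a t) = eraseLetter a (alt t) := by
  induction t using Tens.induction with
  | zero => simp
  | add s s' hs ht => simp only [map_add, hs, ht]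
  | smul r s hs => simp [hs]
  | word u =>
    rw [alt_single, map_smul, eraseLetter_single, eraseWord]
    split_ifs <;> simp

/-- Erasing acts on each letter separately, with `{a}` sent to zero, and a substitution of letters
respects shuffles. -/
theorem eraseLetter_shuffle_words (a : α) (u w : List (Multiset α)) :
    eraseLetter a (shuffle (Finsupp.single u (1 : R)) (Finsupp.single w 1)) =
      shuffle (eraseLetter a (Finsupp.single u 1)) (eraseLetter a (Finsupp.single w 1)) := by
  match u, w with
  | [], w => simp
  | y :: u, [] => simp
  | y :: u, z :: w =>
    have h1 := eraseLetter_shuffle_words a u (z :: w)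
    have h2 := eraseLetter_shuffle_words a (y :: u) w
    simp only [← consL_single] at h1 h2 ⊢
    have h2' : eraseLetter a (shuffle (consL y (alt (Finsupp.single u (1 : R))))
        (Finsupp.single w 1)) = shuffle (eraseLetter a (consL y (alt (Finsupp.single u 1))))
          (eraseLetter a (Finsupp.single w 1)) := by
      simp only [alt_single, map_smul, LinearMap.smul_apply, h2]
    rw [shuffle_consL, map_sub]
    by_cases hy : y = {a}
    · subst hy
      by_cases hz : z = {a}
      · subst hz
        simp only [eraseLetter_consL_self, map_zero, sub_zero]
      · simp only [eraseLetter_consL_self, eraseLetter_consL hz, h2', LinearMap.zero_apply, map_zero,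
          sub_zero]
    · by_cases hz : z = {a}
      · subst hz
        simp only [eraseLetter_consL_self, eraseLetter_consL hy, h1]
        simp
      · rw [eraseLetter_consL hy, eraseLetter_consL hz, h1, h2', eraseLetter_consL hy,
          eraseLetter_consL hz, eraseLetter_consL hy, shuffle_consL, alt_eraseLetter]

theorem eraseLetter_shuffleWords_mem (a : α) {u w : List (Multiset α)} (hu : u ≠ [])
    (hw : w ≠ []) : eraseLetter a (shuffleWords R u w) ∈ shuffleSpan R (Multiset α) := by
  rw [← shuffle_single, eraseLetter_shuffle_words, eraseLetter_single, eraseLetter_single,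
    eraseWord, eraseWord]
  split_ifs
  · simp
  · simp
  · simp
  · exact Submodule.subset_span ⟨_, _, by simpa using hu, by simpa using hw, shuffle_single _ _⟩

/-- The coderivation of pairs of words induced by `detach`. -/
def detachPair (a : α) : TensPair R (Multiset α) →ₗ[R]
    TensPair R (Multiset α) :=
  mapLeft (detach a) - mapPair alt (detach a)

theorem detachPair_consL (a : α) (y : Multiset α)
    (z : TensPair R (Multiset α)) :
    detachPair a (mapLeft (consL y) z) =
      mapLeft (pull R a y) (mapLeft (ins {a}) z) - mapLeft (consL y) (detachPair a z) := by
  induction z using TensPair.induction with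
  | zero => simp
  | pair x y => simp [detachPair, detach_consL]; abel
  | add x y hx hy => simp only [map_add, hx, hy]; abel

theorem detachPair_cut_eq_zero {a : α} {l : List (Multiset α)} (h : a ∉ l.sum) :
    detachPair a (cut (Finsupp.single l (1 : R))) = 0 := by
  induction l with
  | nil => simp
  | cons y l ih =>
    have h' := h
    simp only [List.sum_cons, Multiset.mem_add, not_or] at h
    rw [← consL_single, cut_consL, map_sub, detachPair_consL, ih h.2, pull_of_notMem h.1,
      consL_single]
    simp [detachPair, detach_eq_zero h']

/-- If the cut does not separate `a` from its old letter, the term is matched by detaching inside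
one of the two pieces. If it does, the right piece is a shuffle of `{a}` with the rest of the word,
hence null unless this rest is empty. That leaves the erased word next to the single letter `{a}`.
-/
theorem cut_detach_add_detachPair_cut {a : α} {l : List (Multiset α)} (h : l.sum.count a = 1) :
    cut (detach a (Finsupp.single l (1 : R))) + detachPair a (cut (Finsupp.single l 1)) +
      pair (eraseWord R a l) (Finsupp.single [{a}] 1) ∈ cutNull R (Multiset α) := by
  induction l with
  | nil => simp at h
  | cons y l ih =>
    rw [List.sum_cons, Multiset.count_add] at h
    by_cases hy : a ∈ y
    · have hy1 : y.count a = 1 := by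
        have := Multiset.count_pos.2 hy
        omega
      have hl : a ∉ l.sum := by
        rw [← Multiset.count_eq_zero]; omega
      have hd : detachPair a (pair (Finsupp.single [] (1 : R)) (consL y (Finsupp.single l 1))) =
          -pair (Finsupp.single [] (1 : R)) (pull R a y (ins {a} (Finsupp.single l 1))) := by
        simp only [detachPair, LinearMap.sub_apply, mapPair_pair, detach_nil, map_zero, LinearMap.zero_apply,
          mapPair_pair, detach_consL, detach_eq_zero hl]
        simp
      rw [← eraseLetter_single, ← consL_single, cut_consL, map_sub, detachPair_consL, detach_consL,
        detach_eq_zero hl, map_zero, sub_zero, detachPair_cut_eq_zero hl, map_zero, hd]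
      by_cases hya : y = {a}
      · subst hya
        simp [eraseLetter_consL_self, -consL_single]
      · rw [pull_of_mem hy hya, cut_consL, eraseLetter_consL hya, eraseLetter_single, eraseWord]
        have e1 : y.erase a = y.filter (· ≠ a) := by
          rw [← Multiset.cons_erase hy, Multiset.filter_cons_of_neg _ (by simp),
            Multiset.erase_cons_head, Multiset.filter_eq_self.2]
          intro b hb hba
          subst hba
          rw [← Multiset.count_pos, Multiset.count_erase_self] at hb
          omega
        have e2 : l.map (Multiset.filter (· ≠ a)) = l := by
          refine (List.map_congr_left fun z hz => Multiset.filter_eq_self.2 ?_).trans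
            (List.map_id' l)
          rintro b hb rfl
          exact hl (Multiset.mem_of_le (List.single_le_sum (by simp) z hz) hb)
        have e3 : {a} ∉ l := by
          intro h
          exact hl (Multiset.mem_of_le (List.single_le_sum (by simp) _ h) (by simp))
        rw [if_neg e3, e2, ← e1]
        have h1 := mapLeft_mem_cutNull (consL (y.erase a)) (cut_ins {a} l (R := R))
        convert neg_mem h1 using 1
        simp only [map_sub, map_add, mapPair_pair]
        abel
    · have hl : l.sum.count a = 1 := by
        rw [Multiset.count_eq_zero_of_notMem hy] at h; omega
      have hya : y ≠ {a} := by
        rintro rfl; simp at hy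
      have e1 : y.filter (· ≠ a) = y  := by
        refine Multiset.filter_eq_self.2 ?_
        rintro b hb rfl
        exact hy hb
      have hd : detachPair a (pair (Finsupp.single [] (1 : R)) (consL y (Finsupp.single l 1))) =
          pair (Finsupp.single [] (1 : R)) (consL y (detach a (Finsupp.single l 1))) := by
        simp only [detachPair, LinearMap.sub_apply, mapPair_pair, detach_nil, map_zero, LinearMap.zero_apply,
          mapPair_pair, detach_consL, pull_of_notMem hy]
        simp
      have h1 := mapLeft_mem_cutNull (consL y) (ih hl)
      rw [← eraseLetter_single] at h1 ⊢
      rw [← consL_single, cut_consL, map_sub, detachPair_consL, detach_consL, hd,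
        pull_of_notMem hy, eraseLetter_consL hya, e1]
      convert h1 using 1
      simp only [map_add, map_neg, mapPair_pair, LinearMap.zero_apply, zero_sub,
        cut_consL, mapPair_zero, LinearMap.id_apply]
      abel

end Erase
-- The free algebra on factors, odd derivations and the ideal of identifications
section Cells

variable {R : Type*} [CommRing R] {X : Type*}

variable (R X) in
/-- Formal combinations of products of factors, a factor being a list of letters. -/
abbrev Cells := MonoidAlgebra R (FreeMonoid (List X))

variable (R) in
/-- The product of the factors in the list `w`. -/
def word (w : List (List X)) : Cells R X := MonoidAlgebra.single (FreeMonoid.ofList w) 1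

@[simp] theorem word_nil : word R ([] : List (List X)) = 1 := rfl

theorem word_append (u v : List (List X)) : word R (u ++ v) = word R u * word R v := by
  simp [word]

theorem word_cons (b : List X) (w : List (List X)) : word R (b :: w) = word R [b] * word R w :=
  word_append [b] w

@[elab_as_elim]
theorem Cells.induction {p : Cells R X → Prop} (t : Cells R X) (zero : p 0)
    (add : ∀ s t, p s → p t → p (s + t)) (smul : ∀ (r : R) t, p t → p (r • t))
    (word : ∀ w, p (word R w)) : p t := by
  induction t using MonoidAlgebra.induction_linear with
  | zero => exact zero
  | add f g hf hg => exact add f g hf hg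
  | single l r => simpa [CInf.word] using smul r _ (word l.toList)

/-- The linear map with given values at products of factors. -/
def liftWord {M : Type*} [AddCommMonoid M] [Module R M] (f : List (List X) → M) :
    Cells R X →ₗ[R] M :=
  (Finsupp.linearCombination R fun w : FreeMonoid (List X) => f w.toList) ∘ₗ
    (MonoidAlgebra.coeffLinearEquiv R).toLinearMap

@[simp] theorem liftWord_word {M : Type*} [AddCommMonoid M] [Module R M]
    (f : List (List X) → M) (w : List (List X)) : liftWord (R := R) f (word R w) = f w := by
  simp [liftWord, word]

/-- Tensors as combinations of factors. -/
def factor : Tens R X →ₗ[R] Cells R X := Finsupp.linearCombination R fun b => word R [b]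

@[simp] theorem factor_single (b : List X) : factor (Finsupp.single b (1 : R)) = word R [b] := by
  simp [factor]

/-- Pairs of tensors as combinations of products of two factors. -/
def factorPair : TensPair R X →ₗ[R] Cells R X :=
  Finsupp.linearCombination R fun p => word R [p.1] * word R [p.2]

@[simp] theorem factorPair_pair (s t : Tens R X) :
    factorPair (pair s t) = factor s * factor t := by
  induction s using Tens.induction with
  | zero => simp
  | add s s' hs ht => simp only [map_add, LinearMap.add_apply, hs, ht, add_mul]
  | smul r s hs => simp [hs]
  | word u =>
    induction t using Tens.induction with
    | zero => simp
    | add s s' hs ht => simp only [map_add, hs, ht, mul_add]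
    | smul r s hs => simp only [map_smul, hs, mul_smul_comm]
    | word w => simp [pair_single, factorPair]

/-- The exponent in the sign of a product of factors. -/
def parity (w : List (List X)) : ℕ := (w.map fun b => b.length + 1).sum

/-- The grading automorphism. -/
def sgn : Cells R X →ₗ[R] Cells R X := liftWord fun w => (-1 : R) ^ parity w • word R w

theorem sgn_word (w : List (List X)) : sgn (word R w) = (-1 : R) ^ parity w • word R w := by
  simp [sgn]

@[simp] theorem sgn_mul (x y : Cells R X) : sgn (x * y) = sgn x * sgn y := by
  induction x using Cells.induction with
  | zero => simp
  | add s s' hs ht => simp only [map_add, hs, ht, add_mul]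
  | smul r s hs => simp [hs]
  | word u =>
    induction y using Cells.induction with
    | zero => simp
    | add s s' hs ht => simp only [map_add, hs, ht, mul_add]
    | smul r s hs => simp only [map_smul, hs, mul_smul_comm]
    | word w =>
      rw [← word_append, sgn_word, sgn_word, sgn_word, word_append]
      simp [parity, pow_add, smul_smul, mul_comm]

@[simp] theorem sgn_sgn (x : Cells R X) : sgn (sgn x) = x := by
  induction x using Cells.induction with
  | zero => simp
  | add s s' hs ht => simp only [map_add, hs, ht]
  | smul r s hs => simp [hs]
  | word u => rw [sgn_word, map_smul, sgn_word, smul_smul, ← mul_pow]; simp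

-- A factor with `j` letters has dimension `j - 1`. Its parity is counted as `j + 1` so that the
-- auxiliary empty factor is odd as well.
@[simp] theorem sgn_factor (t : Tens R X) : sgn (factor t) = -factor (alt t) := by
  induction t using Tens.induction with
  | zero => simp
  | add s s' hs ht => simp only [map_add, hs, ht]; abel
  | smul r s hs => simp [hs]
  | word u =>
    rw [factor_single, sgn_word, alt_single, map_smul, factor_single]
    simp [parity, pow_succ]

/-- The values at products of factors of the odd derivation that extends `F`. -/
def derivWord (F : Tens R X →ₗ[R] Cells R X) : List (List X) → Cells R X
  | [] => 0
  | b :: w => F (Finsupp.single b 1) * word R w + sgn (word R [b]) * derivWord F w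

/-- The odd derivation that extends `F`. -/
def deriv (F : Tens R X →ₗ[R] Cells R X) : Cells R X →ₗ[R] Cells R X := liftWord (derivWord F)

@[simp] theorem deriv_one (F : Tens R X →ₗ[R] Cells R X) : deriv F 1 = 0 := by
  rw [← word_nil, deriv, liftWord_word, derivWord]

@[simp] theorem deriv_factor (F : Tens R X →ₗ[R] Cells R X) (t : Tens R X) :
    deriv F (factor t) = F t := by
  induction t using Tens.induction with
  | zero => simp
  | add s s' hs ht => simp only [map_add, hs, ht]
  | smul r s hs => simp [hs]
  | word u => simp [deriv, derivWord]

theorem deriv_word_append (F : Tens R X →ₗ[R] Cells R X) (u v : List (List X)) :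
    deriv F (word R u * word R v) =
      deriv F (word R u) * word R v + sgn (word R u) * deriv F (word R v) := by
  induction u with
  | nil =>
    have : sgn (1 : Cells R X) = 1 := by rw [← word_nil, sgn_word]; simp [parity]
    simp [this]
  | cons b u ih =>
    rw [← word_append] at ih ⊢
    have h (w : List (List X)) : deriv F (word R (b :: w)) =
        F (Finsupp.single b 1) * word R w + sgn (word R [b]) * deriv F (word R w) := by
      rw [deriv, liftWord_word, liftWord_word, derivWord]
    rw [List.cons_append, h, h, ih, word_append, word_cons b u, sgn_mul]
    noncomm_ring

theorem deriv_mul (F : Tens R X →ₗ[R] Cells R X) (x y : Cells R X) :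
    deriv F (x * y) = deriv F x * y + sgn x * deriv F y := by
  induction x using Cells.induction with
  | zero => simp
  | add s s' hs ht => simp only [map_add, hs, ht, add_mul]; abel
  | smul r s hs => simp [hs]
  | word u =>
    induction y using Cells.induction with
    | zero => simp
    | add s s' hs ht => simp only [map_add, hs, ht, mul_add]; abel
    | smul r s hs => simp only [map_smul, hs, mul_smul_comm, smul_add]
    | word w => exact deriv_word_append F u w

/-- Because `sgn` acts on factors as minus `alt`, the hypothesis `hF` says that `F` reverses parity;
the Leibniz rule spreads this to products. -/
theorem sgn_deriv (F : Tens R X →ₗ[R] Cells R X) (hF : ∀ t, sgn (F t) = F (alt t))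
    (x : Cells R X) : sgn (deriv F x) = -deriv F (sgn x) := by
  induction x using Cells.induction with
  | zero => simp
  | add s s' hs ht => simp only [map_add, hs, ht]; abel
  | smul r s hs => simp [hs]
  | word w =>
    induction w with
    | nil => rw [sgn_word]; simp
    | cons b w ih =>
      rw [word_cons, sgn_mul, deriv_mul, deriv_mul, map_add, sgn_mul, sgn_mul, ih, sgn_sgn,
        ← factor_single, sgn_factor, deriv_factor, hF, map_neg, deriv_factor]
      noncomm_ring

/-- The identifications of products of factors. -/
inductive IsRelation : Cells R X → Prop
  | comm (b c : List X) : IsRelation (word R [b] * word R [c] -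
      (-1 : R) ^ ((b.length + 1) * (c.length + 1)) • (word R [c] * word R [b]))
  | shuffle (u v : List X) : u ≠ [] → v ≠ [] → IsRelation (factor (shuffleWords R u v))

variable (R X) in
/-- The ideal generated by the identifications. -/
def relIdeal : Submodule R (Cells R X) :=
  Submodule.span R {z | ∃ x r y, IsRelation r ∧ z = x * r * y}

theorem IsRelation.mem {r : Cells R X} (h : IsRelation r) : r ∈ relIdeal R X :=
  Submodule.subset_span ⟨1, r, 1, h, by simp⟩

theorem mul_mem_relIdeal_right (x : Cells R X) {z : Cells R X} (hz : z ∈ relIdeal R X) :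
    z * x ∈ relIdeal R X := by
  induction hz using Submodule.span_induction with
  | mem z h =>
    obtain ⟨y, r, y', hr, rfl⟩ := h
    exact Submodule.subset_span ⟨y, r, y' * x, hr, by simp [mul_assoc]⟩
  | zero => simp
  | add a b _ _ ha hb => rw [add_mul]; exact add_mem ha hb
  | smul c a _ ha => rw [smul_mul_assoc]; exact Submodule.smul_mem _ _ ha

theorem mul_mem_relIdeal_left (x : Cells R X) {z : Cells R X} (hz : z ∈ relIdeal R X) :
    x * z ∈ relIdeal R X := by
  induction hz using Submodule.span_induction with
  | mem z h =>
    obtain ⟨y, r, y', hr, rfl⟩ := h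
    exact Submodule.subset_span ⟨x * y, r, y', hr, by simp [mul_assoc]⟩
  | zero => simp
  | add a b _ _ ha hb => rw [mul_add]; exact add_mem ha hb
  | smul c a _ ha => rw [mul_smul_comm]; exact Submodule.smul_mem _ _ ha

theorem factor_mem_relIdeal {t : Tens R X} (ht : t ∈ shuffleSpan R X) :
    factor t ∈ relIdeal R X := by
  induction ht using Submodule.span_induction with
  | mem z h =>
    obtain ⟨u, v, hu, hv, rfl⟩ := h
    exact (IsRelation.shuffle u v hu hv).mem
  | zero => simp
  | add a b _ _ ha hb => rw [map_add]; exact add_mem ha hb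
  | smul c a _ ha => rw [map_smul]; exact Submodule.smul_mem _ _ ha

theorem factorPair_mem_relIdeal {z : TensPair R X} (hz : z ∈ cutNull R X) :
    factorPair z ∈ relIdeal R X := by
  induction hz using Submodule.span_induction with
  | mem z h =>
    obtain ⟨t, s, hs, rfl⟩ := h
    rw [factorPair_pair]
    exact mul_mem_relIdeal_left _ (factor_mem_relIdeal hs)
  | zero => simp
  | add a b _ _ ha hb => rw [map_add]; exact add_mem ha hb
  | smul c a _ ha => rw [map_smul]; exact Submodule.smul_mem _ _ ha

variable (R X) in
/-- The sign `(-1) ^ (length + 1)`. -/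
def negAlt : Module.End R (Tens R X) := -(alt : Tens R X →ₗ[R] Tens R X)

theorem negAlt_pow_single (n : ℕ) (c : List X) :
    (negAlt R X ^ n) (Finsupp.single c 1) =
      (-1 : R) ^ (n * (c.length + 1)) • Finsupp.single c 1 := by
  induction n with
  | zero => simp
  | succ n ih =>
    rw [pow_succ', Module.End.mul_apply, ih, map_smul, negAlt, LinearMap.neg_apply, alt_single, ← neg_smul,
      smul_smul]
    congr 1
    ring

/-- The commutation sign depends on the lengths of the words in `t`, so for a tensor it becomes an
operator, a power of `negAlt`. -/
theorem word_mul_factor_sub_mem (b : List X) (t : Tens R X) :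
    word R [b] * factor t -
      factor ((negAlt R X ^ (b.length + 1)) t) * word R [b] ∈
        relIdeal R X := by
  induction t using Tens.induction with
  | zero => simp
  | add s s' hs ht =>
    convert add_mem hs ht using 1
    simp only [map_add, mul_add, add_mul]
    abel
  | smul r s hs =>
    convert Submodule.smul_mem _ r hs using 1
    simp [smul_sub]
  | word c =>
    rw [negAlt_pow_single, map_smul, factor_single, smul_mul_assoc]
    exact (IsRelation.comm b c).mem

theorem sgn_relation_mem {r : Cells R X} (hr : IsRelation r) : sgn r ∈ relIdeal R X := by
  cases hr with
  | comm b c =>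
    convert Submodule.smul_mem _ ((-1 : R) ^ (parity [b, c])) (IsRelation.comm (R := R) b c).mem
      using 1
    rw [map_sub, map_smul, ← word_append, ← word_append, sgn_word, sgn_word, smul_sub, smul_smul,
      smul_smul, mul_comm]
    simp [parity, add_comm]
  | shuffle u v hu hv =>
    rw [sgn_factor, alt_shuffleWords, map_smul]
    exact neg_mem (Submodule.smul_mem _ _ (IsRelation.shuffle u v hu hv).mem)

/-- In the Leibniz expansion of `x * r * y` the derivation hits `r` or leaves it intact up to `sgn`,
which preserves the ideal; so only the generators have to be tested. -/
theorem deriv_mem_relIdeal (F : Tens R X →ₗ[R] Cells R X)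
    (hF : ∀ r, IsRelation r → deriv F r ∈ relIdeal R X) {z : Cells R X} (hz : z ∈ relIdeal R X) :
    deriv F z ∈ relIdeal R X := by
  induction hz using Submodule.span_induction with
  | mem z h =>
    obtain ⟨x, r, y, hr, rfl⟩ := h
    rw [deriv_mul, deriv_mul, sgn_mul]
    refine add_mem (mul_mem_relIdeal_right _ (add_mem ?_ ?_)) (mul_mem_relIdeal_right _ ?_)
    · exact mul_mem_relIdeal_left _ hr.mem
    · exact mul_mem_relIdeal_left _ (hF r hr)
    · exact mul_mem_relIdeal_left _ (sgn_relation_mem hr)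
  | zero => simp
  | add a b _ _ ha hb => rw [map_add]; exact add_mem ha hb
  | smul c a _ ha => rw [map_smul]; exact Submodule.smul_mem _ _ ha

end Cells
-- The boundary, the contracting homotopy and their anticommutator
section Homotopy

variable {R : Type*} [CommRing R]

section
variable {X : Type*}

theorem sgn_factorPair (z : TensPair R X) :
    sgn (factorPair z) = factorPair (mapPair alt alt z) := by
  induction z using TensPair.induction with
  | zero => simp
  | add s t hs ht => simp only [map_add, hs, ht]
  | pair s t => simp

theorem mapPair_alt_mapLeft_consL (y : X) (z : TensPair R X) :
    mapPair alt alt (mapLeft (consL y) z) = -mapLeft (consL y) (mapPair alt alt z) := by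
  induction z using TensPair.induction with
  | zero => simp
  | add s t hs ht => simp only [map_add, hs, ht]; abel
  | pair s t => simp

theorem mapPair_alt_cut (t : Tens R X) : mapPair alt alt (cut t) = cut (alt t) := by
  induction t using Tens.induction with
  | zero => simp
  | add s s' hs ht => simp only [map_add, hs, ht]
  | smul r s hs => simp [hs]
  | word u =>
    induction u with
    | nil => simp
    | cons y u ih =>
      rw [← consL_single, cut_consL, map_sub, mapPair_alt_mapLeft_consL, ih, alt_consL, map_neg,
        cut_consL]
      simp [-consL_single]
      abel

variable (R X) in
/-- The span of the nonempty words. -/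
def nonemptySpan : Submodule R (Tens R X) :=
  Submodule.span R {t | ∃ l : List X, l ≠ [] ∧ t = Finsupp.single l 1}

theorem consL_mem_nonemptySpan (y : X) (t : Tens R X) : consL y t ∈ nonemptySpan R X := by
  induction t using Tens.induction with
  | zero => simp
  | add s s' hs ht => rw [map_add]; exact add_mem hs ht
  | smul r s hs => rw [map_smul]; exact Submodule.smul_mem _ _ hs
  | word u => exact Submodule.subset_span ⟨y :: u, by simp, by simp⟩

theorem shuffle_mem_shuffleSpan {s t : Tens R X} (hs : s ∈ nonemptySpan R X)
    (ht : t ∈ nonemptySpan R X) : shuffle s t ∈ shuffleSpan R X := by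
  induction hs using Submodule.span_induction with
  | mem s h =>
    obtain ⟨u, hu, rfl⟩ := h
    induction ht using Submodule.span_induction with
    | mem t h =>
      obtain ⟨v, hv, rfl⟩ := h
      exact Submodule.subset_span ⟨u, v, hu, hv, shuffle_single u v⟩
    | zero => simp
    | add a b _ _ ha hb => rw [map_add]; exact add_mem ha hb
    | smul c a _ ha => rw [map_smul]; exact Submodule.smul_mem _ _ ha
  | zero => simp
  | add a b _ _ ha hb => rw [map_add]; exact add_mem ha hb
  | smul c a _ ha => rw [map_smul]; exact Submodule.smul_mem _ _ ha

end

/-- The factor `p_1(a)` has dimension zero, so moving it past anything costs no sign. -/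
theorem word_mul_letter_sub_mem {α : Type*} (a : α) (x : Cells R (Multiset α)) :
    x * word R [[{a}]] - word R [[{a}]] * x ∈ relIdeal R (Multiset α) := by
  induction x using Cells.induction with
  | zero => simp
  | add s s' hs ht =>
    convert add_mem hs ht using 1
    noncomm_ring
  | smul r s hs =>
    convert Submodule.smul_mem _ r hs using 1
    simp [smul_sub]
  | word w =>
    induction w with
    | nil => simp
    | cons b w ih =>
      have h := (IsRelation.comm (R := R) b [{a}]).mem
      have e : (-1 : R) ^ ((b.length + 1) * ([{a}] : List (Multiset α)).length.succ) = 1 := by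
        simp [pow_mul']
      convert add_mem (mul_mem_relIdeal_left (word R [b]) ih)
        (mul_mem_relIdeal_right (word R w) h) using 1
      rw [word_cons, ← Nat.succ_eq_add_one ([{a}] : List (Multiset α)).length, e, one_smul]
      noncomm_ring

section Boundary
variable {X : Type*} [AddCommMonoid X]

theorem alt_mergeFirst (y : X) (t : Tens R X) :
    alt (mergeFirst y t) = mergeFirst y (alt t) := by
  induction t using Tens.induction with
  | zero => simp
  | add s s' hs ht => simp only [map_add, hs, ht]
  | smul r s hs => simp [hs]
  | word u =>
    cases u with
    | nil => simp
    | cons z u =>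
      rw [← consL_single, mergeFirst_consL, alt_consL, alt_consL, map_neg, mergeFirst_consL]

theorem alt_merge (t : Tens R X) : alt (merge t) = -merge (alt t) := by
  induction t using Tens.induction with
  | zero => simp
  | add s s' hs ht => simp only [map_add, hs, ht]; abel
  | smul r s hs => simp [hs]
  | word u =>
    induction u with
    | nil => simp
    | cons y u ih =>
      rw [← consL_single, merge_consL, map_sub, alt_consL, alt_consL, ih, alt_mergeFirst, map_neg,
        map_neg, merge_consL]
      abel

variable (R X) in
/-- The boundary of a factor. -/
def factorBd : Tens R X →ₗ[R] Cells R X :=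
  factor ∘ₗ merge + factorPair ∘ₗ cut - LinearMap.mulLeft R (word R [[]]) ∘ₗ factor

/-- The subtracted term is the cut with empty left piece. -/
theorem factorBd_apply (t : Tens R X) :
    factorBd R X t = factor (merge t) + factorPair (cut t) - word R [[]] * factor t := rfl

variable (R X) in
/-- The boundary. -/
def bd : Cells R X →ₗ[R] Cells R X := deriv (factorBd R X)

theorem sgn_factorBd (t : Tens R X) : sgn (factorBd R X t) = factorBd R X (alt t) := by
  rw [factorBd_apply, factorBd_apply, map_sub, map_add, sgn_factor, alt_merge, sgn_factorPair,
    mapPair_alt_cut, sgn_mul, ← factor_single, sgn_factor, sgn_factor]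
  simp

end Boundary

variable {α : Type*} [DecidableEq α]

variable (R) in
/-- The contracting homotopy. -/
def contr (a : α) : Cells R (Multiset α) →ₗ[R] Cells R (Multiset α) :=
  deriv (factor ∘ₗ detach a)

theorem contr_mul (a : α) (x y : Cells R (Multiset α)) :
    contr R a (x * y) = contr R a x * y + sgn x * contr R a y := deriv_mul _ _ _

@[simp] theorem contr_factor (a : α) (t : Tens R (Multiset α)) :
    contr R a (factor t) = factor (detach a t) := by simp [contr]

theorem bd_mul {X : Type*} [AddCommMonoid X] (x y : Cells R X) :
    bd R X (x * y) = bd R X x * y + sgn x * bd R X y := deriv_mul _ _ _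

@[simp] theorem bd_factor {X : Type*} [AddCommMonoid X] (t : Tens R X) :
    bd R X (factor t) = factorBd R X t := by simp [bd]

theorem negAlt_pow_detach (a : α) (n : ℕ) (t : Tens R (Multiset α)) :
    (negAlt R _ ^ n) (detach a t) = (-1 : R) ^ n • detach a ((negAlt R _ ^ n) t) := by
  induction n with
  | zero => simp
  | succ n ih =>
    rw [pow_succ', Module.End.mul_apply, ih, Module.End.mul_apply, map_smul, negAlt,
      LinearMap.neg_apply, alt_detach, LinearMap.neg_apply, map_neg, pow_succ]
    simp

theorem detach_mem_nonemptySpan (a : α) (l : List (Multiset α)) :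
    detach a (Finsupp.single l (1 : R)) ∈ nonemptySpan R _ := by
  cases l with
  | nil => simp
  | cons y l =>
    rw [← consL_single, detach_consL]
    refine sub_mem ?_ (consL_mem_nonemptySpan _ _)
    unfold pull
    split_ifs
    · exact consL_mem_nonemptySpan _ _
    · simp

/-- A commutator of two factors goes to a combination of two commutators in which one factor is
detached and hence one letter longer, with the sign adjusted accordingly. A shuffle goes to a sum of
shuffles, since `detach a` is a derivation of the shuffle product. -/
theorem contr_mem_relIdeal (a : α) {z : Cells R (Multiset α)} (hz : z ∈ relIdeal R _) :
    contr R a z ∈ relIdeal R _ := by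
  refine deriv_mem_relIdeal _ (fun r hr => ?_) hz
  cases hr with
  | comm b c =>
    have h1 := word_mul_factor_sub_mem b (detach a (Finsupp.single c (1 : R)))
    have h2 := word_mul_factor_sub_mem c (detach a (Finsupp.single b (1 : R)))
    rw [negAlt_pow_detach, negAlt_pow_single] at h1 h2
    rw [mul_comm (c.length + 1)] at h2
    have sq (n : ℕ) : (-1 : R) ^ n * (-1) ^ n = 1 := by rw [← mul_pow]; simp
    have hp := sq (b.length + 1)
    have hq := sq (c.length + 1)
    have he := sq ((b.length + 1) * (c.length + 1))
    have hb : sgn (word R [b]) = (-1 : R) ^ (b.length + 1) • word R [b] := sgn_word _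
    have hc : sgn (word R [c]) = (-1 : R) ^ (c.length + 1) • word R [c] := sgn_word _
    rw [map_sub, map_smul, deriv_mul, deriv_mul, hb, hc, ← factor_single, ← factor_single,
      deriv_factor, deriv_factor]
    -- From here on the signs matter only through `p * p = q * q = e * e = 1`.
    generalize (-1 : R) ^ ((b.length + 1) * (c.length + 1)) = e at *
    generalize (-1 : R) ^ (b.length + 1) = p at *
    generalize (-1 : R) ^ (c.length + 1) = q at *
    convert sub_mem (Submodule.smul_mem _ p h1) (Submodule.smul_mem _ (e * q) h2) using 1
    simp only [map_smul, smul_sub, smul_add, LinearMap.comp_apply, factor_single, smul_mul_assoc,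
      smul_smul]
    have e1 : p * (p * e) = e := by linear_combination e * hp
    have e2 : e * q * (q * e) = 1 := by linear_combination e * e * hq + he
    rw [e1, e2]
    module
  | shuffle u v hu hv =>
    rw [deriv_factor, ← shuffle_single, LinearMap.comp_apply, detach_shuffle, map_add]
    refine add_mem (factor_mem_relIdeal ?_) (factor_mem_relIdeal ?_)
    · exact shuffle_mem_shuffleSpan (detach_mem_nonemptySpan a u)
        (Submodule.subset_span ⟨v, hv, rfl⟩)
    · rw [alt_single]
      exact shuffle_mem_shuffleSpan (Submodule.smul_mem _ _ (Submodule.subset_span ⟨u, hu, rfl⟩))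
        (detach_mem_nonemptySpan a v)

theorem contr_factorPair (a : α) (z : TensPair R (Multiset α)) :
    contr R a (factorPair z) = factorPair (detachPair a z) := by
  induction z using TensPair.induction with
  | zero => simp
  | add s t hs ht => simp only [map_add, hs, ht]
  | pair s t => simp [contr_mul, detachPair, sub_eq_add_neg]

/-- The anticommutator of the boundary and the contracting homotopy. -/
def bdContr (a : α) : Cells R (Multiset α) →ₗ[R] Cells R (Multiset α) :=
  bd R _ ∘ₗ contr R a + contr R a ∘ₗ bd R _

/-- The anticommutator of two odd derivations is an even derivation: the mixed terms cancel because
both maps anticommute with `sgn`. -/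
theorem bdContr_mul (a : α) (x y : Cells R (Multiset α)) :
    bdContr a (x * y) = bdContr a x * y + x * bdContr a y := by
  have h1 : ∀ x, sgn (bd R (Multiset α) x) = -bd R _ (sgn x) := sgn_deriv _ sgn_factorBd
  have h2 : ∀ x, sgn (contr R a x) = -contr R a (sgn x) :=
    sgn_deriv _ fun t => by simp [alt_detach]
  simp only [bdContr, LinearMap.add_apply, LinearMap.comp_apply, bd_mul, contr_mul, map_add, h1, h2,
    sgn_sgn]
  noncomm_ring

/-- The terms with the empty factor drop out: it is odd and `contr a` kills it, so its two
contributions have opposite signs. -/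
theorem bdContr_factor (a : α) (t : Tens R (Multiset α)) :
    bdContr a (factor t) = factor (merge (detach a t) + detach a (merge t)) +
      factorPair (cut (detach a t) + detachPair a (cut t)) := by
  have h : contr R a (word R [[]]) = 0 := by
    rw [← factor_single, contr_factor, detach_nil, map_zero]
  rw [bdContr, LinearMap.add_apply, LinearMap.comp_apply, LinearMap.comp_apply, contr_factor,
    bd_factor, bd_factor, factorBd_apply, factorBd_apply, map_sub, map_add, contr_factor,
    contr_factorPair, contr_mul, h, contr_factor, ← factor_single, sgn_factor, map_add, map_add]
  simp
  abel

/-- The correction term is a shuffle with `{a}`, and thus an identification as long as there is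
something to shuffle with. -/
theorem factor_leadTerm_mem (a : α) (l : List (Multiset α)) (hl : l ≠ [{a}]) :
    factor (leadTerm R a l) ∈ relIdeal R (Multiset α) := by
  cases l with
  | nil => simp [leadTerm]
  | cons y l =>
    rw [leadTerm]
    split_ifs with h
    · exact factor_mem_relIdeal (ins_mem_shuffleSpan _ _ (by rintro rfl; exact hl (by rw [h])))
    · simp

variable (R) in
/-- Remove `a` from a factor. A factor with the letter `{a}` goes to zero, except that the factor
that consists of this letter alone goes to the empty product. -/
def forgetFactor (a : α) : Tens R (Multiset α) →ₗ[R] Cells R (Multiset α) :=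
  factor ∘ₗ eraseLetter a + (Finsupp.lapply [{a}]).smulRight 1

theorem forgetFactor_apply (a : α) (t : Tens R (Multiset α)) :
    forgetFactor R a t = factor (eraseLetter a t) + t [{a}] • (1 : Cells R (Multiset α)) := rfl

variable (R) in
/-- Remove `a` from the products of factors, multiplicatively. -/
def forget (a : α) : Cells R (Multiset α) →ₗ[R] Cells R (Multiset α) :=
  liftWord fun w => (w.map fun b => forgetFactor R a (Finsupp.single b 1)).prod

theorem forget_mul (a : α) (x y : Cells R (Multiset α)) :
    forget R a (x * y) = forget R a x * forget R a y := by
  induction x using Cells.induction with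
  | zero => simp
  | add s s' hs ht => simp only [map_add, hs, ht, add_mul]
  | smul r s hs => simp [hs]
  | word u =>
    induction y using Cells.induction with
    | zero => simp
    | add s s' hs ht => simp only [map_add, hs, ht, mul_add]
    | smul r s hs => simp only [map_smul, hs, mul_smul_comm]
    | word w => rw [← word_append]; simp [forget]

@[simp] theorem forget_one (a : α) : forget R a 1 = 1 := by
  rw [← word_nil, forget, liftWord_word]; simp

@[simp] theorem forget_factor (a : α) (t : Tens R (Multiset α)) :
    forget R a (factor t) = forgetFactor R a t := by
  induction t using Tens.induction with
  | zero => simp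
  | add s s' hs ht => simp only [map_add, hs, ht]
  | smul r s hs => simp [hs]
  | word u => simp [forget]

theorem bdContr_word_of_notMem {a : α} {w : List (List (Multiset α))} (h : a ∉ w.flatten.sum) :
    bdContr a (word R w) = 0 := by
  induction w with
  | nil =>
    have := bdContr_mul a (1 : Cells R (Multiset α)) 1
    simpa using this
  | cons b w ih =>
    rw [List.flatten_cons, List.sum_append, Multiset.mem_add, not_or] at h
    rw [word_cons, bdContr_mul, ih h.2, ← factor_single, bdContr_factor, detach_eq_zero h.1,
      detach_merge_eq_zero h.1, detachPair_cut_eq_zero h.1]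
    simp

theorem eraseWord_of_notMem {a : α} {l : List (Multiset α)} (h : a ∉ l.sum) :
    eraseWord R a l = Finsupp.single l 1 := by
  have h' : ∀ y ∈ l, a ∉ y := fun y hy hay =>
    h (Multiset.mem_of_le (List.single_le_sum (by simp) y hy) hay)
  rw [eraseWord, if_neg fun hl => h' _ hl (by simp)]
  congr 1
  refine (List.map_congr_left fun z hz => Multiset.filter_eq_self.2 ?_).trans (List.map_id' l)
  rintro b hb rfl
  exact h' z hz hb

theorem forgetFactor_of_notMem {a : α} {l : List (Multiset α)} (h : a ∉ l.sum) :
    forgetFactor R a (Finsupp.single l 1) = word R [l] := by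
  have : l ≠ [{a}] := by rintro rfl; simp at h
  rw [forgetFactor_apply, eraseLetter_single, eraseWord_of_notMem h, Finsupp.single_apply,
    if_neg this]
  simp

theorem forget_word_of_notMem {a : α} {w : List (List (Multiset α))} (h : a ∉ w.flatten.sum) :
    forget R a (word R w) = word R w := by
  induction w with
  | nil => simp
  | cons b w ih =>
    rw [List.flatten_cons, List.sum_append, Multiset.mem_add, not_or] at h
    rw [word_cons, forget_mul, ih h.2, ← factor_single, forget_factor, forgetFactor_of_notMem h.1,
      factor_single]

/-- The contracting homotopy contracts the words in which `a` occurs once to those in which it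
occurs in a factor of its own. -/
theorem bdContr_word_sub_mem {a : α} {w : List (List (Multiset α))}
    (h : w.flatten.sum.count a = 1) (h0 : 0 ∉ w.flatten) :
    bdContr a (word R w) - (word R w - forget R a (word R w) * word R [[{a}]]) ∈ relIdeal R _ := by
  induction w with
  | nil => simp at h
  | cons b w ih =>
    rw [List.flatten_cons, List.sum_append, Multiset.count_add] at h
    simp only [List.flatten_cons, List.mem_append, not_or] at h0
    by_cases hb : a ∈ b.sum
    · have hb1 : b.sum.count a = 1 := by
        have := Multiset.count_pos.2 hb
        omega
      have hw : a ∉ w.flatten.sum := by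
        rw [← Multiset.count_eq_zero]; omega
      -- In the factor that contains `a`, merging returns `b` up to a shuffle and cutting
      -- contributes minus the erased factor times `p_1(a)`. For `b = [{a}]` the two sides vanish
      -- separately modulo the identifications, since `forget a` then gives the empty product.
      have key : bdContr a (word R [b]) -
          (word R [b] - forget R a (word R [b]) * word R [[{a}]]) ∈ relIdeal R _ := by
        have h1 := factorPair_mem_relIdeal (cut_detach_add_detachPair_cut (R := R) hb1)
        rw [map_add, factorPair_pair] at h1
        rw [← factor_single, bdContr_factor, merge_detach_add_detach_merge hb1 h0.1, forget_factor,
          forgetFactor_apply, eraseLetter_single, Finsupp.single_apply]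
        by_cases hba : b = [{a}]
        · subst hba
          convert h1 using 1
          simp [leadTerm, add_mul]
        · have h2 := factor_leadTerm_mem (R := R) a b hba
          rw [if_neg hba]
          convert sub_mem h1 h2 using 1
          simp
          abel
      -- The factor `p_1(a)` produced inside the product is moved to its right end.
      have h3 := mul_mem_relIdeal_left (forget R a (word R [b]))
        (word_mul_letter_sub_mem (R := R) a (word R w))
      convert add_mem (mul_mem_relIdeal_right (word R w) key) h3 using 1
      rw [word_cons, bdContr_mul, bdContr_word_of_notMem hw, forget_mul, forget_word_of_notMem hw]
      noncomm_ring
    · have hw : w.flatten.sum.count a = 1 := by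
        rw [Multiset.count_eq_zero_of_notMem hb] at h; omega
      convert mul_mem_relIdeal_left (word R [b]) (ih hw h0.2) using 1
      have hb' : a ∉ ([b] : List (List (Multiset α))).flatten.sum := by simpa using hb
      rw [word_cons, bdContr_mul, bdContr_word_of_notMem hb', forget_mul,
        forget_word_of_notMem hb']
      noncomm_ring

end Homotopy
-- Deleting a variable respects identifications and boundaries
section Forget

variable {R : Type*} [CommRing R]

section
variable {X : Type*}

@[simp] theorem consL_apply_nil (y : X) (t : Tens R X) : consL y t [] = 0 := by
  rw [consL, Finsupp.lmapDomain_apply]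
  exact Finsupp.mapDomain_of_notMem_range _ _ (by simp)

@[simp] theorem consL_apply_cons (y : X) (t : Tens R X) (l : List X) :
    consL y t (y :: l) = t l := by
  rw [consL, Finsupp.lmapDomain_apply]
  exact Finsupp.mapDomain_apply (List.cons_injective) _ _

theorem consL_apply_of_ne {x y : X} (h : y ≠ x) (t : Tens R X) (l : List X) :
    consL y t (x :: l) = 0 := by
  rw [consL, Finsupp.lmapDomain_apply]
  exact Finsupp.mapDomain_of_notMem_range _ _ (by simp [h])

/-- Apply a functional to the first component of pairs. -/
def contractLeft (φ : Tens R X →ₗ[R] R) : TensPair R X →ₗ[R] Tens R X :=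
  Finsupp.linearCombination R fun z => φ (Finsupp.single z.1 1) • Finsupp.single z.2 1

/-- Apply a functional to the second component of pairs. -/
def contractRight (φ : Tens R X →ₗ[R] R) : TensPair R X →ₗ[R] Tens R X :=
  Finsupp.linearCombination R fun z => φ (Finsupp.single z.2 1) • Finsupp.single z.1 1

@[simp] theorem contractLeft_pair (φ : Tens R X →ₗ[R] R) (s t : Tens R X) :
    contractLeft φ (pair s t) = φ s • t := by
  induction s using Tens.induction with
  | zero => simp
  | add s s' hs ht => simp only [map_add, LinearMap.add_apply, hs, ht, add_smul]
  | smul r s hs => simp [hs, smul_smul]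
  | word u =>
    induction t using Tens.induction with
    | zero => simp
    | add s s' hs ht => simp only [map_add, hs, ht, smul_add]
    | smul r s hs => simp only [map_smul, hs, smul_comm r]
    | word w => simp [pair_single, contractLeft]

@[simp] theorem contractRight_pair (φ : Tens R X →ₗ[R] R) (s t : Tens R X) :
    contractRight φ (pair s t) = φ t • s := by
  induction s using Tens.induction with
  | zero => simp
  | add s s' hs ht => simp only [map_add, LinearMap.add_apply, hs, ht, smul_add]
  | smul r s hs => rw [map_smul, LinearMap.smul_apply, map_smul, hs, smul_comm]
  | word u =>
    induction t using Tens.induction with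
    | zero => simp
    | add s s' hs ht => simp only [map_add, hs, ht, add_smul]
    | smul r s hs => simp only [map_smul, hs, smul_eq_mul, mul_smul]
    | word w => simp [pair_single, contractRight]

theorem contractRight_mapLeft (φ : Tens R X →ₗ[R] R) (f : Tens R X →ₗ[R] Tens R X)
    (z : TensPair R X) : contractRight φ (mapLeft f z) = f (contractRight φ z) := by
  induction z using TensPair.induction with
  | zero => simp
  | add s t hs ht => simp only [map_add, hs, ht]
  | pair s t => simp

theorem contractLeft_mapLeft (φ : Tens R X →ₗ[R] R) (f : Tens R X →ₗ[R] Tens R X)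
    (z : TensPair R X) : contractLeft φ (mapLeft f z) = contractLeft (φ ∘ₗ f) z := by
  induction z using TensPair.induction with
  | zero => simp
  | add s t hs ht => simp only [map_add, hs, ht]
  | pair s t => simp

@[simp] theorem contractLeft_zero : contractLeft (0 : Tens R X →ₗ[R] R) = 0 := by
  refine LinearMap.ext fun z => ?_
  induction z using TensPair.induction with
  | zero => simp
  | add s t hs ht => simp only [map_add, hs, ht]
  | pair s t => simp

theorem mapPair_mapPair (f g f' g' : Tens R X →ₗ[R] Tens R X) (z : TensPair R X) :
    mapPair f g (mapPair f' g' z) = mapPair (f ∘ₗ f') (g ∘ₗ g') z := by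
  induction z using TensPair.induction with
  | zero => simp
  | add s t hs ht => simp only [map_add, hs, ht]
  | pair s t => simp

theorem contractLeft_nil_cut (l : List X) (hl : l ≠ []) :
    contractLeft (Finsupp.lapply []) (cut (Finsupp.single l (1 : R))) = Finsupp.single l 1 := by
  cases l with
  | nil => exact absurd rfl hl
  | cons y l =>
    have : (Finsupp.lapply [] : Tens R X →ₗ[R] R) ∘ₗ consL y = 0 := by
      refine LinearMap.ext fun t => ?_
      simp
    rw [← consL_single, cut_consL, map_sub, contractLeft_mapLeft, this]
    simp

theorem lapply_comp_consL_of_ne {x y : X} (h : y ≠ x) :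
    (Finsupp.lapply [x] : Tens R X →ₗ[R] R) ∘ₗ consL y = 0 :=
  LinearMap.ext fun t => consL_apply_of_ne h t []

theorem lapply_comp_consL (y : X) :
    (Finsupp.lapply [y] : Tens R X →ₗ[R] R) ∘ₗ consL y = Finsupp.lapply [] :=
  LinearMap.ext fun t => consL_apply_cons y t []

theorem shuffleWords_mem_supported (u v : List X) :
    shuffleWords R u v ∈ Finsupp.supported R R {l : List X | l.length = u.length + v.length} := by
  have hc (y : X) (n : ℕ) (t : Tens R X) (ht : t ∈ Finsupp.supported R R {l : List X | l.length = n}) :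
      consL y t ∈ Finsupp.supported R R {l : List X | l.length = n + 1} := by
    rw [Finsupp.mem_supported'] at ht ⊢
    intro l hl
    cases l with
    | nil => simp
    | cons z l =>
      by_cases hz : y = z
      · subst hz
        rw [consL_apply_cons]
        exact ht _ (by simpa using hl)
      · exact consL_apply_of_ne hz t l
  match u, v with
  | [], v => simpa using Finsupp.single_mem_supported R 1 (by simp)
  | x :: u, [] => simpa using Finsupp.single_mem_supported R 1 (by simp)
  | x :: u, y :: v =>
    rw [shuffleWords]
    have h1 := hc x _ _ (shuffleWords_mem_supported u (y :: v))
    have h2 := hc y _ _ (shuffleWords_mem_supported (x :: u) v)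
    have e1 : u.length + (y :: v).length + 1 = (x :: u).length + (y :: v).length := by
      simp only [List.length_cons]; omega
    have e2 : (x :: u).length + v.length + 1 = (x :: u).length + (y :: v).length := by
      simp only [List.length_cons]; omega
    rw [e1] at h1
    rw [e2] at h2
    exact add_mem h1 (Submodule.smul_mem _ _ h2)
termination_by u.length + v.length

end

theorem contractRight_cut_eq_zero {α : Type*} {a : α} {l : List (Multiset α)} (h : {a} ∉ l) :
    contractRight (Finsupp.lapply [{a}]) (cut (Finsupp.single l (1 : R))) = 0 := by
  induction l with
  | nil => simp
  | cons y l ih =>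
    simp only [List.mem_cons, not_or] at h
    rw [← consL_single, cut_consL, map_sub, contractRight_mapLeft, ih h.2, contractRight_pair,
      Finsupp.lapply_apply, consL_apply_of_ne (Ne.symm h.1)]
    simp

variable {α : Type*} [DecidableEq α]

theorem forgetFactor_single (a : α) (l : List (Multiset α)) :
    forgetFactor R a (Finsupp.single l 1) =
      if l = [{a}] then 1 else if {a} ∈ l then 0
        else word R [l.map (Multiset.filter (· ≠ a))] := by
  rw [forgetFactor_apply, eraseLetter_single, eraseWord, Finsupp.single_apply]
  by_cases h1 : l = [{a}]
  · subst h1; simp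
  · by_cases h2 : {a} ∈ l <;> simp [h1, h2]

/-- Commutators: lengths are unchanged, and the exceptional factor `[{a}]` commutes without sign, as
does the empty product replacing it. Shuffles: their words have at least two letters, so the
exceptional factor does not occur, and erasing is multiplicative for shuffles. -/
theorem forget_mem_relIdeal (a : α) {z : Cells R (Multiset α)} (hz : z ∈ relIdeal R _) :
    forget R a z ∈ relIdeal R _ := by
  induction hz using Submodule.span_induction with
  | mem z h =>
    obtain ⟨x, r, y, hr, rfl⟩ := h
    rw [forget_mul, forget_mul]
    refine mul_mem_relIdeal_right _ (mul_mem_relIdeal_left _ ?_)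
    cases hr with
    | comm b c =>
      rw [map_sub, map_smul, forget_mul, forget_mul, ← factor_single, ← factor_single,
        forget_factor, forget_factor, forgetFactor_single, forgetFactor_single]
      have e1 : (-1 : R) ^ ((([{a}] : List (Multiset α)).length + 1) * (c.length + 1)) = 1 := by
        simp [pow_mul]
      have e2 : (-1 : R) ^ ((b.length + 1) * (([{a}] : List (Multiset α)).length + 1)) = 1 := by
        simp [pow_mul']
      by_cases h1 : b = [{a}]
      · rw [if_pos h1, h1, e1]; simp
      by_cases h2 : c = [{a}]
      · rw [if_pos h2, h2, e2]; simp
      rw [if_neg h1, if_neg h2]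
      split_ifs
      · simp
      · simp
      · simp
      · simpa using (IsRelation.comm (R := R) (b.map (Multiset.filter (· ≠ a)))
          (c.map (Multiset.filter (· ≠ a)))).mem
    | shuffle u v hu hv =>
      have h1 : shuffleWords R u v [{a}] = 0 := by
        refine (Finsupp.mem_supported' R _).1 (shuffleWords_mem_supported u v) _ ?_
        have := List.length_pos_iff.2 hu
        have := List.length_pos_iff.2 hv
        simp only [Set.mem_ofPred_eq, List.length_singleton]
        omega
      rw [forget_factor, forgetFactor_apply, h1, zero_smul, add_zero]
      exact factor_mem_relIdeal (eraseLetter_shuffleWords_mem a hu hv)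
  | zero => simp
  | add a b _ _ ha hb => rw [map_add]; exact add_mem ha hb
  | smul c a _ ha => rw [map_smul]; exact Submodule.smul_mem _ _ ha

/-- Expansion of the product of two images, each an erased factor plus a multiple of `1` that counts
the exceptional factor `[{a}]`. -/
theorem forget_factorPair (a : α) (z : TensPair R (Multiset α)) :
    forget R a (factorPair z) = factorPair (mapPair (eraseLetter a) (eraseLetter a) z) +
      factor (eraseLetter a (contractRight (Finsupp.lapply [{a}]) z +
        contractLeft (Finsupp.lapply [{a}]) z)) +
      contractRight (Finsupp.lapply [{a}]) z [{a}] • (1 : Cells R (Multiset α)) := by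
  induction z using TensPair.induction with
  | zero => simp
  | add s t hs ht => simp only [map_add, hs, ht, Finsupp.add_apply, add_smul]; abel
  | pair s t =>
    rw [factorPair_pair, forget_mul, forget_factor, forget_factor, forgetFactor_apply,
      forgetFactor_apply, mapPair_pair, factorPair_pair, contractRight_pair, contractLeft_pair]
    simp [add_mul, mul_add, smul_smul]
    abel

theorem merge_apply_letter (a : α) {l : List (Multiset α)} (h0 : 0 ∉ l) :
    merge (Finsupp.single l (1 : R)) [{a}] = 0 := by
  cases l with
  | nil => simp
  | cons y l =>
    simp only [List.mem_cons, not_or] at h0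
    rw [← consL_single, merge_consL]
    cases l with
    | nil => simp
    | cons z l =>
      have h1 : y + z ≠ {a} :=
        add_ne_singleton (fun h => h0.1 h.symm) fun h => h0.2 (by simp [h])
      rw [← consL_single, mergeFirst_consL, Finsupp.sub_apply, consL_apply_of_ne h1]
      by_cases hy : y = {a}
      · subst hy
        rw [consL_apply_cons, merge_consL, Finsupp.sub_apply, consL_apply_nil]
        cases l with
        | nil => simp
        | cons x l => rw [← consL_single, mergeFirst_consL, consL_apply_nil]; simp
      · rw [consL_apply_of_ne hy, sub_zero]

theorem eraseLetter_merge {a : α} {l : List (Multiset α)} (h : {a} ∉ l) (h0 : 0 ∉ l) :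
    eraseLetter a (merge (Finsupp.single l (1 : R))) =
      merge (eraseLetter a (Finsupp.single l 1)) := by
  induction l with
  | nil => simp
  | cons y l ih =>
    simp only [List.mem_cons, not_or] at h0 h
    rw [← consL_single, merge_consL, map_sub, eraseLetter_consL (Ne.symm h.1),
      eraseLetter_consL (Ne.symm h.1), merge_consL, ih h.2 h0.2]
    congr 1
    cases l with
    | nil => simp
    | cons z l =>
      have h1 : y + z ≠ {a} :=
        add_ne_singleton (fun h => h0.1 h.symm) fun h => h0.2 (by simp [h])
      simp only [List.mem_cons, not_or] at h
      rw [← consL_single, mergeFirst_consL, eraseLetter_consL (Ne.symm h.2.1), mergeFirst_consL,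
        eraseLetter_consL h1, Multiset.filter_add]

theorem mapPair_eraseLetter_cut {a : α} {l : List (Multiset α)} (h : {a} ∉ l) :
    mapPair (eraseLetter a) (eraseLetter a) (cut (Finsupp.single l (1 : R))) =
      cut (eraseLetter a (Finsupp.single l 1)) := by
  induction l with
  | nil => simp
  | cons y l ih =>
    simp only [List.mem_cons, not_or] at h
    have e : eraseLetter a ∘ₗ consL (R := R) y =
        consL (y.filter (· ≠ a)) ∘ₗ eraseLetter a :=
      LinearMap.ext fun t => eraseLetter_consL (Ne.symm h.1) t
    rw [← consL_single, cut_consL, map_sub, mapPair_pair, eraseLetter_nil, mapPair_mapPair, e,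
      eraseLetter_consL (Ne.symm h.1), cut_consL, ← ih h.2, mapPair_mapPair]
    rfl

theorem mapPair_eraseLetter_cut_eq_zero {a : α} {l : List (Multiset α)} (h : {a} ∈ l) :
    mapPair (eraseLetter a) (eraseLetter a) (cut (Finsupp.single l (1 : R))) = 0 := by
  induction l with
  | nil => simp
  | cons y l ih =>
    have hl : eraseLetter a (consL y (Finsupp.single l (1 : R))) = 0 := by
      rw [consL_single, eraseLetter_single, eraseWord, if_pos h]
    rw [← consL_single, cut_consL, map_sub, mapPair_pair, hl, mapPair_mapPair]
    by_cases hy : y = {a}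
    · have e : eraseLetter a ∘ₗ consL (R := R) y = 0 :=
        LinearMap.ext fun t => by subst hy; exact eraseLetter_consL_self a t
      simp [e]
    · have e : eraseLetter a ∘ₗ consL (R := R) y =
          consL (y.filter (· ≠ a)) ∘ₗ eraseLetter a :=
        LinearMap.ext fun t => eraseLetter_consL hy t
      have h' : {a} ∈ l := by simpa [Ne.symm hy] using h
      have e2 := mapPair_mapPair (consL (y.filter (· ≠ a))) LinearMap.id (eraseLetter a)
        (eraseLetter a) (cut (Finsupp.single l (1 : R)))
      rw [LinearMap.id_comp] at e2
      rw [e, LinearMap.comp_id, ← e2, ih h']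
      simp

theorem contractLeft_cut_cons (a : α) (y : Multiset α) (l : List (Multiset α)) :
    contractLeft (Finsupp.lapply [{a}]) (cut (Finsupp.single (y :: l) (1 : R))) =
      if y = {a} ∧ l ≠ [] then -Finsupp.single l 1 else 0 := by
  rw [← consL_single, cut_consL, map_sub, contractLeft_pair, contractLeft_mapLeft]
  by_cases hy : y = {a}
  · rw [hy, lapply_comp_consL]
    by_cases hl : l = []
    · simp [hl]
    · rw [contractLeft_nil_cut l hl]
      simp [hl]
  · rw [lapply_comp_consL_of_ne hy]
    simp [hy]

theorem contractLeft_cut_eq_zero {a : α} {l : List (Multiset α)} (h : {a} ∉ l) :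
    contractLeft (Finsupp.lapply [{a}]) (cut (Finsupp.single l (1 : R))) = 0 := by
  cases l with
  | nil => simp
  | cons y l =>
    rw [contractLeft_cut_cons, if_neg]
    rintro ⟨rfl, -⟩
    simp at h

/-- The coefficient of the cut in which both pieces are `[{a}]`; this would use `a` twice. -/
theorem contractRight_cut_apply {a : α} {l : List (Multiset α)} (h : l.sum.count a ≤ 1) :
    contractRight (Finsupp.lapply [{a}]) (cut (Finsupp.single l (1 : R))) [{a}] = 0 := by
  cases l with
  | nil => simp
  | cons y l =>
    rw [← consL_single, cut_consL, map_sub, contractRight_mapLeft, contractRight_pair,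
      Finsupp.sub_apply]
    by_cases hy : y = {a}
    · subst hy
      have hl : {a} ∉ l := by
        intro hl
        have h1 := Multiset.count_le_of_le a (List.single_le_sum (l := l) (by simp) _ hl)
        rw [List.sum_cons, Multiset.count_add] at h
        simp only [Multiset.count_singleton_self] at h h1
        omega
      rw [contractRight_cut_eq_zero hl]
      simp
    · rw [consL_apply_of_ne hy]
      simp

/-- An interior letter `{a}` merges with its left and with its right neighbour; after erasing, the
two results agree and have opposite signs. At an end of the word one of these mergers is missing,
and the cut that splits off `[{a}]` takes its place. The word `[{a}]` has no mergers, only the cut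
with empty left piece. -/
theorem eraseLetter_merge_add {a : α} {l : List (Multiset α)} (h : l.sum.count a = 1)
    (ha : {a} ∈ l) (h0 : 0 ∉ l) :
    eraseLetter a (merge (Finsupp.single l (1 : R)) +
      (contractRight (Finsupp.lapply [{a}]) (cut (Finsupp.single l 1)) +
        contractLeft (Finsupp.lapply [{a}]) (cut (Finsupp.single l 1)))) =
      if l = [{a}] then Finsupp.single [] 1 else 0 := by
  induction l with
  | nil => simp at ha
  | cons y l ih =>
    rw [List.sum_cons, Multiset.count_add] at h
    simp only [List.mem_cons, not_or] at h0
    rw [contractLeft_cut_cons, ← consL_single, merge_consL, cut_consL, map_sub,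
      contractRight_mapLeft, contractRight_pair]
    by_cases hy : y = {a}
    · subst hy
      have hl : a ∉ l.sum := by
        rw [← Multiset.count_eq_zero]; simp at h; simpa using h
      have hl' : {a} ∉ l := fun hh => hl (Multiset.mem_of_le (List.single_le_sum (by simp) _ hh)
        (by simp))
      cases l with
      | nil => simp
      | cons z l =>
        simp only [List.sum_cons, Multiset.mem_add, not_or] at hl
        have h1 : {a} + z ≠ {a} := add_ne_singleton (by simp) fun h => h0.2 (by simp [h])
        have h2 : z ≠ {a} := by rintro rfl; simp at hl
        have h3 : ({a} + z).filter (· ≠ a) = z.filter (· ≠ a) := by simp [Multiset.filter_add]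
        rw [← consL_single, mergeFirst_consL]
        simp only [map_add, map_sub, eraseLetter_consL_self, eraseLetter_consL h1, h3]
        simp [eraseLetter_consL h2, -consL_single]
    · have ha' : {a} ∈ l := by simpa [Ne.symm hy] using ha
      have hl : l.sum.count a = 1 := by
        have h1 := Multiset.count_le_of_le a (List.single_le_sum (l := l) (by simp) _ ha')
        simp only [Multiset.count_singleton_self] at h1
        omega
      specialize ih hl ha' h0.2
      cases l with
      | nil => simp at hl
      | cons z l =>
        have h1 : y + z ≠ {a} := add_ne_singleton (Ne.symm h0.1) fun h => h0.2 (by simp [h])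
        have e := congrArg (consL (y.filter (· ≠ a))) ih
        rw [contractLeft_cut_cons] at e
        simp only [map_add] at e
        simp only [map_add, map_sub, eraseLetter_consL hy, consL_apply_of_ne hy, hy, false_and,
          if_false, map_zero, Finsupp.lapply_apply, zero_smul]
        have hne : ¬(y :: z :: l = [{a}]) := by simp
        rw [if_neg hne, ← consL_single z, mergeFirst_consL, eraseLetter_consL h1,
          Multiset.filter_add]
        rw [← consL_single z] at e
        generalize y.filter (· ≠ a) = y' at *
        by_cases hz : z = {a}
        · subst hz
          have hf : ({a} : Multiset α).filter (· ≠ a) = 0 := by simp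
          rw [hf, add_zero]
          by_cases hl : l = []
          · subst hl
            simp only [if_true, ne_eq, not_true_eq_false, and_false, if_false, map_zero,
              add_zero, eraseLetter_nil] at e ⊢
            linear_combination (norm := module) -e
          · simp only [hl, if_true, ne_eq, not_false_eq_true, and_self, map_neg, List.cons.injEq,
              and_false, if_false, map_zero] at e ⊢
            linear_combination (norm := module) -e
        · have h3 : {a} ∈ l := by simpa [Ne.symm hz] using ha'
          have h4 : eraseLetter a (Finsupp.single l (1 : R)) = 0 := by
            rw [eraseLetter_single, eraseWord, if_pos h3]
          simp only [hz, false_and, List.cons.injEq, if_false, map_zero, add_zero] at e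
          rw [h4]
          simp only [map_zero, add_zero]
          linear_combination (norm := module) -e

/-- If `{a}` is not a letter, erasing commutes with merging and with cutting. If it is, the right
side is zero, because `forget a` gives `0` or `1`, and the left side is zero by
`eraseLetter_merge_add`. -/
theorem forget_bd_factor {a : α} {l : List (Multiset α)} (h : l.sum.count a ≤ 1) (h0 : 0 ∉ l) :
    forget R a (bd R _ (word R [l])) = bd R _ (forget R a (word R [l])) := by
  have hbd1 : bd R (Multiset α) 1 = 0 := deriv_one _
  have hnil : ([] : List (Multiset α)) ≠ [{a}] := by simp
  rw [← factor_single, bd_factor, forget_factor, factorBd_apply, map_sub, map_add, forget_mul,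
    forget_factor, forget_factor, forget_factorPair, contractRight_cut_apply h,
    ← factor_single [], forget_factor, forgetFactor_apply (t := merge _), merge_apply_letter a h0,
    forgetFactor_single, forgetFactor_apply, map_add (bd R _), map_smul (bd R _), bd_factor, hbd1]
  simp only [hnil, if_false, List.not_mem_nil, List.map_nil, smul_zero, zero_smul, add_zero]
  by_cases ha : {a} ∈ l
  · have h1 : l.sum.count a = 1 := by
      have h1 := Multiset.count_le_of_le a (List.single_le_sum (l := l) (by simp) _ ha)
      simp at h1
      omega
    have e1 := congrArg factor (eraseLetter_merge_add (R := R) h1 ha h0)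
    have e2 : eraseLetter a (Finsupp.single l (1 : R)) = 0 := by
      rw [eraseLetter_single, eraseWord, if_pos ha]
    rw [mapPair_eraseLetter_cut_eq_zero ha, e2]
    rw [map_add, map_add] at e1
    simp only [map_zero, zero_add, e1, Finsupp.single_apply]
    split_ifs <;> simp
  · have hl : l ≠ [{a}] := by rintro rfl; simp at ha
    rw [mapPair_eraseLetter_cut ha, contractRight_cut_eq_zero ha, contractLeft_cut_eq_zero ha,
      eraseLetter_merge ha h0, factorBd_apply, Finsupp.single_apply, if_neg hl]
    simp

theorem sgn_forget (a : α) (x : Cells R (Multiset α)) :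
    sgn (forget R a x) = forget R a (sgn x) := by
  induction x using Cells.induction with
  | zero => simp
  | add s s' hs ht => simp only [map_add, hs, ht]
  | smul r s hs => simp [hs]
  | word w =>
    induction w with
    | nil => 
      have : sgn (1 : Cells R (Multiset α)) = 1 := by rw [← word_nil, sgn_word]; simp [parity]
      simp [this]
    | cons b w ih =>
      rw [word_cons, forget_mul, sgn_mul, sgn_mul, forget_mul, ih]
      congr 1
      rw [← factor_single, sgn_factor, forget_factor, alt_single, map_smul, map_neg, map_smul,
        forget_factor, forgetFactor_single]
      by_cases h1 : b = [{a}]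
      · rw [if_pos h1, h1, ← word_nil, sgn_word]
        simp [parity]
      · rw [if_neg h1]
        by_cases h2 : {a} ∈ b
        · simp [h2]
        · rw [if_neg h2, sgn_word]
          simp [parity, pow_succ]

theorem forget_bd {a : α} {w : List (List (Multiset α))} (h : w.flatten.sum.count a ≤ 1)
    (h0 : 0 ∉ w.flatten) :
    forget R a (bd R _ (word R w)) = bd R _ (forget R a (word R w)) := by
  induction w with
  | nil =>
    have hbd1 : bd R (Multiset α) 1 = 0 := deriv_one _
    simp [hbd1]
  | cons b w ih =>
    rw [List.flatten_cons, List.sum_append, Multiset.count_add] at h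
    simp only [List.flatten_cons, List.mem_append, not_or] at h0
    rw [word_cons, bd_mul, map_add, forget_mul, forget_mul, forget_mul, bd_mul,
      forget_bd_factor (by omega) h0.1, ih (by omega) h0.2, sgn_forget]

end Forget
-- Content, dimension and length of factors; acyclicity in the free algebra
section Span

variable (R : Type*) [CommRing R]

/-- The span of the words of `n` nonzero letters of sum `S`. -/
def tensSpan {X : Type*} [AddCommMonoid X] (S : X) (n : ℕ) : Submodule R (Tens R X) :=
  Submodule.span R {t | ∃ l : List X, l.sum = S ∧ l.length = n ∧ 0 ∉ l ∧ t = Finsupp.single l 1}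

/-- Products of nonempty factors of at most `m` nonzero letters, of dimension `k`, where the sum of
all letters is `S`. -/
structure IsGoodWord {X : Type*} [AddCommMonoid X] (S : X) (m k : ℕ) (w : List (List X)) :
    Prop where
  sum_eq : w.flatten.sum = S
  ne_nil : [] ∉ w
  ne_zero : 0 ∉ w.flatten
  dim_eq : (w.map fun b => b.length - 1).sum = k
  length_le : ∀ b ∈ w, b.length ≤ m

/-- The span of the words that satisfy `IsGoodWord`. -/
def cellSpan {X : Type*} [AddCommMonoid X] (S : X) (m k : ℕ) : Submodule R (Cells R X) :=
  Submodule.span R {z | ∃ w, IsGoodWord S m k w ∧ z = word R w}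

variable {R}

section
variable {X : Type*}

variable (R X) in
/-- The sum of the coefficients. -/
def aug : Cells R X →ₗ[R] R := liftWord fun _ => 1

@[simp] theorem aug_word (w : List (List X)) : aug R X (word R w) = 1 := by simp [aug]

theorem aug_mul (x y : Cells R X) : aug R X (x * y) = aug R X x * aug R X y := by
  induction x using Cells.induction with
  | zero => simp
  | add s s' hs ht => simp only [map_add, hs, ht, add_mul]
  | smul r s hs => simp [hs, mul_assoc]
  | word u =>
    induction y using Cells.induction with
    | zero => simp
    | add s s' hs ht => simp only [map_add, hs, ht, mul_add]
    | smul r s hs => simp only [map_smul, hs, mul_smul_comm]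
    | word w => rw [← word_append]; simp

variable [AddCommMonoid X]

theorem single_mem_tensSpan {l : List X} (h0 : 0 ∉ l) :
    Finsupp.single l (1 : R) ∈ tensSpan R l.sum l.length :=
  Submodule.subset_span ⟨l, rfl, rfl, h0, rfl⟩

theorem consL_mem_tensSpan {y S : X} (hy : y ≠ 0) {n : ℕ} {t : Tens R X} (ht : t ∈ tensSpan R S n) :
    consL y t ∈ tensSpan R (y + S) (n + 1) := by
  induction ht using Submodule.span_induction with
  | mem t h =>
    obtain ⟨l, rfl, rfl, h0, rfl⟩ := h
    exact Submodule.subset_span ⟨y :: l, by simp, by simp, by simp [hy.symm, h0], by simp⟩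
  | zero => simp
  | add a b _ _ ha hb => rw [map_add]; exact add_mem ha hb
  | smul c a _ ha => rw [map_smul]; exact Submodule.smul_mem _ _ ha

theorem ins_mem_tensSpan {a : X} (ha : a ≠ 0) {l : List X} (h0 : 0 ∉ l) :
    ins a (Finsupp.single l (1 : R)) ∈ tensSpan R (a + l.sum) (l.length + 1) := by
  induction l with
  | nil =>
    rw [ins_nil]
    exact Submodule.subset_span ⟨[a], by simp, by simp, by simp [ha.symm], rfl⟩
  | cons y l ih =>
    simp only [List.mem_cons, not_or] at h0
    have hs := single_mem_tensSpan (R := R) h0.2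
    rw [← consL_single, ins_consL]
    refine sub_mem (consL_mem_tensSpan ha ?_) ?_
    · exact consL_mem_tensSpan (Ne.symm h0.1) hs
    · have := consL_mem_tensSpan (Ne.symm h0.1) (ih h0.2)
      rwa [add_left_comm] at this

theorem factor_mem_cellSpan {S : X} {n m : ℕ} (hn : n + 1 ≤ m) {t : Tens R X}
    (ht : t ∈ tensSpan R S (n + 1)) : factor t ∈ cellSpan R S m n := by
  induction ht using Submodule.span_induction with
  | mem t h =>
    obtain ⟨l, rfl, hl, h0, rfl⟩ := h
    refine Submodule.subset_span ⟨[l], ⟨by simp, ?_, by simpa using h0, by simp [hl], ?_⟩, by simp⟩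
    · simp only [List.mem_singleton]
      rintro rfl
      simp at hl
    · simp only [List.mem_singleton, forall_eq]
      omega
  | zero => simp
  | add a b _ _ ha hb => rw [map_add]; exact add_mem ha hb
  | smul c a _ ha => rw [map_smul]; exact Submodule.smul_mem _ _ ha

theorem mul_mem_cellSpan {S T : X} {m k j : ℕ} {x y : Cells R X} (hx : x ∈ cellSpan R S m k)
    (hy : y ∈ cellSpan R T m j) : x * y ∈ cellSpan R (S + T) m (k + j) := by
  induction hx using Submodule.span_induction with
  | mem t h =>
    obtain ⟨u, hu, rfl⟩ := h
    induction hy using Submodule.span_induction with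
    | mem t h =>
      obtain ⟨v, hv, rfl⟩ := h
      refine Submodule.subset_span ⟨u ++ v, ⟨?_, ?_, ?_, ?_, ?_⟩, (word_append u v).symm⟩
      · rw [List.flatten_append, List.sum_append, hu.sum_eq, hv.sum_eq]
      · simp [hu.ne_nil, hv.ne_nil]
      · rw [List.flatten_append, List.mem_append]
        exact fun h => h.elim hu.ne_zero hv.ne_zero
      · rw [List.map_append, List.sum_append, hu.dim_eq, hv.dim_eq]
      · intro b hb
        exact (List.mem_append.1 hb).elim (hu.length_le b) (hv.length_le b)
    | zero => simp
    | add a b _ _ ha hb => rw [mul_add]; exact add_mem ha hb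
    | smul c a _ ha => rw [mul_smul_comm]; exact Submodule.smul_mem _ _ ha
  | zero => simp
  | add a b _ _ ha hb => rw [add_mul]; exact add_mem ha hb
  | smul c a _ ha => rw [smul_mul_assoc]; exact Submodule.smul_mem _ _ ha

theorem one_mem_cellSpan (m : ℕ) : (1 : Cells R X) ∈ cellSpan R 0 m 0 :=
  Submodule.subset_span ⟨[], ⟨rfl, by simp, by simp, rfl, by simp⟩, rfl⟩

theorem cellSpan_mono {S : X} {m m' k : ℕ} (h : m ≤ m') : cellSpan R S m k ≤ cellSpan R S m' k := by
  refine Submodule.span_mono ?_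
  rintro z ⟨w, hw, rfl⟩
  exact ⟨w, ⟨hw.1, hw.2, hw.3, hw.4, fun b hb => (hw.5 b hb).trans h⟩, rfl⟩

theorem IsGoodWord.tail {S : X} {m k : ℕ} {b : List X} {w : List (List X)}
    (h : IsGoodWord S m k (b :: w)) :
    IsGoodWord w.flatten.sum m (w.map fun b => b.length - 1).sum w := by
  obtain ⟨h1, h2, h3, h4, h5⟩ := h
  simp only [List.mem_cons, not_or, List.flatten_cons, List.mem_append] at h2 h3 h5
  exact ⟨rfl, h2.2, h3.2, rfl, fun c hc => h5 c (Or.inr hc)⟩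

theorem word_mem_cellSpan {S : X} {m k : ℕ} {w : List (List X)} (h : IsGoodWord S m k w) :
    word R w ∈ cellSpan R S m k := Submodule.subset_span ⟨w, h, rfl⟩

theorem sgn_mem_cellSpan {S : X} {m k : ℕ} {x : Cells R X} (hx : x ∈ cellSpan R S m k) :
    sgn x ∈ cellSpan R S m k := by
  induction hx using Submodule.span_induction with
  | mem t h =>
    obtain ⟨u, hu, rfl⟩ := h
    rw [sgn_word]
    exact Submodule.smul_mem _ _ (word_mem_cellSpan hu)
  | zero => simp
  | add a b _ _ ha hb => rw [map_add]; exact add_mem ha hb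
  | smul c a _ ha => rw [map_smul]; exact Submodule.smul_mem _ _ ha

end

variable {α : Type*}

theorem sum_map_filter (p : α → Prop) [DecidablePred p] (l : List (Multiset α)) :
    (l.map (Multiset.filter p)).sum = l.sum.filter p := by
  induction l with
  | nil => simp
  | cons y l ih => simp [ih, Multiset.filter_add]

/-- Start of the induction on the variables: without variables the only word is the empty product,
of dimension zero, and its coefficient is the augmentation. -/
theorem cellSpan_zero_eq_zero {m k : ℕ} {z : Cells R (Multiset α)}
    (hz : z ∈ cellSpan R (0 : Multiset α) m k) (hk : k = 0 → aug R _ z = 0) : z = 0 := by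
  have key : z = aug R _ z • (1 : Cells R (Multiset α)) ∧ (k ≠ 0 → z = 0) := by
    clear hk
    induction hz using Submodule.span_induction with
    | mem t h =>
      obtain ⟨w, ⟨h1, h2, h3, h4, h5⟩, rfl⟩ := h
      have hw : w = [] := by
        rcases w with _ | ⟨b, w⟩
        · rfl
        · rcases b with _ | ⟨y, b⟩
          · simp at h2
          · simp only [List.flatten_cons, List.cons_append, List.sum_cons, add_eq_zero] at h1
            simp [h1.1] at h3
      subst hw
      subst h4
      rw [aug_word, one_smul, word_nil]
      simp
    | zero => simp
    | add x y _ _ hx hy =>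
      refine ⟨?_, fun h => by rw [hx.2 h, hy.2 h, add_zero]⟩
      rw [map_add, add_smul, ← hx.1, ← hy.1]
    | smul c a _ ha =>
      refine ⟨?_, fun h => by rw [ha.2 h, smul_zero]⟩
      rw [map_smul, smul_eq_mul, mul_smul, ← ha.1]
  by_cases h : k = 0
  · rw [key.1, hk h, zero_smul]
  · exact key.2 h

variable [DecidableEq α]

/-- Detaching only redistributes variables and creates one new letter. No letter becomes empty,
since `pull` leaves out the letter `{a}`. -/
theorem detach_mem_tensSpan (a : α) {l : List (Multiset α)} (h0 : 0 ∉ l) :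
    detach a (Finsupp.single l (1 : R)) ∈ tensSpan R l.sum (l.length + 1) := by
  induction l with
  | nil => simp
  | cons y l ih =>
    simp only [List.mem_cons, not_or] at h0
    rw [← consL_single, detach_consL, List.sum_cons, List.length_cons]
    refine sub_mem ?_ (consL_mem_tensSpan (Ne.symm h0.1) (ih h0.2))
    by_cases h : a ∈ y ∧ y ≠ {a}
    · have h1 : y.erase a ≠ 0 := by
        intro h1
        have := Multiset.cons_erase h.1
        rw [h1] at this
        exact h.2 (by simpa using this.symm)
      rw [pull_of_mem h.1 h.2]
      have := consL_mem_tensSpan h1 (ins_mem_tensSpan (R := R) (a := {a}) (by simp) h0.2)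
      rwa [← add_assoc, add_comm (y.erase a) {a}, Multiset.singleton_add, Multiset.cons_erase h.1] at this
    · simp [pull, h]

/-- Each term of the derivation lengthens a single factor by one letter. This is the origin of the
bound `m + 1`. -/
theorem contr_mem_cellSpan (a : α) {S : Multiset α} {m k : ℕ} {x : Cells R (Multiset α)}
    (hx : x ∈ cellSpan R S m k) : contr R a x ∈ cellSpan R S (m + 1) (k + 1) := by
  induction hx using Submodule.span_induction with
  | mem t h =>
    obtain ⟨w, hw, rfl⟩ := h
    induction w generalizing S k with
    | nil => rw [word_nil, contr, deriv_one]; exact zero_mem _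
    | cons b w ih =>
      have ht := hw.tail
      obtain ⟨h1, h2, h3, h4, h5⟩ := hw
      simp only [List.mem_cons, not_or, List.flatten_cons, List.mem_append, List.sum_append,
        List.map_cons, List.sum_cons, forall_eq_or_imp] at h1 h2 h3 h4 h5
      have hb : 0 < b.length := List.length_pos_iff.2 (Ne.symm h2.1)
      have hbm : word R [b] ∈ cellSpan R b.sum (m + 1) (b.length - 1) :=
        word_mem_cellSpan ⟨by simp, by simp [h2.1], by simp [h3.1], by simp, by simp; omega⟩
      rw [word_cons, contr_mul, ← factor_single, contr_factor, factor_single]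
      refine add_mem ?_ ?_
      · have h6 : factor (detach a (Finsupp.single b (1 : R))) ∈
            cellSpan R b.sum (m + 1) b.length :=
          factor_mem_cellSpan (by omega) (detach_mem_tensSpan a h3.1)
        convert mul_mem_cellSpan h6 (cellSpan_mono (Nat.le_succ m) (word_mem_cellSpan ht)) using 2
        · exact h1.symm
        · omega
      · convert mul_mem_cellSpan (sgn_mem_cellSpan hbm) (ih ht) using 2
        · exact h1.symm
        · omega
  | zero => simp
  | add a b _ _ ha hb => rw [map_add]; exact add_mem ha hb
  | smul c a _ ha => rw [map_smul]; exact Submodule.smul_mem _ _ ha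

theorem forget_word_mem_cellSpan {a : α} {S : Multiset α} {m k : ℕ} {w : List (List (Multiset α))}
    (hw : IsGoodWord S m k w) (hS : S.count a ≤ 1) :
    forget R a (word R w) ∈ cellSpan R (S.filter (· ≠ a)) m k := by
  induction w generalizing S k with
  | nil =>
    obtain ⟨h1, h2, h3, h4, h5⟩ := hw
    simp only [List.flatten_nil, List.sum_nil, List.map_nil] at h1 h4
    subst h1 h4
    rw [word_nil, forget_one, Multiset.filter_zero]
    exact one_mem_cellSpan m
  | cons b w ih =>
    have ht := hw.tail
    obtain ⟨h1, h2, h3, h4, h5⟩ := hw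
    simp only [List.mem_cons, not_or, List.flatten_cons, List.mem_append, List.sum_append,
      List.map_cons, List.sum_cons, forall_eq_or_imp] at h1 h2 h3 h4 h5
    rw [← h1, Multiset.count_add] at hS
    rw [word_cons, forget_mul, ← h1, ← h4, Multiset.filter_add]
    refine mul_mem_cellSpan ?_ (ih ht (by omega))
    rw [← factor_single, forget_factor, forgetFactor_single]
    split_ifs with hb hb'
    · rw [hb, List.sum_singleton, Multiset.filter_singleton, if_neg (by simp)]
      exact one_mem_cellSpan m
    · exact zero_mem _
    · refine word_mem_cellSpan ⟨?_, ?_, ?_, by simp, by simpa using h5.1⟩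
      · simpa using sum_map_filter (· ≠ a) b
      · simpa using Ne.symm h2.1
      · simp only [List.flatten_cons, List.flatten_nil, List.append_nil, List.mem_map, not_exists,
          not_and]
        intro y hy h
        rw [Multiset.filter_eq_nil] at h
        have hc := Multiset.count_le_of_le a (List.single_le_sum (l := b) (by simp) _ hy)
        -- A letter that erasing would empty consists of copies of `a`. As `a` occurs at most once,
        -- it is `{a}`, the case already treated.
        have h6 : y = Multiset.replicate (Multiset.card y) a :=
          Multiset.eq_replicate_card.2 fun c hc => by simpa using h c hc
        have h7 : y.count a = Multiset.card y := by
          rw [h6]; simp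
        have h8 : 0 < Multiset.card y := Multiset.card_pos.2 fun h => h3.1 (h ▸ hy)
        have h9 : Multiset.card y = 1 := by omega
        rw [h9] at h6
        exact hb' (by rw [h6] at hy; simpa using hy)

/-- In dimension zero every factor has exactly one letter, so none is killed by `forget a`. -/
theorem aug_forget_word {a : α} {S : Multiset α} {m : ℕ} {w : List (List (Multiset α))}
    (hw : IsGoodWord S m 0 w) : aug R _ (forget R a (word R w)) = 1 := by
  induction w generalizing S with
  | nil => rw [word_nil, forget_one, ← word_nil, aug_word]
  | cons b w ih =>
    have ht := hw.tail
    obtain ⟨h1, h2, h3, h4, h5⟩ := hw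
    simp only [List.mem_cons, not_or, List.map_cons, List.sum_cons, Nat.add_eq_zero_iff] at h2 h4
    rw [h4.2] at ht
    rw [word_cons, forget_mul, aug_mul, ih ht, ← factor_single, forget_factor, forgetFactor_single]
    have hb : b.length = 1 := by
      have : 0 < b.length := List.length_pos_iff.2 (Ne.symm h2.1)
      omega
    obtain ⟨y, rfl⟩ := List.length_eq_one_iff.1 hb
    by_cases hy : y = {a}
    · rw [if_pos (by rw [hy]), ← word_nil, aug_word, mul_one]
    · simp [hy, Ne.symm hy]

/-- Every reduced cycle is a boundary, and the length of factors increases by at most one. -/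
theorem exists_bd_sub_mem {S : Multiset α} (hS : S.Nodup) {m k : ℕ} {z : Cells R (Multiset α)}
    (hz : z ∈ cellSpan R S m k) (hcyc : bd R _ z ∈ relIdeal R _)
    (hk : k = 0 → aug R _ z = 0) :
    ∃ y ∈ cellSpan R S (m + 1) (k + 1), bd R _ y - z ∈ relIdeal R _ := by
  induction S using Multiset.induction generalizing z with
  | empty =>
    refine ⟨0, zero_mem _, ?_⟩
    rw [cellSpan_zero_eq_zero hz hk]
    simp
  | cons a S ih =>
    rw [Multiset.nodup_cons] at hS
    have hcount : (a ::ₘ S).count a = 1 := by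
      rw [Multiset.count_cons_self, Multiset.count_eq_zero_of_notMem hS.1]
    have hfilter : (a ::ₘ S).filter (· ≠ a) = S := by
      rw [Multiset.filter_cons_of_neg _ (by simp), Multiset.filter_eq_self]
      rintro b hb rfl
      exact hS.1 hb
    -- All that the induction step needs to know about `z` is linear in `z`, so it can be checked on
    -- words.
    have h1 : forget R a z ∈ cellSpan R S m k ∧
        forget R a (bd R _ z) = bd R _ (forget R a z) ∧
        (k = 0 → aug R _ (forget R a z) = aug R _ z) ∧
        bdContr a z - (z - forget R a z * word R [[{a}]]) ∈ relIdeal R _ := by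
      clear hcyc hk
      induction hz using Submodule.span_induction with
      | mem t h =>
        obtain ⟨w, hw, rfl⟩ := h
        refine ⟨?_, forget_bd ?_ hw.ne_zero, ?_, bdContr_word_sub_mem ?_ hw.ne_zero⟩
        · have := forget_word_mem_cellSpan (R := R) hw hcount.le
          rwa [hfilter] at this
        · rw [hw.sum_eq, hcount]
        · rintro rfl
          rw [aug_forget_word hw, aug_word]
        · rw [hw.sum_eq, hcount]
      | zero => simp
      | add x y _ _ hx hy =>
        refine ⟨?_, ?_, fun hk => ?_, ?_⟩
        · rw [map_add]; exact add_mem hx.1 hy.1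
        · simp only [map_add, hx.2.1, hy.2.1]
        · simp only [map_add, hx.2.2.1 hk, hy.2.2.1 hk]
        · convert add_mem hx.2.2.2 hy.2.2.2 using 1
          simp only [map_add, add_mul]
          abel
      | smul c x _ hx =>
        refine ⟨?_, ?_, fun hk => ?_, ?_⟩
        · rw [map_smul]; exact Submodule.smul_mem _ _ hx.1
        · simp only [map_smul, hx.2.1]
        · simp only [map_smul, hx.2.2.1 hk]
        · convert Submodule.smul_mem _ c hx.2.2.2 using 1
          simp [smul_sub]
    obtain ⟨hf, hfb, hfa, hD⟩ := h1
    obtain ⟨y, hy, hyb⟩ := ih hS.2 hf (by rw [← hfb]; exact forget_mem_relIdeal a hcyc)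
      (fun h => by rw [hfa h, hk h])
    -- The first summand bounds `z - forget a z * p_1(a)`, because `contr a` maps the boundary of
    -- `z` into the ideal; the second bounds what is missing, `p_1(a)` being closed.
    refine ⟨contr R a z + y * word R [[{a}]], add_mem (contr_mem_cellSpan a hz) ?_, ?_⟩
    · have h2 : word R [[({a} : Multiset α)]] ∈ cellSpan R {a} (m + 1) 0 :=
        word_mem_cellSpan ⟨by simp, by simp, by simp, by simp, by simp⟩
      have := mul_mem_cellSpan hy h2
      rwa [add_comm, Multiset.singleton_add] at this
    · have h3 : bd R _ (word R [[({a} : Multiset α)]]) = 0 := by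
        rw [← factor_single, bd_factor, factorBd_apply, ← consL_single, merge_consL, cut_consL]
        simp
      have h4 := mul_mem_relIdeal_right (word R [[({a} : Multiset α)]]) hyb
      have h5 := contr_mem_relIdeal a hcyc
      convert sub_mem (add_mem hD h4) h5 using 1
      rw [map_add, bd_mul, h3, bdContr]
      simp only [LinearMap.add_apply, LinearMap.comp_apply]
      noncomm_ring

end Span
-- Shuffle permutations versus the recursive shuffle product
section PermShuffle

/-- The permutation that sends `p` to `0` and acts by `ρ` on the other indices. -/
def permOfZero {N : ℕ} (z : Fin (N + 1) × Equiv.Perm (Fin N)) : Equiv.Perm (Fin (N + 1)) :=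
  Equiv.Perm.decomposeFin.symm (0, z.2) * z.1.cycleRange

theorem permOfZero_self {N : ℕ} (p : Fin (N + 1)) (ρ : Equiv.Perm (Fin N)) :
    permOfZero (p, ρ) p = 0 := by simp [permOfZero]

theorem permOfZero_succAbove {N : ℕ} (p : Fin (N + 1)) (ρ : Equiv.Perm (Fin N)) (i : Fin N) :
    permOfZero (p, ρ) (p.succAbove i) = (ρ i).succ := by simp [permOfZero]

theorem permOfZero_inv_zero {N : ℕ} (p : Fin (N + 1)) (ρ : Equiv.Perm (Fin N)) :
    (permOfZero (p, ρ))⁻¹ 0 = p := by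
  rw [Equiv.Perm.inv_eq_iff_eq, permOfZero_self]

theorem permOfZero_inv_succ {N : ℕ} (p : Fin (N + 1)) (ρ : Equiv.Perm (Fin N)) (i : Fin N) :
    (permOfZero (p, ρ))⁻¹ i.succ = p.succAbove (ρ⁻¹ i) := by
  rw [Equiv.Perm.inv_eq_iff_eq, permOfZero_succAbove]
  simp

theorem sign_permOfZero {N : ℕ} (p : Fin (N + 1)) (ρ : Equiv.Perm (Fin N)) :
    Equiv.Perm.sign (permOfZero (p, ρ)) = (-1) ^ (p : ℕ) * Equiv.Perm.sign ρ := by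
  simp [permOfZero, mul_comm]

theorem permOfZero_bijective (N : ℕ) : Function.Bijective (permOfZero (N := N)) := by
  constructor
  · rintro ⟨p, ρ⟩ ⟨p', ρ'⟩ h
    have h1 : p = p' := by
      rw [← permOfZero_inv_zero p ρ, h, permOfZero_inv_zero]
    subst h1
    refine Prod.ext rfl (Equiv.ext fun i => Fin.succ_injective _ ?_)
    rw [← permOfZero_succAbove p, h, permOfZero_succAbove]
  · intro σ
    obtain ⟨⟨q, ρ⟩, h⟩ := Equiv.Perm.decomposeFin.symm.surjective (σ * (σ⁻¹ 0).cycleRange⁻¹)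
    have hq : q = 0 := by
      have := congrArg (fun f : Equiv.Perm (Fin (N + 1)) => f 0) h
      simpa [Equiv.Perm.inv_def] using this
    subst hq
    exact ⟨(σ⁻¹ 0, ρ), by rw [permOfZero, h, inv_mul_cancel_right]⟩

/-- The permutations of `N` indices that are increasing on the first `q` and on the last `N - q`
indices. -/
def cutShuffles (N q : ℕ) : Finset (Equiv.Perm (Fin N)) :=
  Finset.univ.filter fun σ =>
    ∀ i j : Fin N, i ≤ j → ((j : ℕ) < q ∨ q ≤ (i : ℕ)) → σ i ≤ σ j

theorem cutShuffles_eq (q r : ℕ) : cutShuffles (q + r) q = shuffles q r := by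
  ext σ
  simp only [cutShuffles, shuffles, Finset.mem_filter, Finset.mem_univ, true_and]
  constructor
  · intro h
    exact ⟨fun i j hij => h _ _ hij (Or.inl (by simp)),
      fun i j hij => h _ _ (by simpa using hij) (Or.inr (by simp))⟩
  · rintro ⟨h1, h2⟩ i j hij (h | h)
    · have h' : (i : ℕ) < q := lt_of_le_of_lt hij h
      exact h1 ⟨i, h'⟩ ⟨j, h⟩ hij
    · obtain ⟨i', rfl⟩ : ∃ k, i = Fin.natAdd q k :=
        ⟨⟨i - q, by omega⟩, Fin.ext (by simp; omega)⟩
      have h' : q ≤ (j : ℕ) := le_trans h hij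
      obtain ⟨j', rfl⟩ : ∃ k, j = Fin.natAdd q k :=
        ⟨⟨j - q, by omega⟩, Fin.ext (by simp; omega)⟩
      exact h2 i' j' (by simpa using hij)

/-- The first block loses its head. For `q = 0` there is no first block and the truncated `q - 1 =
0` is still right. -/
theorem permOfZero_zero_mem {N q : ℕ} (ρ : Equiv.Perm (Fin N)) :
    permOfZero (0, ρ) ∈ cutShuffles (N + 1) q ↔ ρ ∈ cutShuffles N (q - 1) := by
  simp only [cutShuffles, Finset.mem_filter, Finset.mem_univ, true_and]
  have h0 := permOfZero_self 0 ρ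
  have h1 := permOfZero_succAbove 0 ρ
  simp only [Fin.zero_succAbove] at h1
  constructor
  · intro h i j hij hq
    have := h i.succ j.succ (by simpa using hij) (by simp only [Fin.val_succ]; omega)
    simpa [h1] using this
  · intro h i j hij hq
    cases i using Fin.cases with
    | zero => rw [h0]; exact Fin.zero_le _
    | succ i =>
      cases j using Fin.cases with
      | zero => simp at hij
      | succ j =>
        simp only [Fin.val_succ] at hq
        rw [h1, h1, Fin.succ_le_succ_iff]
        exact h i j (by simpa using hij) (by omega)

theorem permOfZero_mem {N q : ℕ} (hq : q < N + 1) (ρ : Equiv.Perm (Fin N)) :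
    permOfZero (⟨q, hq⟩, ρ) ∈ cutShuffles (N + 1) q ↔ ρ ∈ cutShuffles N q := by
  simp only [cutShuffles, Finset.mem_filter, Finset.mem_univ, true_and]
  have h0 := permOfZero_self ⟨q, hq⟩ ρ
  have h1 := permOfZero_succAbove ⟨q, hq⟩ ρ
  have hv (i : Fin N) : (((⟨q, hq⟩ : Fin (N + 1)).succAbove i : Fin (N + 1)) : ℕ) =
      if (i : ℕ) < q then (i : ℕ) else i + 1 := by
    simp only [Fin.succAbove, Fin.lt_def, Fin.val_castSucc]
    split_ifs <;> simp
  constructor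
  · intro h i j hij hq'
    have h2 := h ((⟨q, hq⟩ : Fin (N + 1)).succAbove i) ((⟨q, hq⟩ : Fin (N + 1)).succAbove j)
      ((Fin.succAbove_le_succAbove_iff).2 hij) (by rw [hv, hv]; split_ifs <;> omega)
    rwa [h1, h1, Fin.succ_le_succ_iff] at h2
  · intro h i j hij hq'
    cases i using Fin.succAboveCases (⟨q, hq⟩ : Fin (N + 1)) with
    | x => rw [h0]; exact Fin.zero_le _
    | p i =>
      cases j using Fin.succAboveCases (⟨q, hq⟩ : Fin (N + 1)) with
      | x =>
        rw [Fin.le_def] at hij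
        rw [hv] at hij hq'
        simp only at hij hq'
        split_ifs at hij hq' <;> omega
      | p j =>
        rw [h1, h1, Fin.succ_le_succ_iff]
        refine h i j (Fin.succAbove_le_succAbove_iff.1 hij) ?_
        rw [hv, hv] at hq'
        split_ifs at hq' <;> omega

/-- If `p` is not the head of a block, its predecessor belongs to the same block and would have to
go below the value `0`. -/
theorem permOfZero_notMem {N q : ℕ} {p : Fin (N + 1)} (hp : p ≠ 0) (hq : (p : ℕ) ≠ q)
    (ρ : Equiv.Perm (Fin N)) : permOfZero (p, ρ) ∉ cutShuffles (N + 1) q := by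
  simp only [cutShuffles, Finset.mem_filter, Finset.mem_univ, true_and]
  intro h
  have hp' : 0 < (p : ℕ) := Fin.pos_iff_ne_zero.2 hp
  have := h ⟨p - 1, by omega⟩ p (by rw [Fin.le_def]; simp) (by simp only; omega)
  rw [permOfZero_self, Fin.le_zero_iff] at this
  have h2 := permOfZero_self p ρ
  have h3 := (permOfZero (p, ρ)).injective (this.trans h2.symm)
  rw [Fin.ext_iff] at h3
  simp only at h3
  omega

variable {R : Type*} [CommRing R] {X : Type*}

theorem ofFn_permOfZero {N : ℕ} (x : Fin (N + 1) → X) (p : Fin (N + 1)) (ρ : Equiv.Perm (Fin N)) :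
    (List.ofFn fun i => x ((permOfZero (p, ρ))⁻¹ i)) =
      x p :: List.ofFn fun i => x (p.succAbove (ρ⁻¹ i)) := by
  rw [List.ofFn_succ, permOfZero_inv_zero]
  simp only [permOfZero_inv_succ]

theorem ofFn_succAbove {N : ℕ} (x : Fin (N + 1) → X) (p : Fin (N + 1)) :
    (List.ofFn fun i => x (p.succAbove i)) = (List.ofFn x).eraseIdx p := by
  refine List.ext_getElem ?_ ?_
  · simp [List.length_eraseIdx, Fin.is_le]
  · intro i h1 h2
    simp only [List.getElem_ofFn, List.getElem_eraseIdx, Fin.succAbove, Fin.lt_def, Fin.val_castSucc]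
    split_ifs <;> rfl

/-- The term of a permutation in the signed shuffle product. -/
def shuffleTerm (R : Type*) [CommRing R] {N : ℕ} (x : Fin N → X) (σ : Equiv.Perm (Fin N)) :
    Tens R X :=
  Equiv.Perm.sign σ • Finsupp.single (List.ofFn fun i => x (σ⁻¹ i)) 1

theorem shuffleTerm_permOfZero {N : ℕ} (x : Fin (N + 1) → X) (p : Fin (N + 1))
    (ρ : Equiv.Perm (Fin N)) :
    shuffleTerm R x (permOfZero (p, ρ)) =
      (-1 : R) ^ (p : ℕ) • consL (x p) (shuffleTerm R (fun i => x (p.succAbove i)) ρ) := by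
  rw [shuffleTerm, shuffleTerm, ofFn_permOfZero, sign_permOfZero, Units.smul_def, Units.smul_def,
    map_zsmul, consL_single]
  push_cast
  rw [mul_smul, ← Int.cast_smul_eq_zsmul R ((-1) ^ (p : ℕ))]
  push_cast
  rfl

/-- Sort the shuffles by the index `p` that goes to `0`, that is, by the source of the first letter.
Only the heads `p = 0` and `p = q` of the two blocks are possible, and these give the two terms of
the recursion. The sign `(-1) ^ p` is the cost of bringing the letter to the front. -/
theorem sum_shuffleTerm {N q : ℕ} (hq : q ≤ N) (x : Fin N → X) :
    ∑ σ ∈ cutShuffles N q, shuffleTerm R x σ =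
      shuffleWords R ((List.ofFn x).take q) ((List.ofFn x).drop q) := by
  induction N generalizing q with
  | zero =>
    have : cutShuffles 0 q = {1} := by
      refine Finset.eq_singleton_iff_unique_mem.2 ⟨?_, fun σ _ => Subsingleton.elim _ _⟩
      simp [cutShuffles]
    rw [this]
    simp [shuffleTerm]
  | succ N ih =>
    have h1 : ∑ σ ∈ cutShuffles (N + 1) q, shuffleTerm R x σ =
        ∑ p : Fin (N + 1), ∑ ρ : Equiv.Perm (Fin N),
          if permOfZero (p, ρ) ∈ cutShuffles (N + 1) q then
            shuffleTerm R x (permOfZero (p, ρ)) else 0 := by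
      rw [← Fintype.sum_prod_type' (f := fun p ρ =>
          if permOfZero (p, ρ) ∈ cutShuffles (N + 1) q then
            shuffleTerm R x (permOfZero (p, ρ)) else 0),
        (permOfZero_bijective N).sum_comp fun σ =>
          if σ ∈ cutShuffles (N + 1) q then shuffleTerm R x σ else 0]
      simp
    have h2 (p : Fin (N + 1)) (h0 : p ≠ 0) (hp : (p : ℕ) ≠ q) :
        (∑ ρ : Equiv.Perm (Fin N), if permOfZero (p, ρ) ∈ cutShuffles (N + 1) q then
            shuffleTerm R x (permOfZero (p, ρ)) else 0) = 0 :=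
      Finset.sum_eq_zero fun ρ _ => if_neg (permOfZero_notMem h0 hp ρ)
    have h3 : (∑ ρ : Equiv.Perm (Fin N), if permOfZero (0, ρ) ∈ cutShuffles (N + 1) q then
            shuffleTerm R x (permOfZero (0, ρ)) else 0) =
        consL (x 0) (shuffleWords R ((List.ofFn fun i : Fin N => x i.succ).take (q - 1))
          ((List.ofFn fun i : Fin N => x i.succ).drop (q - 1))) := by
      simp only [permOfZero_zero_mem, shuffleTerm_permOfZero, Fin.val_zero, pow_zero, one_smul,
        Fin.zero_succAbove]
      rw [← ih (by omega), map_sum]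
      simp
    -- For `q = 0` and for `q = N + 1` one block is empty, and only `p = 0` contributes.
    rcases Nat.eq_zero_or_pos q with rfl | hq0
    · rw [h1, Fintype.sum_eq_single 0 fun p hp => h2 p hp fun h => hp (Fin.ext h), h3]
      simp
    rcases hq.eq_or_lt with rfl | hqN
    · rw [h1, Fintype.sum_eq_single 0 fun p hp => h2 p hp (by omega), h3]
      simp [List.take_of_length_le, List.drop_of_length_le]
    rw [h1, Fintype.sum_eq_add 0 ⟨q, hqN⟩ (by rw [Ne, Fin.ext_iff]; exact hq0.ne)
      (fun p hp => h2 p hp.1 fun h => hp.2 (Fin.ext h)), h3]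
    obtain ⟨q, rfl⟩ : ∃ j, q = j + 1 := ⟨q - 1, by omega⟩
    have h4 : (∑ ρ : Equiv.Perm (Fin N), if permOfZero (⟨q + 1, hqN⟩, ρ) ∈
            cutShuffles (N + 1) (q + 1) then
            shuffleTerm R x (permOfZero (⟨q + 1, hqN⟩, ρ)) else 0) =
        (-1 : R) ^ (q + 1) • consL (x ⟨q + 1, hqN⟩) (shuffleWords R
          ((List.ofFn x).take (q + 1)) ((List.ofFn x).drop (q + 2))) := by
      simp only [permOfZero_mem, shuffleTerm_permOfZero]
      have := ih (q := q + 1) (by omega) fun i => x ((⟨q + 1, hqN⟩ : Fin (N + 1)).succAbove i)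
      rw [ofFn_succAbove] at this
      simp only at this
      rw [List.take_eraseIdx_eq_take_of_le _ _ _ le_rfl] at this
      have hd : ((List.ofFn x).eraseIdx (q + 1)).drop (q + 1) = (List.ofFn x).drop (q + 2) := by
        rw [List.eraseIdx_eq_take_drop_succ, List.drop_left']
        simp; omega
      rw [hd] at this
      rw [← this, map_sum, Finset.smul_sum]
      simp
    rw [h4]
    have hd : (List.ofFn x).drop (q + 1) = x ⟨q + 1, hqN⟩ :: (List.ofFn x).drop (q + 2) := by
      rw [List.drop_eq_getElem_cons (by simpa using hqN)]
      simp
    have ht : (List.ofFn x).take (q + 1) = x 0 :: (List.ofFn fun i : Fin N => x i.succ).take q := by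
      rw [List.ofFn_succ, List.take_succ_cons]
    have hd' : (List.ofFn fun i : Fin N => x i.succ).drop q = (List.ofFn x).drop (q + 1) := by
      rw [List.ofFn_succ (f := x), List.drop_succ_cons]
    rw [Nat.add_sub_cancel, hd', hd, ht, shuffleWords]
    congr 2
    rw [List.length_take, List.length_ofFn, min_eq_left (by omega)]

end PermShuffle
-- From chains of words to the free algebra and back
section Bridge

variable {R : Type*} [CommRing R]

theorem sum_shuffles (q r : ℕ) {X : Type*} (x : Fin (q + r) → X) :
    ∑ σ ∈ shuffles q r, shuffleTerm R x σ =
      shuffleWords R ((List.ofFn x).take q) ((List.ofFn x).drop q) := by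
  rw [← cutShuffles_eq, sum_shuffleTerm (Nat.le_add_right q r)]

section
variable {X : Type*}

theorem cut_single (l : List X) : cut (Finsupp.single l (1 : R)) =
    ∑ i ∈ Finset.range l.length,
      (-1 : R) ^ i • pair (Finsupp.single (l.take i) 1) (Finsupp.single (l.drop i) 1) := by
  induction l with
  | nil => simp
  | cons y l ih =>
    rw [← consL_single, cut_consL, ih, List.length_cons, Finset.sum_range_succ', map_sum, sub_eq_add_neg,
      add_comm, ← Finset.sum_neg_distrib]
    congr 1
    · refine Finset.sum_congr rfl fun i _ => ?_
      simp [pow_succ]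
    · simp

variable [AddCommMonoid X]

theorem merge_single (l : List X) : merge (Finsupp.single l (1 : R)) =
    ∑ i ∈ Finset.range (l.length - 1), (-1 : R) ^ i •
      Finsupp.single (l.take i ++ ((l.drop i).take 2).sum :: l.drop (i + 2)) 1 := by
  induction l with
  | nil => simp
  | cons y l ih =>
    rw [← consL_single, merge_consL, ih]
    rcases l with _ | ⟨z, l⟩
    · simp
    · rw [← consL_single z l, mergeFirst_consL]
      simp only [List.length_cons, Nat.add_sub_cancel]
      rw [Finset.sum_range_succ', map_sum, sub_eq_add_neg, add_comm, ← Finset.sum_neg_distrib]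
      congr 1
      · refine Finset.sum_congr rfl fun i _ => ?_
        rw [map_smul, consL_single, pow_succ]
        simp
      · simp

/-- The cut at `0` cancels against the term with the empty factor. Shifting the index of the
remaining cuts by one produces their minus sign. -/
theorem factorBd_single {l : List X} (hl : l ≠ []) : factorBd R X (Finsupp.single l 1) =
    ∑ i ∈ Finset.range (l.length - 1), (-1 : R) ^ i •
      (word R [l.take i ++ ((l.drop i).take 2).sum :: l.drop (i + 2)] -
        word R [l.take (i + 1), l.drop (i + 1)]) := by
  obtain ⟨k, hk⟩ : ∃ k, l.length = k + 1 :=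
    ⟨l.length - 1, by have := List.length_pos_iff.2 hl; omega⟩
  rw [factorBd_apply, merge_single, cut_single, hk, Finset.sum_range_succ', map_add, map_sum,
    map_sum, map_smul, factorPair_pair]
  simp only [Nat.add_sub_cancel, smul_sub, Finset.sum_sub_distrib, map_smul, factorPair_pair,
    factor_single, ← word_append, List.singleton_append, List.take_zero, List.drop_zero, pow_zero,
    one_smul, pow_succ, mul_neg, mul_one, neg_smul, map_neg, Finset.sum_neg_distrib]
  abel

end

variable {n : ℕ}

/-- The word with its arguments regarded as multisets of variables. -/
def toLetters (w : Word n) : List (List (Multiset (Fin n))) := w.map (List.map (↑))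

/-- A word with the given arguments. -/
def ofLetters (w : List (List (Multiset (Fin n)))) : Word n := w.map (List.map Multiset.toList)

theorem toLetters_ofLetters (w : List (List (Multiset (Fin n)))) : toLetters (ofLetters w) = w := by
  simp [toLetters, ofLetters, Function.comp_def]

theorem toLetters_append (u v : Word n) : toLetters (u ++ v) = toLetters u ++ toLetters v := by
  simp [toLetters]

theorem toLetters_cons (b : List (List (Fin n))) (w : Word n) :
    toLetters (b :: w) = b.map (↑) :: toLetters w := rfl

theorem map_coe_map_toList (b : List (Multiset (Fin n))) :
    (b.map Multiset.toList).map Multiset.ofList = b := by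
  simp [Function.comp_def]

theorem sum_map_coe (b : List (List (Fin n))) :
    (b.map ((↑) : List (Fin n) → Multiset (Fin n))).sum = ↑b.flatten := by
  induction b with
  | nil => rfl
  | cons x b ih => rw [List.map_cons, List.sum_cons, ih, List.flatten_cons, Multiset.coe_add]

theorem sum_flatten_toLetters (w : Word n) : (toLetters w).flatten.sum = ↑w.flatten.flatten := by
  rw [toLetters, ← List.map_flatten, sum_map_coe]

/-- Every variable occurs exactly once, and there are no empty factors or arguments. -/
def IsCellWord (w : List (List (Multiset (Fin n)))) : Prop :=
  w.flatten.sum = ↑(List.finRange n) ∧ [] ∉ w ∧ 0 ∉ w.flatten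

theorem isCell_iff (w : Word n) : w.IsCell ↔ IsCellWord (toLetters w) := by
  rw [Word.IsCell, IsCellWord, sum_flatten_toLetters, Multiset.coe_eq_coe]
  refine and_congr_right fun _ => and_congr ?_ ?_
  · simp only [toLetters, List.mem_map, List.map_eq_nil_iff, exists_eq_right]
    exact ⟨fun h h' => h _ h' rfl, fun h b hb h' => h (h' ▸ hb)⟩
  · simp only [toLetters, List.mem_flatten, List.mem_map, exists_exists_and_eq_and,
      Multiset.coe_eq_zero, exists_eq_right]
    exact ⟨fun h ⟨b, hb, h'⟩ => h b hb _ h' rfl, fun h b hb x hx h' => h ⟨b, hb, h' ▸ hx⟩⟩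

theorem dim_toLetters (w : Word n) : ((toLetters w).map fun b => b.length - 1).sum = w.dim := by
  simp [toLetters, Word.dim, Function.comp_def]

theorem toLetters_ofFn {N : ℕ} (x : Fin N → List (Fin n)) :
    toLetters [List.ofFn x] = [List.ofFn fun i => (x i : Multiset (Fin n))] := by
  simp [toLetters, List.map_ofFn, Function.comp_def]

theorem isGoodWord_iff {m k : ℕ} (w : Word n) :
    IsGoodWord (↑(List.finRange n)) m k (toLetters w) ↔
      w.IsCell ∧ w.dim = k ∧ ∀ b ∈ w, b.length ≤ m := by
  rw [isCell_iff, IsCellWord, ← dim_toLetters]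
  have : (∀ b ∈ toLetters w, b.length ≤ m) ↔ ∀ b ∈ w, b.length ≤ m := by simp [toLetters]
  rw [← this]
  exact ⟨fun ⟨h1, h2, h3, h4, h5⟩ => ⟨⟨h1, h2, h3⟩, h4, h5⟩,
    fun ⟨⟨h1, h2, h3⟩, h4, h5⟩ => ⟨h1, h2, h3, h4, h5⟩⟩

variable (R n) in
/-- Chains as elements of the free algebra on the factors. -/
def toCells : Chain R n →ₗ[R] Cells R (Multiset (Fin n)) :=
  Finsupp.linearCombination R fun w => word R (toLetters w)

@[simp] theorem toCells_single (w : Word n) :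
    toCells R n (Finsupp.single w 1) = word R (toLetters w) := by simp [toCells]

theorem chain_induction {p : Chain R n → Prop} (z : Chain R n) (zero : p 0)
    (add : ∀ x y, p x → p y → p (x + y)) (smul : ∀ (c : R) x, p x → p (c • x))
    (single : ∀ w, p (Finsupp.single w 1)) : p z := by
  induction z using Finsupp.induction_linear with
  | zero => exact zero
  | add x y hx hy => exact add x y hx hy
  | single w c =>
    have := smul c _ (single w)
    rwa [Finsupp.smul_single, smul_eq_mul, mul_one] at this

/-- `insertChain` as a linear map. -/
def insertHom (R : Type*) [CommRing R] (u v : Word n) : Chain R n →ₗ[R] Chain R n :=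
  Finsupp.lmapDomain R R fun w => u ++ w ++ v

theorem insertHom_apply (u v : Word n) (z : Chain R n) : insertHom R u v z = insertChain u v z := rfl

@[simp] theorem insertHom_single (u v w : Word n) (c : R) :
    insertHom R u v (Finsupp.single w c) = Finsupp.single (u ++ w ++ v) c := by
  simp [insertHom]

theorem toCells_insertHom (u v : Word n) (z : Chain R n) :
    toCells R n (insertHom R u v z) =
      word R (toLetters u) * toCells R n z * word R (toLetters v) := by
  induction z using chain_induction with
  | zero => simp
  | add x y hx hy => simp only [map_add, hx, hy, mul_add, add_mul]
  | smul c x hx => simp [hx]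
  | single w => simp [toLetters_append, word_append, mul_assoc]

theorem toCells_factorBoundary {b : List (List (Fin n))} (hb : b ≠ []) :
    toCells R n (factorBoundary R b) = factorBd R _ (Finsupp.single (b.map (↑)) 1) := by
  rw [factorBd_single (by simpa using hb), factorBoundary, map_sum, List.length_map]
  refine Finset.sum_congr rfl fun i _ => ?_
  rw [map_smul, map_sub, toCells_single, toCells_single]
  congr 3
  · simp only [toLetters, List.map_cons, List.map_nil, List.map_append, ← List.map_take,
      ← List.map_drop, sum_map_coe]
  · simp [toLetters]

theorem toCells_wordBoundary {w : Word n} (hw : ∀ b ∈ w, b ≠ []) :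
    toCells R n (wordBoundary R w) = bd R _ (word R (toLetters w)) := by
  induction w with
  | nil => simp [wordBoundary, toLetters, bd]
  | cons b w ih =>
    simp only [List.mem_cons, forall_eq_or_imp] at hw
    have h : toLetters (b :: w) = b.map (↑) :: toLetters w := rfl
    rw [wordBoundary, ← insertHom_apply, ← insertHom_apply, map_add, map_smul, toCells_insertHom,
      toCells_insertHom, toCells_factorBoundary hw.1, ih hw.2, h, word_cons, bd_mul,
      ← factor_single, bd_factor, factor_single, sgn_word]
    have h1 : 0 < b.length := List.length_pos_iff.2 hw.1
    -- The exponents `length + 1` and `length - 1` agree modulo 2, since the factor is nonempty.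
    have h2 : (-1 : R) ^ (parity [b.map ((↑) : List (Fin n) → Multiset (Fin n))]) =
        (-1) ^ (b.length - 1) := by
      obtain ⟨k, hk⟩ : ∃ k, b.length = k + 1 := ⟨b.length - 1, by omega⟩
      simp [parity, hk, pow_succ]
    rw [h2]
    simp [toLetters]

variable (R n) in
/-- Combinations of cells. -/
def cellChains : Submodule R (Chain R n) := Finsupp.supported R R {w | w.IsCell}

theorem builtFrom_le_cellChains (m k : ℕ) : builtFrom R n m k ≤ cellChains R n :=
  Finsupp.supported_mono fun _ hw => hw.1

theorem supported_induction {s : Set (Word n)}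
    {p : ∀ z : Chain R n, z ∈ Finsupp.supported R R s → Prop} {z : Chain R n}
    (hz : z ∈ Finsupp.supported R R s) (zero : p 0 (zero_mem _))
    (add : ∀ x y hx hy, p x hx → p y hy → p (x + y) (add_mem hx hy))
    (smul : ∀ (c : R) x hx, p x hx → p (c • x) (Submodule.smul_mem _ c hx))
    (single : ∀ w (hw : w ∈ s), p (Finsupp.single w 1) (Finsupp.single_mem_supported R 1 hw)) :
    p z hz := by
  suffices h : ∃ h, p z h from h.2
  have hz' := hz
  rw [Finsupp.supported_eq_span_single] at hz'
  induction hz' using Submodule.span_induction with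
  | mem x h => obtain ⟨w, hw, rfl⟩ := h; exact ⟨_, single w hw⟩
  | zero => exact ⟨_, zero⟩
  | add x y hx hy ihx ihy =>
    rw [← Finsupp.supported_eq_span_single] at hx hy
    exact ⟨_, add x y hx hy (ihx hx).2 (ihy hy).2⟩
  | smul c x hx ih =>
    rw [← Finsupp.supported_eq_span_single] at hx
    exact ⟨_, smul c x hx (ih hx).2⟩

theorem boundary_single (w : Word n) :
    boundary R n (Finsupp.single w 1) = wordBoundary R w := by simp [boundary]

theorem toCells_boundary {z : Chain R n} (hz : z ∈ cellChains R n) :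
    toCells R n (boundary R n z) = bd R _ (toCells R n z) := by
  induction hz using supported_induction with
  | zero => simp
  | add x y _ _ hx hy => simp only [map_add, hx, hy]
  | smul c x _ hx => simp only [map_smul, hx]
  | single w hw => rw [boundary_single, toCells_single, toCells_wordBoundary hw.2.1]

theorem aug_toCells (z : Chain R n) : aug R _ (toCells R n z) = z.sum fun _ c => c := by
  rw [toCells, Finsupp.linearCombination_apply, map_finsuppSum]
  simp

theorem toCells_mem_cellSpan {m k : ℕ} {z : Chain R n} (hz : z ∈ builtFrom R n m k) :
    toCells R n z ∈ cellSpan R (↑(List.finRange n)) m k := by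
  induction hz using supported_induction with
  | zero => simp
  | add x y _ _ hx hy => rw [map_add]; exact add_mem hx hy
  | smul c x _ hx => rw [map_smul]; exact Submodule.smul_mem _ _ hx
  | single w hw => rw [toCells_single]; exact word_mem_cellSpan ((isGoodWord_iff w).2 hw)

theorem exists_toCells_eq {m k : ℕ} {y : Cells R (Multiset (Fin n))}
    (hy : y ∈ cellSpan R (↑(List.finRange n)) m k) :
    ∃ z ∈ builtFrom R n m k, toCells R n z = y := by
  rw [← Submodule.mem_map]
  refine Submodule.span_le.2 ?_ hy
  rintro _ ⟨w, hw, rfl⟩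
  refine ⟨Finsupp.single (ofLetters w) 1, ?_, by rw [toCells_single, toLetters_ofLetters]⟩
  refine Finsupp.single_mem_supported R _ ((isGoodWord_iff _).1 ?_)
  rwa [toLetters_ofLetters]

/-- Two words that differ by reordering the variables inside the arguments. -/
theorem same_of_perm {x y : List (Fin n)} (h : x.Perm y) (u v : Word n)
    (b c : List (List (Fin n))) (s : List (Fin n))
    (hc : (u ++ [b ++ [s ++ x] ++ c] ++ v).IsCell) :
    Same R (Finsupp.single (u ++ [b ++ [s ++ x] ++ c] ++ v) (1 : R))
      (Finsupp.single (u ++ [b ++ [s ++ y] ++ c] ++ v) 1) := by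
  induction h generalizing s with
  | nil => simp [Same]
  | cons i _ ih =>
    have := ih (s ++ [i])
    simp only [List.append_assoc, List.singleton_append] at this hc ⊢
    exact this hc
  | swap i j l =>
    simp only [List.append_assoc, List.singleton_append] at hc ⊢
    refine Submodule.subset_span ?_
    have := Relator.commA (R := R) u v b c s l j i
    simp only [List.append_assoc, List.singleton_append] at this
    exact this hc
  | trans h1 _ ih1 ih2 =>
    rename_i x y z _
    have hc' : (u ++ [b ++ [s ++ y] ++ c] ++ v).IsCell := by
      have : toLetters (u ++ [b ++ [s ++ x] ++ c] ++ v) =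
          toLetters (u ++ [b ++ [s ++ y] ++ c] ++ v) := by
        simp [toLetters, ← Multiset.coe_add, Multiset.coe_eq_coe.2 h1]
      rwa [isCell_iff, ← this, ← isCell_iff]
    have := add_mem (ih1 s hc) (ih2 s hc')
    rwa [sub_add_sub_cancel] at this

/-- The arguments are brought into their chosen orders one at a time; `b` collects those already
treated. -/
theorem same_map_toList (u v : Word n) (b c : List (List (Fin n)))
    (hc : (u ++ [b ++ c] ++ v).IsCell) :
    Same R (Finsupp.single (u ++ [b ++ c] ++ v) (1 : R))
      (Finsupp.single (u ++ [b ++ c.map fun x => (Multiset.ofList x).toList] ++ v) 1) := by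
  induction c generalizing b with
  | nil => simp [Same]
  | cons x c ih =>
    have hp : x.Perm (x : Multiset (Fin n)).toList := by
      rw [← Multiset.coe_eq_coe, Multiset.coe_toList]
    have h1 := same_of_perm (R := R) hp u v b c []
    have h2 := ih (b ++ [(x : Multiset (Fin n)).toList])
    simp only [List.append_assoc, List.singleton_append, List.nil_append, List.map_cons] at h1 h2 hc ⊢
    have hc' : (u ++ ((b ++ (x : Multiset (Fin n)).toList :: c) :: v)).IsCell := by
      rw [isCell_iff] at hc ⊢
      simpa [toLetters] using hc
    have := add_mem (h1 hc) (h2 hc')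
    rwa [sub_add_sub_cancel] at this

theorem same_ofLetters_toLetters (u w : Word n) (hc : (u ++ w).IsCell) :
    Same R (Finsupp.single (u ++ w) (1 : R)) (Finsupp.single (u ++ ofLetters (toLetters w)) 1) := by
  induction w generalizing u with
  | nil => simp [Same, toLetters, ofLetters]
  | cons b w ih =>
    have h1 := same_map_toList (R := R) u w [] b
    have h2 := ih (u ++ [b.map fun x => (Multiset.ofList x).toList])
    have hb : (b.map fun x => (Multiset.ofList x).toList) =
        (b.map Multiset.ofList).map Multiset.toList := by
      rw [List.map_map]; rfl
    have ho : ofLetters (toLetters (b :: w)) =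
        (b.map fun x => (Multiset.ofList x).toList) :: ofLetters (toLetters w) := by
      rw [hb]; rfl
    simp only [List.append_assoc, List.singleton_append, List.nil_append] at h1 h2 hc ⊢
    have hc' : (u ++ ((b.map fun x => (Multiset.ofList x).toList) :: w)).IsCell := by
      rw [isCell_iff, toLetters_append, toLetters_cons] at hc ⊢
      rwa [hb, map_coe_map_toList]
    have := add_mem (h1 hc) (h2 hc')
    rw [sub_add_sub_cancel] at this
    rw [ho]
    exact this

open Classical in
variable (R n) in
/-- The class of an element of the free algebra in the complex of operations. -/
def ofCells : Cells R (Multiset (Fin n)) →ₗ[R] Chain R n ⧸ relations R n :=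
  liftWord fun w =>
    if IsCellWord w then (relations R n).mkQ (Finsupp.single (ofLetters w) 1) else 0

theorem ofCells_toCells {z : Chain R n} (hz : z ∈ cellChains R n) :
    ofCells R n (toCells R n z) = (relations R n).mkQ z := by
  induction hz using supported_induction with
  | zero => simp
  | add x y _ _ hx hy => simp only [map_add, hx, hy]
  | smul c x _ hx => simp only [map_smul, hx]
  | single w hw =>
    rw [toCells_single, ofCells, liftWord_word, if_pos ((isCell_iff w).1 hw), Submodule.mkQ_apply,
      Submodule.mkQ_apply, eq_comm, Submodule.Quotient.eq]
    exact same_ofLetters_toLetters [] w hw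

/-- The words in one identification have the same content, so either all of them are cells or none
is. -/
theorem isCellWord_congr {u v w w' : List (List (Multiset (Fin n)))}
    (h : w.flatten.sum = w'.flatten.sum) (h1 : [] ∈ w ↔ [] ∈ w') (h2 : 0 ∈ w.flatten ↔ 0 ∈ w'.flatten) :
    IsCellWord (u ++ w ++ v) ↔ IsCellWord (u ++ w' ++ v) := by
  simp only [IsCellWord, List.flatten_append, List.sum_append, List.mem_append, h, h1, h2]

/-- The ideal relates arbitrary words, whereas `Relator` only relates cells. A generator that
involves cells is an instance of `Relator`; any other one vanishes term by term. -/
theorem ofCells_eq_zero {z : Cells R (Multiset (Fin n))} (hz : z ∈ relIdeal R _) :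
    ofCells R n z = 0 := by
  induction hz using Submodule.span_induction with
  | mem z h =>
    obtain ⟨x, r, y, hr, rfl⟩ := h
    induction x using Cells.induction with
    | zero => simp
    | add s t hs ht => simp only [add_mul, map_add, hs, ht, add_zero]
    | smul c s hs => simp [hs]
    | word u =>
      induction y using Cells.induction with
      | zero => simp
      | add s t hs ht => simp only [mul_add, map_add, hs, ht, add_zero]
      | smul c s hs => rw [mul_smul_comm, map_smul, hs, smul_zero]
      | word v =>
        cases hr with
        | comm b c =>
          rw [mul_sub, sub_mul, mul_smul_comm, smul_mul_assoc, ← word_append, ← word_append,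
            ← word_append, ← word_append, ← word_append, ← word_append, map_sub, map_smul, ofCells,
            liftWord_word, liftWord_word]
          have hiff : IsCellWord (u ++ ([b] ++ [c]) ++ v) ↔ IsCellWord (u ++ ([c] ++ [b]) ++ v) :=
            isCellWord_congr (by simp [add_comm]) (by simp [or_comm]) (by simp [or_comm])
          by_cases hc : IsCellWord (u ++ ([b] ++ [c]) ++ v)
          · rw [if_pos hc, if_pos (hiff.1 hc), ← map_smul, ← map_sub, Submodule.mkQ_apply,
              Submodule.Quotient.mk_eq_zero]
            have hb : b ≠ [] := by
              rintro rfl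
              exact hc.2.1 (by simp)
            have hc0 : c ≠ [] := by
              rintro rfl
              exact hc.2.1 (by simp)
            have := Relator.commB (R := R) (ofLetters u) (ofLetters v) (b.map Multiset.toList)
              (c.map Multiset.toList) (by
                rw [isCell_iff, toLetters_append, toLetters_append, toLetters_ofLetters,
                  toLetters_ofLetters, toLetters_cons, toLetters_cons, map_coe_map_toList,
                  map_coe_map_toList]
                exact hc)
            have hs : (-1 : R) ^ ((b.length + 1) * (c.length + 1)) =
                (-1) ^ ((b.length - 1) * (c.length - 1)) := by
              obtain ⟨i, hi⟩ : ∃ i, b.length = i + 1 :=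
                ⟨b.length - 1, by have := List.length_pos_iff.2 hb; omega⟩
              obtain ⟨j, hj⟩ : ∃ j, c.length = j + 1 :=
                ⟨c.length - 1, by have := List.length_pos_iff.2 hc0; omega⟩
              rw [hi, hj]
              simp only [Nat.add_sub_cancel]
              rw [show (i + 1 + 1) * (j + 1 + 1) = i * j + 2 * (i + j + 2) by ring, pow_add, pow_mul]
              simp
            rw [hs]
            refine Submodule.subset_span ?_
            simpa [ofLetters] using this
          · rw [if_neg hc, if_neg fun h => hc (hiff.2 h)]
            simp
        | shuffle p q hp hq =>
          -- The two words are joined into one function, the form in which `Relator.shuffle` takes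
          -- them.
          obtain ⟨x, hx1, hx2⟩ : ∃ x : Fin (p.length + q.length) → Multiset (Fin n),
              (List.ofFn x).take p.length = p ∧ (List.ofFn x).drop p.length = q := by
            refine ⟨fun i => (p ++ q).get (i.cast (by simp)), ?_⟩
            have : (List.ofFn fun i : Fin (p.length + q.length) =>
                (p ++ q).get (i.cast (by simp))) = p ++ q := by
              refine List.ext_getElem (by simp) fun i h1 h2 => by simp
            rw [this]
            simp
          have hsum := sum_shuffles (R := R) p.length q.length x
          rw [hx1, hx2] at hsum
          rw [← hsum, map_sum, Finset.mul_sum, Finset.sum_mul, map_sum]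
          have hterm (σ : Equiv.Perm (Fin (p.length + q.length))) :
              word R u * factor (shuffleTerm R x σ) * word R v =
                Equiv.Perm.sign σ • word R (u ++ [List.ofFn fun i => x (σ⁻¹ i)] ++ v) := by
            rw [shuffleTerm, Units.smul_def, Units.smul_def, map_zsmul, mul_smul_comm,
              smul_mul_assoc, factor_single, ← word_append, ← word_append]
          have hperm (σ : Equiv.Perm (Fin (p.length + q.length))) :
              (List.ofFn fun i => x (σ⁻¹ i)).Perm (List.ofFn x) :=
            Equiv.Perm.ofFn_comp_perm σ⁻¹ x
          have hiff (σ : Equiv.Perm (Fin (p.length + q.length))) :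
              IsCellWord (u ++ [List.ofFn fun i => x (σ⁻¹ i)] ++ v) ↔
                IsCellWord (u ++ [List.ofFn x] ++ v) := by
            refine isCellWord_congr ?_ ?_ ?_
            · simpa using (hperm σ).sum_eq
            · simp [List.ofFn_eq_nil_iff]
            · simpa using (hperm σ).mem_iff
          simp only [hterm]
          by_cases hc : IsCellWord (u ++ [List.ofFn x] ++ v)
          · have := Relator.shuffle (R := R) (ofLetters u) (ofLetters v) p.length q.length
              (fun i => (x i).toList) (List.length_pos_iff.2 hp) (List.length_pos_iff.2 hq) (by
                rw [isCell_iff, toLetters_append, toLetters_append, toLetters_ofLetters,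
                  toLetters_ofLetters, toLetters_ofFn]
                simpa using hc)
            have h0 := (Submodule.Quotient.mk_eq_zero (relations R n)).2 (Submodule.subset_span this)
            rw [← Submodule.mkQ_apply, map_sum] at h0
            rw [← h0]
            refine Finset.sum_congr rfl fun σ _ => ?_
            rw [Units.smul_def, Units.smul_def, map_zsmul, map_zsmul, ofCells, liftWord_word,
              if_pos ((hiff σ).2 hc)]
            simp [ofLetters, List.map_ofFn, Function.comp_def]
          · refine Finset.sum_eq_zero fun σ _ => ?_
            rw [Units.smul_def, map_zsmul, ofCells, liftWord_word, if_neg fun h => hc ((hiff σ).1 h),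
              smul_zero]
  | zero => simp
  | add a b _ _ ha hb => rw [map_add, ha, hb, add_zero]
  | smul c a _ ha => rw [map_smul, ha, smul_zero]

/-- Commutativity inside an argument becomes an equality, letters being multisets; the other
identifications go to generators of the ideal. -/
theorem toCells_mem_relIdeal {z : Chain R n} (hz : z ∈ relations R n) :
    toCells R n z ∈ relIdeal R _ := by
  induction hz using Submodule.span_induction with
  | mem z h =>
    cases h with
    | commA u v b c s t i j hc =>
      rw [map_sub, toCells_single, toCells_single]
      have : toLetters (u ++ [b ++ [s ++ i :: j :: t] ++ c] ++ v) =
          toLetters (u ++ [b ++ [s ++ j :: i :: t] ++ c] ++ v) := by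
        have h : (s ++ i :: j :: t).Perm (s ++ j :: i :: t) := (List.Perm.swap j i t).append_left s
        simp [toLetters, Multiset.coe_eq_coe.2 h]
      rw [this, sub_self]
      exact zero_mem _
    | commB u v b c hc =>
      rw [map_sub, map_smul, toCells_single, toCells_single]
      have h := mul_mem_relIdeal_right (word R (toLetters v)) (mul_mem_relIdeal_left
        (word R (toLetters u)) (IsRelation.comm (R := R) (b.map ((↑) : _ → Multiset (Fin n)))
          (c.map (↑))).mem)
      convert h using 1
      have hb : 0 < b.length := List.length_pos_iff.2 (hc.2.1 b (by simp))
      have hc0 : 0 < c.length := List.length_pos_iff.2 (hc.2.1 c (by simp))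
      have hs : (-1 : R) ^ ((b.length + 1) * (c.length + 1)) =
          (-1) ^ ((b.length - 1) * (c.length - 1)) := by
        obtain ⟨i, hi⟩ : ∃ i, b.length = i + 1 := ⟨b.length - 1, by omega⟩
        obtain ⟨j, hj⟩ : ∃ j, c.length = j + 1 := ⟨c.length - 1, by omega⟩
        rw [hi, hj]
        simp only [Nat.add_sub_cancel]
        rw [show (i + 1 + 1) * (j + 1 + 1) = i * j + 2 * (i + j + 2) by ring, pow_add, pow_mul]
        simp
      rw [List.length_map, List.length_map, hs, mul_sub, sub_mul, mul_smul_comm, smul_mul_assoc,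
        ← word_append, ← word_append, ← word_append, ← word_append, ← word_append, ← word_append]
      simp [toLetters]
    | shuffle u v q r x hq hr hc =>
      have hsum := sum_shuffles (R := R) q r fun i => (x i : Multiset (Fin n))
      have h := mul_mem_relIdeal_right (word R (toLetters v)) (mul_mem_relIdeal_left
        (word R (toLetters u)) (IsRelation.shuffle (R := R)
          ((List.ofFn fun i => (x i : Multiset (Fin n))).take q)
          ((List.ofFn fun i => (x i : Multiset (Fin n))).drop q)
          (List.length_pos_iff.1 (by simp; omega)) (List.length_pos_iff.1 (by simp; omega))).mem)
      rw [← hsum, map_sum, Finset.mul_sum, Finset.sum_mul] at h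
      rw [map_sum]
      convert h using 2 with σ
      rw [shuffleTerm, Units.smul_def, Units.smul_def, map_zsmul, map_zsmul, mul_smul_comm,
        smul_mul_assoc, factor_single, ← word_append, ← word_append, toCells_single]
      simp [toLetters, List.map_ofFn, Function.comp_def]
  | zero => simp
  | add a b _ _ ha hb => rw [map_add]; exact add_mem ha hb
  | smul c a _ ha => rw [map_smul]; exact Submodule.smul_mem _ _ ha

end Bridge
-- Words with a given reading order; reduced cycles of chains bound
section Exact

variable {R : Type*} [CommRing R] {n : ℕ}

/-- The nondegenerate words of dimension `k` that list the variables in the order `L`. -/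
def wordsOn (L : List (Fin n)) (k : ℕ) : Set (Word n) :=
  {w | w.flatten.flatten = L ∧ (∀ b ∈ w, b ≠ []) ∧ (∀ b ∈ w, ∀ x ∈ b, x ≠ []) ∧ w.dim = k}

theorem wordsOn_append {L M : List (Fin n)} {j k : ℕ} {u v : Word n} (hu : u ∈ wordsOn L j)
    (hv : v ∈ wordsOn M k) : u ++ v ∈ wordsOn (L ++ M) (j + k) := by
  obtain ⟨rfl, h1, h2, rfl⟩ := hu
  obtain ⟨rfl, h3, h4, rfl⟩ := hv
  refine ⟨by simp, ?_, ?_, by simp [Word.dim]⟩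
  · intro b hb
    exact (List.mem_append.1 hb).elim (h1 b) (h3 b)
  · intro b hb
    exact (List.mem_append.1 hb).elim (h2 b) (h4 b)

theorem insertHom_mem {L M N : List (Fin n)} {i j k : ℕ} {u v : Word n} (hu : u ∈ wordsOn L i)
    (hv : v ∈ wordsOn N k) {z : Chain R n} (hz : z ∈ Finsupp.supported R R (wordsOn M j)) :
    insertHom R u v z ∈ Finsupp.supported R R (wordsOn (L ++ M ++ N) (i + j + k)) := by
  induction hz using supported_induction with
  | zero => simp
  | add x y _ _ hx hy => rw [map_add]; exact add_mem hx hy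
  | smul c x _ hx => rw [map_smul]; exact Submodule.smul_mem _ _ hx
  | single w hw =>
    rw [insertHom_single]
    exact Finsupp.single_mem_supported R _ (wordsOn_append (wordsOn_append hu hw) hv)

/-- Merging and cutting leave the reading order alone. The length is written `k + 2` so that the
dimension `k + 1` visibly drops to `k`. -/
theorem factorBoundary_mem {b : List (List (Fin n))} {k : ℕ} (hb : b.length = k + 2)
    (h : ∀ x ∈ b, x ≠ []) :
    factorBoundary R b ∈ Finsupp.supported R R (wordsOn b.flatten k) := by
  refine Submodule.sum_mem _ fun i hi => Submodule.smul_mem _ _ (sub_mem ?_ ?_)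
  · rw [Finset.mem_range] at hi
    refine Finsupp.single_mem_supported R _ ⟨?_, by simp, ?_, ?_⟩
    · have h1 : b.take i ++ (b.drop i).take 2 ++ b.drop (i + 2) = b := by
        rw [← List.take_add, List.take_append_drop]
      rw [← congrArg List.flatten h1]
      simp only [List.flatten_cons, List.flatten_append, List.flatten_nil, List.append_nil,
        List.append_assoc]
    · intro c hc
      rw [List.mem_singleton.1 hc]
      simp only [List.mem_append, List.mem_cons]
      rintro x (hx | rfl | hx)
      · exact h x (List.mem_of_mem_take hx)
      · have h1 : b[i] ∈ (b.drop i).take 2 := by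
          rw [List.drop_eq_getElem_cons (by omega), List.take_succ_cons]
          exact List.mem_cons_self
        intro h0
        rw [List.flatten_eq_nil_iff] at h0
        exact h _ (List.getElem_mem _) (h0 _ h1)
      · exact h x (List.mem_of_mem_drop hx)
    · simp [Word.dim]
      omega
  · rw [Finset.mem_range] at hi
    refine Finsupp.single_mem_supported R _ ⟨?_, ?_, ?_, ?_⟩
    · simp [← List.flatten_append]
    · simp only [List.mem_cons, List.not_mem_nil, or_false, forall_eq_or_imp, forall_eq]
      rw [← List.length_pos_iff, ← List.length_pos_iff]
      simp
      omega
    · simp only [List.mem_cons, List.not_mem_nil, or_false, forall_eq_or_imp, forall_eq]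
      exact ⟨fun x hx => h x (List.mem_of_mem_take hx), fun x hx => h x (List.mem_of_mem_drop hx)⟩
    · simp [Word.dim]
      omega

theorem factorBoundary_eq_zero {b : List (List (Fin n))} (hb : b.length = 1) :
    factorBoundary R b = 0 := by simp [factorBoundary, hb]

theorem mem_wordsOn_self {w : Word n} (h1 : ∀ b ∈ w, b ≠ []) (h2 : ∀ b ∈ w, ∀ x ∈ b, x ≠ []) :
    w ∈ wordsOn w.flatten.flatten w.dim := ⟨rfl, h1, h2, rfl⟩

theorem wordBoundary_eq_zero {L : List (Fin n)} {w : Word n} (hw : w ∈ wordsOn L 0) :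
    wordBoundary R w = 0 := by
  induction w generalizing L with
  | nil => rfl
  | cons c w ih =>
    obtain ⟨rfl, h1, h2, h3⟩ := hw
    simp only [List.mem_cons, forall_eq_or_imp] at h1 h2
    have hc : c.length ≠ 0 := by simpa using h1.1
    simp only [Word.dim, List.map_cons, List.sum_cons, Nat.add_eq_zero_iff] at h3
    rw [wordBoundary, factorBoundary_eq_zero (by omega), ih ⟨rfl, h1.2, h2.2, h3.2⟩]
    simp [← insertHom_apply]

/-- Since every term of the boundary reads the variables in the order `L`, all terms carry the same
Koszul sign when they are realized. -/
theorem wordBoundary_mem {L : List (Fin n)} {k : ℕ} {w : Word n} (hw : w ∈ wordsOn L (k + 1)) :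
    wordBoundary R w ∈ Finsupp.supported R R (wordsOn L k) := by
  induction w generalizing L k with
  | nil => simp [wordBoundary]
  | cons b w ih =>
    obtain ⟨rfl, h1, h2, h3⟩ := hw
    simp only [List.mem_cons, forall_eq_or_imp] at h1 h2
    have hb : b.length ≠ 0 := by simpa using h1.1
    have hd : Word.dim (b :: w) = b.length - 1 + Word.dim w := by simp [Word.dim]
    have hw0 := mem_wordsOn_self h1.2 h2.2
    have hb0 : [b] ∈ wordsOn b.flatten (b.length - 1) :=
      ⟨by simp, by simpa using h1.1, by simpa using h2.1, by simp [Word.dim]⟩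
    have hn : ([] : Word n) ∈ wordsOn [] 0 := ⟨rfl, by simp, by simp, rfl⟩
    rw [wordBoundary, ← insertHom_apply, ← insertHom_apply]
    refine add_mem ?_ (Submodule.smul_mem _ _ ?_)
    · obtain ⟨j, hj⟩ : ∃ j, b.length = j + 1 := ⟨b.length - 1, by omega⟩
      rcases j with _ | j
      · rw [factorBoundary_eq_zero hj, map_zero]
        exact zero_mem _
      · convert insertHom_mem hn hw0 (factorBoundary_mem (R := R) hj h2.1) using 3
        · simp
        · omega
    · rcases hwd : Word.dim w with _ | j
      · rw [hwd] at hw0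
        rw [wordBoundary_eq_zero hw0, map_zero]
        exact zero_mem _
      · rw [hwd] at hw0
        convert insertHom_mem hb0 hn (ih hw0) using 3
        · simp
        · omega

theorem isCell_iff_exists (w : Word n) :
    w.IsCell ↔ ∃ L k, L.Perm (List.finRange n) ∧ w ∈ wordsOn L k :=
  ⟨fun h => ⟨_, _, h.1, rfl, h.2.1, h.2.2, rfl⟩,
    fun ⟨_, _, h, h1, h2, h3, _⟩ => ⟨h1 ▸ h, h2, h3⟩⟩

theorem boundary_mem_cellChains {z : Chain R n} (hz : z ∈ cellChains R n) :
    boundary R n z ∈ cellChains R n := by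
  induction hz using supported_induction with
  | zero => simp
  | add x y _ _ hx hy => rw [map_add]; exact add_mem hx hy
  | smul c x _ hx => rw [map_smul]; exact Submodule.smul_mem _ _ hx
  | single w hw =>
    rw [boundary_single]
    have hw' := mem_wordsOn_self hw.2.1 hw.2.2
    rcases hd : w.dim with _ | k
    · rw [hd] at hw'
      rw [wordBoundary_eq_zero hw']
      exact zero_mem _
    · rw [hd] at hw'
      exact Finsupp.supported_mono (fun v hv => (isCell_iff_exists v).2 ⟨_, _, hw.1, hv⟩)
        (wordBoundary_mem hw')

/-- Every reduced cycle built from `p_1, …, p_m` is the boundary of a chain built from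
`p_1, …, p_{m+1}`. -/
theorem exists_boundary_same {m k : ℕ} {z : Chain R n} (hz : z ∈ builtFrom R n m k)
    (hcyc : IsCycle R k z) :
    ∃ w ∈ builtFrom R n (m + 1) (k + 1), Same R (boundary R n w) z := by
  have hz' := builtFrom_le_cellChains m k hz
  obtain ⟨y, hy, hyz⟩ := exists_bd_sub_mem (Multiset.coe_nodup.2 (List.nodup_finRange n))
    (toCells_mem_cellSpan hz)
    (by
      rw [← toCells_boundary hz']
      refine toCells_mem_relIdeal ?_
      have := hcyc.1
      rwa [Same, sub_zero] at this)
    (fun h => by rw [aug_toCells, hcyc.2 h])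
  obtain ⟨w, hw, rfl⟩ := exists_toCells_eq hy
  have hw' := builtFrom_le_cellChains _ _ hw
  refine ⟨w, hw, ?_⟩
  rw [← toCells_boundary hw', ← map_sub] at hyz
  have := ofCells_eq_zero hyz
  rwa [ofCells_toCells (sub_mem (boundary_mem_cellChains hw') hz'), Submodule.mkQ_apply,
    Submodule.Quotient.mk_eq_zero] at this

end Exact
-- The formal cumulant is a reduced cycle
section Cumulant

variable {n : ℕ}

theorem mem_part_iff {π : Finpartition (Finset.univ : Finset (Fin n))} {i j : Fin n} :
    i ∈ π.part j ↔ π.part i = π.part j :=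
  π.mem_part_iff_part_eq_part (Finset.mem_univ _) (Finset.mem_univ _)

/-- A function on `Fin n` that is constant on the parts of `π`. -/
def ofParts {x : ℕ} (z : Σ π : Finpartition (Finset.univ : Finset (Fin n)), π.parts ↪ Fin x)
    (i : Fin n) : Fin x := z.2 ⟨z.1.part i, z.1.part_mem.2 (Finset.mem_univ i)⟩

theorem ofParts_eq_iff {x : ℕ}
    (z : Σ π : Finpartition (Finset.univ : Finset (Fin n)), π.parts ↪ Fin x) (i j : Fin n) :
    ofParts z i = ofParts z j ↔ z.1.part i = z.1.part j := by
  rw [ofParts, ofParts, z.2.injective.eq_iff, Subtype.mk.injEq]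

theorem parts_eq_image_part (π : Finpartition (Finset.univ : Finset (Fin n))) :
    π.parts = Finset.univ.image π.part := by
  ext s
  simp only [Finset.mem_image, Finset.mem_univ, true_and]
  constructor
  · intro hs
    obtain ⟨i, hi⟩ := π.nonempty_of_mem_parts hs
    exact ⟨i, π.part_eq_of_mem hs hi⟩
  · rintro ⟨i, rfl⟩
    exact π.part_mem.2 (Finset.mem_univ i)

theorem finpartition_ext {π π' : Finpartition (Finset.univ : Finset (Fin n))}
    (h : ∀ i j, π.part i = π.part j ↔ π'.part i = π'.part j) : π = π' := by
  refine Finpartition.ext ?_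
  rw [parts_eq_image_part, parts_eq_image_part]
  refine congrArg (fun f => Finset.univ.image f) (funext fun i => ?_)
  ext j
  rw [mem_part_iff, mem_part_iff, h]

/-- A function is the same as the partition into its fibres together with the injective labelling of
the fibres by their values. -/
theorem ofParts_bijective (n x : ℕ) : Function.Bijective (ofParts (n := n) (x := x)) := by
  constructor
  · rintro ⟨π, g⟩ ⟨π', g'⟩ h
    have h1 : π = π' := finpartition_ext fun i j => by
      rw [← ofParts_eq_iff ⟨π, g⟩, h, ofParts_eq_iff]
    subst h1
    congr 1
    ext ⟨s, hs⟩
    obtain ⟨i, hi⟩ := π.nonempty_of_mem_parts hs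
    obtain rfl := π.part_eq_of_mem hs hi
    exact congrArg Fin.val (congrFun h i)
  · intro f
    classical
    have hpart (i j : Fin n) : (Finpartition.ofSetoid (Setoid.ker f)).part i =
        (Finpartition.ofSetoid (Setoid.ker f)).part j ↔ f i = f j := by
      rw [← mem_part_iff, Finpartition.mem_part_ofSetoid_iff_rel, Setoid.ker_def, eq_comm]
    have hex (s : (Finpartition.ofSetoid (Setoid.ker f)).parts) :
        ∃ i, (Finpartition.ofSetoid (Setoid.ker f)).part i = s := by
      obtain ⟨i, hi⟩ := Finpartition.nonempty_of_mem_parts _ s.2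
      exact ⟨i, Finpartition.part_eq_of_mem _ s.2 hi⟩
    choose r hr using hex
    refine ⟨⟨Finpartition.ofSetoid (Setoid.ker f), fun s => f (r s), fun s t hst => ?_⟩, ?_⟩
    · rw [← hpart, hr, hr] at hst
      exact Subtype.ext hst
    · funext i
      exact (hpart _ _).1 (hr ⟨_, Finpartition.part_mem _ |>.2 (Finset.mem_univ i)⟩)

theorem pow_eq_sum_descFactorial (n x : ℕ) :
    x ^ n = ∑ π : Finpartition (Finset.univ : Finset (Fin n)), x.descFactorial π.parts.card := by
  have h := Fintype.card_of_bijective (ofParts_bijective n x)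
  rw [Fintype.card_sigma, Fintype.card_fun, Fintype.card_fin, Fintype.card_fin] at h
  rw [← h]
  simp [Fintype.card_embedding_eq]

-- Counting functions to a set with `x` elements gives the identity at every natural number `x`,
-- hence for polynomials.
open Polynomial in
theorem X_pow_eq_sum_descPochhammer (n : ℕ) : (X : ℤ[X]) ^ n =
    ∑ π : Finpartition (Finset.univ : Finset (Fin n)), descPochhammer ℤ π.parts.card := by
  refine Polynomial.eq_of_infinite_eval_eq _ _ (Set.infinite_of_injective_forall_mem
    (f := fun x : ℕ => (x : ℤ)) Nat.cast_injective fun x => ?_)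
  rw [Set.mem_ofPred_eq, eval_pow, eval_X, eval_finsetSum]
  simp only [descPochhammer_eval_eq_descFactorial]
  exact_mod_cast pow_eq_sum_descFactorial n x

theorem descPochhammer_eval_neg_one (k : ℕ) :
    (descPochhammer ℤ k).eval (-1) = (-1) ^ k * k.factorial := by
  induction k with
  | zero => simp
  | succ k ih =>
    rw [descPochhammer_succ_eval, ih, Nat.factorial_succ]
    push_cast
    ring

/-- Division by `X` leaves `(X - 1) ⋯ (X - k)`, and its value at `0` is the falling factorial at
`-1`. -/
theorem coeff_one_descPochhammer (k : ℕ) :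
    (descPochhammer ℤ (k + 1)).coeff 1 = (-1) ^ k * k.factorial := by
  rw [descPochhammer_succ_left, Polynomial.coeff_X_mul, Polynomial.coeff_zero_eq_eval_zero,
    Polynomial.eval_comp, ← descPochhammer_eval_neg_one]
  simp

/-- Each cumulant coefficient is the linear coefficient of the falling factorial that belongs to the
number of blocks, and `X ^ n` has no linear term for `n ≥ 2`. -/
theorem sum_cumulantCoeff (hn : 2 ≤ n) :
    ∑ π : Finpartition (Finset.univ : Finset (Fin n)), cumulantCoeff π = 0 := by
  have h := congrArg (Polynomial.coeff · 1) (X_pow_eq_sum_descPochhammer n)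
  simp only [Polynomial.finsetSum_coeff] at h
  rw [Polynomial.coeff_X_pow, if_neg (by omega)] at h
  rw [h]
  refine Finset.sum_congr rfl fun π _ => ?_
  have : 0 < π.parts.card := by
    rw [Finset.card_pos]
    refine π.parts_nonempty ?_
    have : Nonempty (Fin n) := ⟨⟨0, by omega⟩⟩
    exact Finset.univ_nonempty.ne_empty
  obtain ⟨k, hk⟩ : ∃ k, π.parts.card = k + 1 := ⟨π.parts.card - 1, by omega⟩
  rw [cumulantCoeff, hk, coeff_one_descPochhammer, Nat.add_sub_cancel]

theorem mem_blocks {π : Finpartition (Finset.univ : Finset (Fin n))} {b : List (Fin n)} :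
    b ∈ blocks π ↔ ∃ i, b = (π.part i).sort (· ≤ ·) := by
  simp only [blocks, List.mem_map, List.mem_filter, List.mem_finRange, true_and, decide_eq_true_eq]
  constructor
  · rintro ⟨i, _, rfl⟩
    exact ⟨i, rfl⟩
  · rintro ⟨i, rfl⟩
    have hne : (π.part i).Nonempty := π.part_nonempty.2 (Finset.mem_univ i)
    have hm := mem_part_iff.1 ((π.part i).min'_mem hne)
    -- `blocks` represents every part by its least element.
    exact ⟨(π.part i).min' hne, fun j hj => (π.part i).min'_le j (hm ▸ hj), by rw [hm]⟩

theorem flatten_blocks_perm (π : Finpartition (Finset.univ : Finset (Fin n))) :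
    (blocks π).flatten.Perm (List.finRange n) := by
  refine (List.perm_ext_iff_of_nodup ?_ (List.nodup_finRange n)).2 fun i => ?_
  · refine List.nodup_flatten.2 ⟨fun b hb => ?_, ?_⟩
    · obtain ⟨i, rfl⟩ := mem_blocks.1 hb
      exact Finset.sort_nodup _ _
    · rw [blocks, List.pairwise_map]
      refine List.Pairwise.imp_of_mem ?_ ((List.nodup_finRange n).filter _)
      intro i j hi hj hij k hki hkj
      simp only [List.mem_filter, List.mem_finRange, true_and, decide_eq_true_eq] at hi hj
      rw [Finset.mem_sort, mem_part_iff] at hki hkj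
      have h := hki.symm.trans hkj
      exact hij (le_antisymm (hi j (mem_part_iff.2 h.symm)) (hj i (mem_part_iff.2 h)))
  · refine iff_of_true (List.mem_flatten.2 ⟨_, mem_blocks.2 ⟨i, rfl⟩, ?_⟩) (List.mem_finRange i)
    rw [Finset.mem_sort]
    exact π.mem_part_self.2 (Finset.mem_univ i)

theorem blocks_mem_wordsOn (π : Finpartition (Finset.univ : Finset (Fin n))) :
    ((blocks π).map fun b => [b]) ∈ wordsOn (blocks π).flatten 0 := by
  refine ⟨?_, by simp, ?_, by simp [Word.dim, Function.comp_def]⟩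
  · congr 1
    induction blocks π with
    | nil => rfl
    | cons b l ih => rw [List.map_cons, List.flatten_cons, ih]; rfl
  · simp only [List.mem_map, forall_exists_index, and_imp, forall_apply_eq_imp_iff₂,
      List.mem_singleton, forall_eq]
    intro b hb
    obtain ⟨i, rfl⟩ := mem_blocks.1 hb
    intro h
    have := π.mem_part_self.2 (Finset.mem_univ i)
    rw [← Finset.mem_sort (· ≤ ·), h] at this
    simp at this

theorem cumulantChain_mem (R : Type*) [CommRing R] (n : ℕ) :
    cumulantChain R n ∈ builtFrom R n 1 0 := by
  refine Submodule.sum_mem _ fun π _ => zsmul_mem (Finsupp.single_mem_supported R _ ?_) _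
  refine ⟨(isCell_iff_exists _).2 ⟨_, _, flatten_blocks_perm π, blocks_mem_wordsOn π⟩, ?_, ?_⟩
  · exact (blocks_mem_wordsOn π).2.2.2
  · simp

theorem boundary_eq_zero_of_dim_zero {R : Type*} [CommRing R] {m : ℕ} {z : Chain R n}
    (hz : z ∈ builtFrom R n m 0) : boundary R n z = 0 := by
  induction hz using supported_induction with
  | zero => simp
  | add x y _ _ hx hy => rw [map_add, hx, hy, add_zero]
  | smul c x _ hx => rw [map_smul, hx, smul_zero]
  | single w hw =>
    have := mem_wordsOn_self hw.1.2.1 hw.1.2.2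
    rw [hw.2.1] at this
    rw [boundary_single, wordBoundary_eq_zero this]

theorem isCycle_cumulantChain (R : Type*) [CommRing R] (hn : 2 ≤ n) :
    IsCycle R 0 (cumulantChain R n) := by
  refine ⟨?_, fun _ => ?_⟩
  · rw [Same, boundary_eq_zero_of_dim_zero (cumulantChain_mem R n), sub_zero]
    exact zero_mem _
  · have h (z : Chain R n) : (z.sum fun _ c => c) = aug R _ (toCells R n z) := (aug_toCells z).symm
    rw [h, cumulantChain]
    simp only [map_sum, map_zsmul, toCells_single, aug_word]
    rw [← Finset.sum_smul, sum_cumulantCoeff hn, zero_smul]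

end Cumulant
-- Koszul signs under reordering and under the differential
section Signs

variable {n : ℕ}

/-- The sum of the degrees of the variables in `L` that are smaller than `i`. -/
def degLT (e : Fin n → ℤ) (i : Fin n) (L : List (Fin n)) : ℤ := ((L.filter (· < i)).map e).sum

/-- The sum of the degrees of the variables in `L`. -/
def degSum (e : Fin n → ℤ) (L : List (Fin n)) : ℤ := (L.map e).sum

theorem degSum_append (e : Fin n → ℤ) (L M : List (Fin n)) :
    degSum e (L ++ M) = degSum e L + degSum e M := by simp [degSum]

theorem degSum_cons (e : Fin n → ℤ) (i : Fin n) (M : List (Fin n)) :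
    degSum e (i :: M) = e i + degSum e M := by simp [degSum]

theorem degLT_append (e : Fin n → ℤ) (i : Fin n) (L M : List (Fin n)) :
    degLT e i (L ++ M) = degLT e i L + degLT e i M := by simp [degLT]

theorem degLT_cons (e : Fin n → ℤ) (i j : Fin n) (L : List (Fin n)) :
    degLT e i (j :: L) = (if j < i then e j else 0) + degLT e i L := by
  by_cases h : j < i <;> simp [degLT, h]

theorem degLT_perm (e : Fin n → ℤ) (i : Fin n) {L M : List (Fin n)} (h : L.Perm M) :
    degLT e i L = degLT e i M := ((h.filter _).map e).sum_eq

theorem koszulSign_cons (e : Fin n → ℤ) (i : Fin n) (L : List (Fin n)) :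
    koszulSign e (i :: L) = (e i * degLT e i L).negOnePow * koszulSign e L := by
  rw [koszulSign, degLT]
  congr 1
  induction L.filter (· < i) with
  | nil => simp
  | cons j L ih =>
    rw [List.map_cons, List.prod_cons, ih, List.map_cons, List.sum_cons, mul_add, Int.negOnePow_add]

/-- The sign of the transpositions between `L` and `M`. -/
def crossSign (e : Fin n → ℤ) : List (Fin n) → List (Fin n) → ℤˣ
  | [], _ => 1
  | i :: L, M => (e i * degLT e i M).negOnePow * crossSign e L M

theorem koszulSign_append (e : Fin n → ℤ) (L M : List (Fin n)) :
    koszulSign e (L ++ M) = koszulSign e L * crossSign e L M * koszulSign e M := by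
  induction L with
  | nil => simp [koszulSign, crossSign]
  | cons i L ih =>
    rw [List.cons_append, koszulSign_cons, koszulSign_cons, ih, degLT_append, crossSign, mul_add,
      Int.negOnePow_add]
    ac_rfl

theorem crossSign_perm_right (e : Fin n → ℤ) (L : List (Fin n)) {M N : List (Fin n)}
    (h : M.Perm N) : crossSign e L M = crossSign e L N := by
  induction L with
  | nil => rfl
  | cons i L ih => rw [crossSign, crossSign, ih, degLT_perm e i h]

theorem crossSign_append_right (e : Fin n → ℤ) (L M N : List (Fin n)) :
    crossSign e L (M ++ N) = crossSign e L M * crossSign e L N := by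
  induction L with
  | nil => simp [crossSign]
  | cons i L ih =>
    rw [crossSign, crossSign, crossSign, ih, degLT_append, mul_add, Int.negOnePow_add]
    ac_rfl

theorem crossSign_append_left (e : Fin n → ℤ) (L M N : List (Fin n)) :
    crossSign e (L ++ M) N = crossSign e L N * crossSign e M N := by
  induction L with
  | nil => simp [crossSign]
  | cons i L ih => rw [List.cons_append, crossSign, crossSign, ih, mul_assoc]

theorem crossSign_cons_right (e : Fin n → ℤ) (L M : List (Fin n)) (j : Fin n) :
    crossSign e L (j :: M) = crossSign e L [j] * crossSign e L M :=
  crossSign_append_right e L [j] M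

theorem negOnePow_mul_self (k : ℤ) : k.negOnePow * k.negOnePow = 1 := by
  rw [← Int.negOnePow_add]; exact Int.negOnePow_even _ ⟨k, rfl⟩

theorem crossSign_singleton_right (e : Fin n → ℤ) (j : Fin n) {M : List (Fin n)} (h : j ∉ M) :
    (e j * degLT e j M).negOnePow * crossSign e M [j] = (e j * degSum e M).negOnePow := by
  induction M with
  | nil => simp [crossSign, degLT, degSum]
  | cons i M ih =>
    simp only [List.mem_cons, not_or] at h
    rw [degLT_cons, degSum_cons, mul_add (e j), mul_add (e j), Int.negOnePow_add, Int.negOnePow_add, crossSign,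
      ← ih h.2, degLT_cons]
    have hij : (e j * if i < j then e i else 0).negOnePow *
        (e i * ((if j < i then e j else 0) + degLT e i [])).negOnePow = (e j * e i).negOnePow := by
      rcases lt_or_gt_of_ne h.1 with h' | h'
      · simp [h', degLT, mul_comm, not_lt_of_gt h']
      · simp [h', degLT, not_lt_of_gt h']
    rw [← hij]
    ac_rfl

/-- Each pair of variables, one from `L` and one from `M`, is out of order in exactly one of the two
arrangements, so every product of degrees occurs once. -/
theorem crossSign_mul_crossSign (e : Fin n → ℤ) {L M : List (Fin n)} (h : L.Disjoint M) :
    crossSign e L M * crossSign e M L = (degSum e L * degSum e M).negOnePow := by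
  induction L with
  | nil =>
    have : crossSign e M [] = 1 := by
      induction M with
      | nil => rfl
      | cons i M ih => simpa [crossSign, degLT] using ih (by simp)
    simp [this, crossSign, degSum]
  | cons i L ih =>
    rw [List.disjoint_cons_left] at h
    rw [crossSign, crossSign_cons_right, degSum_cons, add_mul, Int.negOnePow_add, ← ih h.2,
      ← crossSign_singleton_right e i h.1]
    ac_rfl

theorem koszulSign_swap (e : Fin n → ℤ) (U V L M : List (Fin n)) (h : L.Disjoint M) :
    koszulSign e (U ++ (L ++ M) ++ V) =
      (degSum e L * degSum e M).negOnePow * koszulSign e (U ++ (M ++ L) ++ V) := by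
  have h1 := crossSign_mul_crossSign e h
  simp only [koszulSign_append, crossSign_append_right,
    crossSign_perm_right e _ (List.perm_append_comm (l₁ := L) (l₂ := M))]
  have h2 : crossSign e L M = (degSum e L * degSum e M).negOnePow * crossSign e M L := by
    rw [← h1, mul_assoc, Int.units_mul_self, mul_one]
  simp only [crossSign_append_left]
  rw [h2]
  ac_rfl

/-- Permuting blocks of variables costs the same as permuting single elements of the total degrees.
The shuffle relation needs this because its inputs are products of variables. -/
theorem koszulSign_eq_of_perm (e : Fin n → ℤ) {N : ℕ} (x : Fin N → List (Fin n))
    {L M : List (Fin N)} (h : L.Perm M) (hL : (L.map x).flatten.Nodup) (hnd : L.Nodup)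
    (U V : List (Fin n)) :
    koszulSign (fun s => degSum e (x s)) L * koszulSign e (U ++ (L.map x).flatten ++ V) =
      koszulSign (fun s => degSum e (x s)) M * koszulSign e (U ++ (M.map x).flatten ++ V) := by
  induction h generalizing U with
  | nil => rfl
  | cons s h ih =>
    rw [List.map_cons, List.flatten_cons] at hL
    have := ih hL.of_append_right hnd.of_cons (U ++ x s)
    rw [koszulSign_cons, koszulSign_cons, degLT_perm _ _ h]
    simp only [List.map_cons, List.flatten_cons, List.append_assoc] at this ⊢
    rw [mul_assoc, mul_assoc, this]
  | swap s t L =>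
    simp only [List.map_cons, List.flatten_cons] at hL ⊢
    rw [← List.append_assoc, List.nodup_append'] at hL
    have hd : (x t).Disjoint (x s) := (List.nodup_append'.1 hL.1).2.2
    have hts : t ≠ s := by
      rintro rfl
      simp at hnd
    have h1 := koszulSign_swap e U ((L.map x).flatten ++ V) (x t) (x s) hd
    have h2 := koszulSign_swap (fun s => degSum e (x s)) [] L [t] [s] (by simpa using hts.symm)
    have h3 : degSum (fun s => degSum e (x s)) [t] * degSum (fun s => degSum e (x s)) [s] =
      degSum e (x t) * degSum e (x s) := by simp [degSum]
    rw [h3] at h2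
    simp only [List.append_assoc, List.nil_append, List.cons_append] at h1 h2 ⊢
    rw [h1, h2, mul_mul_mul_comm, negOnePow_mul_self, one_mul]
  | trans h1 _ ih1 ih2 =>
    rw [ih1 hL hnd, ih2 ((h1.map x).flatten.nodup_iff.1 hL) (h1.nodup_iff.1 hnd)]

theorem koszulSign_finRange (e : Fin n → ℤ) : koszulSign e (List.finRange n) = 1 := by
  have h : ∀ L : List (Fin n), L.Pairwise (· < ·) → koszulSign e L = 1 := by
    intro L hL
    induction L with
    | nil => rfl
    | cons i L ih =>
      rw [List.pairwise_cons] at hL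
      have : degLT e i L = 0 := by
        rw [degLT, List.filter_eq_nil_iff.2]
        · rfl
        · intro j hj
          simpa using (hL.1 j hj).le
      rw [koszulSign_cons, ih hL.2, this]
      simp
  exact h _ (List.pairwise_lt_finRange n)

/-- The sum of the values of `F` on `L`, where `F` has degree one. -/
def orderedSum {M : Type*} [AddCommGroup M] (e : Fin n → ℤ) (F : Fin n → M) : List (Fin n) → M
  | [] => 0
  | i :: L => F i + (e i).negOnePow • orderedSum e F L

theorem orderedSum_append {M : Type*} [AddCommGroup M] (e : Fin n → ℤ) (F : Fin n → M)
    (L L' : List (Fin n)) : orderedSum e F (L ++ L') =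
      orderedSum e F L + (degSum e L).negOnePow • orderedSum e F L' := by
  induction L with
  | nil => simp [orderedSum, degSum]
  | cons i L ih =>
    rw [List.cons_append, orderedSum, orderedSum, ih, degSum_cons, Int.negOnePow_add, smul_add,
      mul_smul, add_assoc]

theorem orderedSum_congr {M : Type*} [AddCommGroup M] (e : Fin n → ℤ) {F G : Fin n → M}
    {L : List (Fin n)} (h : ∀ i ∈ L, F i = G i) : orderedSum e F L = orderedSum e G L := by
  induction L with
  | nil => rfl
  | cons i L ih =>
    simp only [List.mem_cons, forall_eq_or_imp] at h
    rw [orderedSum, orderedSum, h.1, ih h.2]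

theorem map_orderedSum {M N : Type*} [AddCommGroup M] [AddCommGroup N] (φ : M →+ N)
    (e : Fin n → ℤ) (F : Fin n → M) (L : List (Fin n)) :
    φ (orderedSum e F L) = orderedSum e (fun i => φ (F i)) L := by
  induction L with
  | nil => simp [orderedSum]
  | cons i L ih =>
    rw [orderedSum, orderedSum, map_add, Units.smul_def, map_zsmul, ih, Units.smul_def]

theorem degSum_update (e : Fin n → ℤ) (i : Fin n) (c : ℤ) {L : List (Fin n)} (hL : L.Nodup) :
    degSum (Function.update e i (e i + c)) L = degSum e L + if i ∈ L then c else 0 := by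
  induction L with
  | nil => simp [degSum]
  | cons j L ih =>
    rw [List.nodup_cons] at hL
    rw [degSum_cons, degSum_cons, ih hL.2]
    by_cases h : i = j
    · subst h
      simp [hL.1]
      ring
    · simp [h, Function.update_of_ne (Ne.symm h), add_assoc]

theorem degLT_update (e : Fin n → ℤ) (i l : Fin n) (c : ℤ) {L : List (Fin n)} (hL : L.Nodup) :
    degLT (Function.update e i (e i + c)) l L = degLT e l L + if i ∈ L ∧ i < l then c else 0 := by
  have := degSum_update e i c (hL.filter (· < l))
  simpa [degLT, degSum] using this

theorem koszulSign_congr {e e' : Fin n → ℤ} {L : List (Fin n)} (h : ∀ i ∈ L, e i = e' i) :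
    koszulSign e L = koszulSign e' L := by
  induction L with
  | nil => rfl
  | cons i L ih =>
    simp only [List.mem_cons, forall_eq_or_imp] at h
    have : degLT e i L = degLT e' i L := by
      rw [degLT, degLT]
      congr 1
      exact List.map_congr_left fun j hj => h.2 j (List.mem_of_mem_filter hj)
    rw [koszulSign_cons, koszulSign_cons, ih h.2, h.1, this]

/-- In `homDiff` the differential passes the variables smaller than `i`, in a word those standing
before `i`. The discrepancy is made up by the pairs containing `i` that are out of order in `L`, and
raising the degree of `i` by one changes the Koszul sign by exactly these. -/
theorem sum_koszulSign_update {M : Type*} [AddCommGroup M] (e : Fin n → ℤ) (F : Fin n → M)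
    {L : List (Fin n)} (hL : L.Nodup) :
    (L.map fun i => (degLT e i L).negOnePow •
      koszulSign (Function.update e i (e i + 1)) L • F i).sum =
        koszulSign e L • orderedSum e F L := by
  induction L with
  | nil => simp [orderedSum]
  | cons l L ih =>
    rw [List.nodup_cons] at hL
    rw [List.map_cons, List.sum_cons, orderedSum, smul_add]
    congr 1
    · have h1 : koszulSign (Function.update e l (e l + 1)) L = koszulSign e L :=
        koszulSign_congr fun i hi => Function.update_of_ne (fun h : i = l => hL.1 (h ▸ hi)) _ _
      rw [smul_smul]
      congr 1
      rw [koszulSign_cons, koszulSign_cons, h1, degLT_cons, degLT_update e l l 1 hL.2]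
      simp only [lt_irrefl, and_false, if_false, zero_add, add_zero, Function.update_self, add_mul,
        one_mul, Int.negOnePow_add]
      have := negOnePow_mul_self (degLT e l L)
      rw [mul_comm (e l * _).negOnePow, ← mul_assoc, ← mul_assoc, this, one_mul]
    · have key : (L.map fun i => (degLT e i (l :: L)).negOnePow •
          koszulSign (Function.update e i (e i + 1)) (l :: L) • F i) =
          (L.map fun i => (degLT e i L).negOnePow •
            koszulSign (Function.update e i (e i + 1)) L • F i).map
              (((e l * degLT e l L).negOnePow * (e l).negOnePow) • ·) := by
        rw [List.map_map]
        refine List.map_congr_left fun i hi => ?_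
        have hil : i ≠ l := fun h => hL.1 (h ▸ hi)
        rw [Function.comp_apply, smul_smul, smul_smul, smul_smul]
        congr 1
        rw [koszulSign_cons, degLT_update e i l 1 hL.2, degLT_cons,
          Function.update_of_ne (Ne.symm hil)]
        rcases lt_or_gt_of_ne hil with h | h
        · simp only [hi, h, not_lt_of_gt h, and_self, if_true, if_false, zero_add, mul_add, mul_one,
            Int.negOnePow_add]
          ac_rfl
        · simp only [h, not_lt_of_gt h, and_false, if_true, if_false, add_zero, Int.negOnePow_add]
          ac_rfl
      rw [key, koszulSign_cons, ← List.smul_sum, ih hL.2, smul_smul, smul_smul]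
      congr 1
      ac_rfl

end Signs

/-! ### Values of factors and words, without the Koszul sign -/

section Values

section nprod

variable {A : Type*} [NonUnitalRing A]

theorem nprod_singleton (x : A) : nprod [x] = x := rfl

theorem nprod_cons (x : A) {l : List A} (hl : l ≠ []) : nprod (x :: l) = x * nprod l := by
  cases l with
  | nil => exact absurd rfl hl
  | cons y l => rfl

theorem nprod_append {l r : List A} (hl : l ≠ []) (hr : r ≠ []) :
    nprod (l ++ r) = nprod l * nprod r := by
  induction l with
  | nil => exact absurd rfl hl
  | cons x l ih =>
    rcases eq_or_ne l [] with rfl | h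
    · rw [List.singleton_append, nprod_cons x hr, nprod_singleton]
    · rw [List.cons_append, nprod_cons x (by simp [h]), ih h, nprod_cons x h, mul_assoc]

theorem nprod_mul (l r : List A) (x y : A) :
    nprod (l ++ x :: y :: r) = nprod (l ++ (x * y) :: r) := by
  have h : nprod (x :: y :: r) = nprod ((x * y) :: r) := by
    rcases eq_or_ne r [] with rfl | h
    · rfl
    · rw [nprod_cons x (by simp), nprod_cons y h, nprod_cons _ h, mul_assoc]
  rcases eq_or_ne l [] with rfl | hl
  · exact h
  · rw [nprod_append hl (by simp), nprod_append hl (by simp), h]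

theorem exists_linear_nprod (R : Type*) [CommRing R] [Module R A] [IsScalarTower R A A]
    [SMulCommClass R A A] (l r : List A) : ∃ φ : A →ₗ[R] A, ∀ x, nprod (l ++ x :: r) = φ x := by
  have h : ∃ φ : A →ₗ[R] A, ∀ x, nprod (x :: r) = φ x := by
    rcases eq_or_ne r [] with rfl | hr
    · exact ⟨LinearMap.id, fun x => rfl⟩
    · exact ⟨LinearMap.mulRight R (nprod r), fun x => nprod_cons x hr⟩
  obtain ⟨φ, hφ⟩ := h
  rcases eq_or_ne l [] with rfl | hl
  · exact ⟨φ, hφ⟩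
  · exact ⟨LinearMap.mulLeft R (nprod l) ∘ₗ φ, fun x => by
      rw [nprod_append hl (by simp), hφ]; rfl⟩

end nprod

variable {R : Type*} [CommRing R]
  {A : Type*} [NonUnitalRing A] [Module R A] [IsScalarTower R A A] [SMulCommClass R A A]
  {B : Type*} [NonUnitalRing B] [Module R B] [IsScalarTower R B B] [SMulCommClass R B B]
  {DA : DGCA R A} {DB : DGCA R B} {n : ℕ}

theorem negOnePow_smul_eq {M : Type*} [AddCommGroup M] [Module R M] (k : ℕ) (x : M) :
    (-1 : R) ^ k • x = (k : ℤ).negOnePow • x := by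
  rw [Units.smul_def, Int.coe_negOnePow_natCast, ← Int.cast_smul_eq_zsmul R]
  push_cast
  rfl

theorem negOnePow_neg_natCast (k : ℕ) : (-(k : ℤ)).negOnePow = (k : ℤ).negOnePow := Int.negOnePow_neg _

theorem map_update_of_notMem {α β : Type*} [DecidableEq α] (f : α → β) {i : α} (x : β) {L : List α}
    (h : i ∉ L) : L.map (Function.update f i x) = L.map f :=
  List.map_congr_left fun j hj => Function.update_of_ne (fun hji : j = i => h (hji ▸ hj)) _ _

theorem nprod_mem (DA : DGCA R A) {e : Fin n → ℤ} {a : Fin n → A} (ha : DA.Homog e a)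
    {L : List (Fin n)} (hL : L ≠ []) : nprod (L.map a) ∈ DA.gr (degSum e L) := by
  induction L with
  | nil => exact absurd rfl hL
  | cons i L ih =>
    rcases eq_or_ne L [] with rfl | h
    · simpa [degSum, nprod] using ha i
    · rw [List.map_cons, nprod_cons _ (by simpa using h), degSum_cons]
      exact DA.mul_mem (ha i) (ih h)

theorem d_nprod {e : Fin n → ℤ} {a : Fin n → A} (ha : DA.Homog e a) {L : List (Fin n)}
    (hL : L.Nodup) : DA.d (nprod (L.map a)) =
      orderedSum e (fun i => nprod (L.map (Function.update a i (DA.d (a i))))) L := by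
  induction L with
  | nil => simp [nprod, orderedSum]
  | cons i L ih =>
    rw [List.nodup_cons] at hL
    rcases eq_or_ne L [] with rfl | h
    · simp [nprod, orderedSum]
    · have h' (f : Fin n → A) : L.map f ≠ [] := by simpa using h
      rw [List.map_cons, nprod_cons _ (h' _), DA.leibniz (ha i), ih hL.2, orderedSum]
      congr 1
      · rw [List.map_cons, nprod_cons _ (h' _), map_update_of_notMem a _ hL.1, Function.update_self]
      · congr 1
        refine (map_orderedSum (AddMonoidHom.mulLeft (a i)) e _ L).trans (orderedSum_congr e ?_)
        intro j hj
        have hij : i ≠ j := fun h => hL.1 (h ▸ hj)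
        rw [List.map_cons, nprod_cons _ (h' _), Function.update_of_ne hij]
        rfl

variable (P : CInfMorphism DA DB)

theorem app_eq {N : ℕ} (f : Fin N → A) (l : List A) (h : l.length = N)
    (hf : ∀ i (hi : i < l.length), l[i] = f ⟨i, h ▸ hi⟩) : P.app l = P.p N f := by
  subst h
  exact congrArg _ (funext fun i : Fin l.length => hf i i.2)

theorem app_ofFn {N : ℕ} (f : Fin N → A) : P.app (List.ofFn f) = P.p N f :=
  app_eq P f _ (by simp) (by simp)

/-- The value of a factor. -/
def factorVal (a : Fin n → A) (b : List (List (Fin n))) : B :=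
  P.app (b.map fun x => nprod (x.map a))

theorem factorVal_ofFn {N : ℕ} (a : Fin n → A) (x : Fin N → List (Fin n)) :
    factorVal P a (List.ofFn x) = P.p N fun s => nprod ((x s).map a) := by
  rw [factorVal, List.map_ofFn, app_ofFn]
  rfl

theorem degSum_flatten (e : Fin n → ℤ) (b : List (List (Fin n))) :
    degSum e b.flatten = (b.map (degSum e)).sum := by
  induction b with
  | nil => rfl
  | cons x b ih => rw [List.flatten_cons, degSum_append, ih, List.map_cons, List.sum_cons]

theorem degSum_flatten_ofFn (e : Fin n → ℤ) {N : ℕ} (x : Fin N → List (Fin n)) :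
    degSum e (List.ofFn x).flatten = ∑ s, degSum e (x s) := by
  rw [degSum_flatten, List.map_ofFn, List.sum_ofFn]
  rfl

theorem factorVal_mem {e : Fin n → ℤ} {a : Fin n → A} (ha : DA.Homog e a)
    {b : List (List (Fin n))} (hb : b ≠ []) (h : ∀ x ∈ b, x ≠ []) :
    factorVal P a b ∈ DB.gr (degSum e b.flatten - (b.length - 1 : ℕ)) := by
  obtain ⟨x, hx⟩ : ∃ x : Fin b.length → List (Fin n), b = List.ofFn x :=
    ⟨b.get, (List.ofFn_get b).symm⟩
  have hb' : 0 < b.length := List.length_pos_iff.2 hb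
  have := P.map_mem b.length hb' (fun s => degSum e (x s)) (fun s => nprod ((x s).map a))
    fun s => nprod_mem DA ha (h (x s) (by rw [hx]; simp))
  rw [← factorVal_ofFn, ← degSum_flatten_ofFn, ← hx] at this
  convert this using 2
  push_cast [hb']
  ring

theorem sum_Iio_eq {N : ℕ} (f : Fin N → ℤ) (s : Fin N) :
    ∑ j ∈ Finset.Iio s, f j = ∑ j, if j < s then f j else 0 := by
  rw [← Finset.sum_filter]
  congr 1
  ext j
  simp

theorem orderedSum_flatten_ofFn {M : Type*} [AddCommGroup M] (e : Fin n → ℤ) (F : Fin n → M)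
    {N : ℕ} (x : Fin N → List (Fin n)) : orderedSum e F (List.ofFn x).flatten =
      ∑ s, (∑ j ∈ Finset.Iio s, degSum e (x j)).negOnePow • orderedSum e F (x s) := by
  simp only [sum_Iio_eq]
  induction N with
  | zero => simp [orderedSum]
  | succ N ih =>
    rw [List.ofFn_succ, List.flatten_cons, orderedSum_append, ih, Fin.sum_univ_succ,
      Finset.smul_sum]
    congr 1
    · simp
    · refine Finset.sum_congr rfl fun s _ => ?_
      rw [smul_smul, Fin.sum_univ_succ, Int.negOnePow_add]
      simp

/-- The relation of the morphism is applied with the products of variables as homogeneous inputs.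
The differentials of these inputs are then expanded by the Leibniz rule down to the variables. -/
theorem d_factorVal {e : Fin n → ℤ} {a : Fin n → A} (ha : DA.Homog e a) {N : ℕ}
    (x : Fin (N + 1) → List (Fin n)) (hx : ∀ s, x s ≠ []) (hnd : (List.ofFn x).flatten.Nodup) :
    DB.d (factorVal P a (List.ofFn x)) - (N : ℤ).negOnePow •
      orderedSum e (fun i => factorVal P (Function.update a i (DA.d (a i))) (List.ofFn x))
        (List.ofFn x).flatten =
    ∑ i : Fin N, ((i : ℕ) : ℤ).negOnePow •
        (P.p N (i.castSucc.contractNth (· * ·) fun s => nprod ((x s).map a)) -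
          (((N : ℤ) - (i : ℕ) - 1) * ∑ j ∈ Finset.Iic i.castSucc, degSum e (x j)).negOnePow •
            (P.p (i + 1) (fun k => nprod ((x ⟨k, by omega⟩).map a)) *
              P.p (N - i) (fun k => nprod ((x ⟨i + 1 + k, by omega⟩).map a)))) := by
  rw [← P.relation N (fun s => degSum e (x s)) (fun s => nprod ((x s).map a))
    fun s => nprod_mem DA ha (hx s), homDiff, negOnePow_neg_natCast, factorVal_ofFn,
    orderedSum_flatten_ofFn]
  congr 2
  refine Finset.sum_congr rfl fun s _ => ?_
  congr 1
  rw [List.nodup_flatten] at hnd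
  rw [d_nprod ha (hnd.1 (x s) (List.mem_ofFn.2 ⟨s, rfl⟩))]
  refine Eq.trans ?_ (map_orderedSum
    ((P.p (N + 1)).toLinearMap (fun s => nprod ((x s).map a)) s).toAddMonoidHom e _ (x s)).symm
  refine orderedSum_congr e fun i hi => ?_
  rw [factorVal_ofFn]
  refine congrArg (P.p (N + 1)) (funext fun t => ?_)
  by_cases hts : t = s
  · subst hts
    rw [Function.update_self]
  · rw [Function.update_of_ne hts, map_update_of_notMem]
    intro hit
    have h := hnd.2
    rw [List.pairwise_ofFn] at h
    rcases lt_or_gt_of_ne hts with h' | h'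
    · exact h h' hit hi
    · exact h h' hi hit

/-- The value of a word without the Koszul sign. -/
def wordVal (e : Fin n → ℤ) (a : Fin n → A) (w : Word n) : B :=
  w.tensorSign e • nprod (w.map (factorVal P a))

/-- The linear extension of `wordVal`. -/
def chainVal (e : Fin n → ℤ) (a : Fin n → A) : Chain R n →ₗ[R] B :=
  Finsupp.linearCombination R (wordVal P e a)

@[simp] theorem chainVal_single (e : Fin n → ℤ) (a : Fin n → A) (w : Word n) :
    chainVal P e a (Finsupp.single w 1) = wordVal P e a w := by simp [chainVal]

theorem realizeWord_eq (e : Fin n → ℤ) (a : Fin n → A) (w : Word n) :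
    P.realizeWord w e a = koszulSign e w.flatten.flatten • wordVal P e a w := by
  rw [CInfMorphism.realizeWord, mul_smul]
  rfl

theorem wordVal_singleton (e : Fin n → ℤ) (a : Fin n → A) (b : List (List (Fin n))) :
    wordVal P e a [b] = factorVal P a b := by
  simp [wordVal, Word.tensorSign, Word.dim, nprod]

theorem tensorSign_append (e : Fin n → ℤ) (u v : Word n) :
    Word.tensorSign e (u ++ v) = ((Word.dim v : ℤ) * degSum e u.flatten.flatten).negOnePow *
      (Word.tensorSign e u * Word.tensorSign e v) := by
  induction u with
  | nil => simp [Word.tensorSign, degSum]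
  | cons b u ih =>
    have h1 : Word.dim (u ++ v) = Word.dim u + Word.dim v := by simp [Word.dim]
    rw [List.cons_append, Word.tensorSign, ih, Word.tensorSign, h1, List.flatten_cons,
      List.flatten_append, degSum_append, mul_add, Int.negOnePow_add]
    push_cast
    rw [add_mul, Int.negOnePow_add]
    change (_ * (Word.dim v * degSum e b.flatten).negOnePow) * _ = _
    simp only [degSum]
    ac_rfl

/-- The maps in `v`, of total degree `-dim v`, have to pass the arguments in `u`. -/
theorem wordVal_append (e : Fin n → ℤ) (a : Fin n → A) {u v : Word n} (hu : u ≠ []) (hv : v ≠ []) :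
    wordVal P e a (u ++ v) = ((Word.dim v : ℤ) * degSum e u.flatten.flatten).negOnePow •
      (wordVal P e a u * wordVal P e a v) := by
  rw [wordVal, wordVal, wordVal, List.map_append, nprod_append (by simpa using hu)
    (by simpa using hv), tensorSign_append, smul_mul_smul_comm, mul_smul]

end Values

/-! ### The boundary of a word and the differential of its value -/

section Differential

variable {R : Type*} [CommRing R]
  {A : Type*} [NonUnitalRing A] [Module R A] [IsScalarTower R A A] [SMulCommClass R A A]
  {B : Type*} [NonUnitalRing B] [Module R B] [IsScalarTower R B B] [SMulCommClass R B B]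
  {DA : DGCA R A} {DB : DGCA R B} {n : ℕ} (P : CInfMorphism DA DB)

theorem sum_Iic_castSucc {N : ℕ} (f : Fin (N + 1) → ℤ) (i : Fin N) :
    ∑ j ∈ Finset.Iic i.castSucc, f j = ∑ k : Fin (i + 1), f ⟨k, by omega⟩ := by
  symm
  refine Finset.sum_bij (fun k _ => ⟨k, by omega⟩) ?_ ?_ ?_ fun _ _ => rfl
  · intro k _
    rw [Finset.mem_Iic, Fin.le_def]
    exact Nat.lt_succ_iff.1 k.2
  · intro k _ l _ h
    exact Fin.ext (congrArg (fun j : Fin (N + 1) => (j : ℕ)) h)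
  · intro j hj
    rw [Finset.mem_Iic, Fin.le_def] at hj
    exact ⟨⟨j, Nat.lt_succ_of_le hj⟩, Finset.mem_univ _, rfl⟩

theorem take_ofFn {α : Type*} {N : ℕ} (x : Fin (N + 1) → α) (i : Fin N) :
    (List.ofFn x).take (i + 1) = List.ofFn fun k : Fin (i + 1) => x ⟨k, by omega⟩ := by
  refine List.ext_getElem (by simp) fun k h1 h2 => ?_
  simp only [List.getElem_take, List.getElem_ofFn]

theorem drop_ofFn {α : Type*} {N : ℕ} (x : Fin (N + 1) → α) (i : Fin N) :
    (List.ofFn x).drop (i + 1) = List.ofFn fun k : Fin (N - i) => x ⟨i + 1 + k, by omega⟩ := by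
  refine List.ext_getElem (by simp) fun k h1 h2 => ?_
  simp only [List.getElem_drop, List.getElem_ofFn]

theorem drop_take_ofFn {α : Type*} {N : ℕ} (x : Fin (N + 1) → α) (i : Fin N) :
    ((List.ofFn x).drop i).take 2 = [x i.castSucc, x i.succ] := by
  rw [List.drop_eq_getElem_cons (by simp), List.drop_eq_getElem_cons (by simp)]
  simp only [List.take_succ_cons, List.take_zero, List.getElem_ofFn]
  rfl

theorem factorVal_merge (a : Fin n → A) {N : ℕ} (x : Fin (N + 1) → List (Fin n))
    (hx : ∀ s, x s ≠ []) (i : Fin N) :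
    factorVal P a ((List.ofFn x).take i ++ (((List.ofFn x).drop i).take 2).flatten ::
      (List.ofFn x).drop (i + 2)) =
    P.p N (i.castSucc.contractNth (· * ·) fun s => nprod ((x s).map a)) := by
  have hi := i.2
  rw [drop_take_ofFn]
  refine app_eq P _ _ (by simp; omega) fun k hk => ?_
  simp only [List.length_map, List.length_append, List.length_cons, List.length_take,
    List.length_drop, List.length_ofFn] at hk
  rw [List.getElem_map, List.getElem_append, Fin.contractNth]
  simp only [List.length_take, List.length_ofFn, Fin.val_castSucc, min_eq_left (by omega : (i : ℕ) ≤ N + 1)]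
  split_ifs with h1 h2
  · simp only [List.getElem_take, List.getElem_ofFn]
    rfl
  · subst h2
    simp only [Nat.sub_self, List.getElem_cons_zero, List.flatten_cons, List.flatten_nil,
      List.append_nil, List.map_append]
    exact nprod_append (by simpa using hx _) (by simpa using hx _)
  · obtain ⟨j, rfl⟩ : ∃ j, k = i + 1 + j := ⟨k - i - 1, by omega⟩
    have h3 : (i : ℕ) + 1 + j - i = j + 1 := by omega
    simp only [h3, List.getElem_cons_succ, List.getElem_drop, List.getElem_ofFn]
    congr 3
    apply Fin.ext
    simp
    omega

theorem chainVal_factorBoundary (e : Fin n → ℤ) (a : Fin n → A) {N : ℕ}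
    (x : Fin (N + 1) → List (Fin n)) (hx : ∀ s, x s ≠ []) :
    chainVal P e a (factorBoundary R (List.ofFn x)) =
    ∑ i : Fin N, ((i : ℕ) : ℤ).negOnePow •
        (P.p N (i.castSucc.contractNth (· * ·) fun s => nprod ((x s).map a)) -
          (((N : ℤ) - (i : ℕ) - 1) * ∑ j ∈ Finset.Iic i.castSucc, degSum e (x j)).negOnePow •
            (P.p (i + 1) (fun k => nprod ((x ⟨k, by omega⟩).map a)) *
              P.p (N - i) (fun k => nprod ((x ⟨i + 1 + k, by omega⟩).map a)))) := by
  rw [factorBoundary, map_sum, List.length_ofFn, Nat.add_sub_cancel, Finset.sum_range]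
  refine Finset.sum_congr rfl fun i _ => ?_
  rw [map_smul, negOnePow_smul_eq, map_sub, chainVal_single, chainVal_single, wordVal_singleton,
    factorVal_merge P a x hx]
  congr 2
  have hi := i.2
  have h1 := wordVal_append P e a (u := [(List.ofFn x).take (i + 1)])
    (v := [(List.ofFn x).drop (i + 1)]) (by simp) (by simp)
  rw [List.singleton_append] at h1
  rw [h1, wordVal_singleton, wordVal_singleton, take_ofFn, drop_ofFn, factorVal_ofFn,
    factorVal_ofFn, List.flatten_singleton, degSum_flatten_ofFn, sum_Iic_castSucc]
  congr 3
  rw [Word.dim]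
  simp only [List.map_cons, List.map_nil, List.sum_cons, List.sum_nil, List.length_ofFn, add_zero]
  omega

/-- The condition on `L` keeps out the empty word: its value is a default `0`, not a unit. -/
theorem chainVal_insertHom_nil_left (e : Fin n → ℤ) (a : Fin n → A) {w : Word n} (hw : w ≠ [])
    {L : List (Fin n)} {k : ℕ} (hL : L ≠ []) {z : Chain R n}
    (hz : z ∈ Finsupp.supported R R (wordsOn L k)) :
    chainVal P e a (insertHom R [] w z) =
      ((Word.dim w : ℤ) * degSum e L).negOnePow • (chainVal P e a z * wordVal P e a w) := by
  induction hz using supported_induction with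
  | zero => simp
  | add x y _ _ hx hy => simp only [map_add, hx, hy, add_mul, smul_add]
  | smul c x _ hx => rw [map_smul, map_smul, hx, map_smul, smul_mul_assoc, smul_comm]
  | single u hu =>
    rw [insertHom_single, List.nil_append, chainVal_single, chainVal_single,
      wordVal_append P e a ?_ hw, hu.1]
    rintro rfl
    exact hL hu.1.symm

theorem chainVal_insertHom_nil_right (e : Fin n → ℤ) (a : Fin n → A) (b : List (List (Fin n)))
    {L : List (Fin n)} {k : ℕ} (hL : L ≠ []) {z : Chain R n}
    (hz : z ∈ Finsupp.supported R R (wordsOn L k)) :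
    chainVal P e a (insertHom R [b] [] z) =
      ((k : ℤ) * degSum e b.flatten).negOnePow • (factorVal P a b * chainVal P e a z) := by
  induction hz using supported_induction with
  | zero => simp
  | add x y _ _ hx hy => simp only [map_add, hx, hy, mul_add, smul_add]
  | smul c x _ hx => rw [map_smul, map_smul, hx, map_smul, mul_smul_comm, smul_comm]
  | single u hu =>
    rw [insertHom_single, List.append_nil, chainVal_single, chainVal_single,
      wordVal_append P e a (by simp) ?_, hu.2.2.2, wordVal_singleton, List.flatten_singleton]
    rintro rfl
    exact hL hu.1.symm

theorem flatten_ne_nil {L : List (Fin n)} {k : ℕ} {w : Word n} (hw : w ∈ wordsOn L k)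
    (h : w ≠ []) : L ≠ [] := by
  obtain ⟨rfl, h1, h2, -⟩ := hw
  rcases w with _ | ⟨b, w⟩
  · exact absurd rfl h
  · rcases b with _ | ⟨x, b⟩
    · exact absurd rfl (h1 [] (by simp))
    · have := h2 (x :: b) (by simp) x (by simp)
      simp [this]

theorem d_factorVal_eq {e : Fin n → ℤ} {a : Fin n → A} (ha : DA.Homog e a)
    {b : List (List (Fin n))} (hb : b ≠ []) (h : ∀ x ∈ b, x ≠ []) (hnd : b.flatten.Nodup) :
    DB.d (factorVal P a b) - ((b.length - 1 : ℕ) : ℤ).negOnePow •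
      orderedSum e (fun i => factorVal P (Function.update a i (DA.d (a i))) b) b.flatten =
    chainVal P e a (factorBoundary R b) := by
  obtain ⟨N, x, rfl⟩ : ∃ (N : ℕ) (x : Fin (N + 1) → List (Fin n)), b = List.ofFn x := by
    have hb' : 0 < b.length := List.length_pos_iff.2 hb
    refine ⟨b.length - 1, fun i => b.get (i.cast (by omega)), ?_⟩
    refine List.ext_getElem (by simp; omega) fun k h1 h2 => ?_
    simp only [List.getElem_ofFn, List.get_eq_getElem, Fin.val_cast]
  have hx (s : Fin (N + 1)) : x s ≠ [] := h _ (List.mem_ofFn.2 ⟨s, rfl⟩)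
  rw [List.length_ofFn, Nat.add_sub_cancel, d_factorVal P ha x hx hnd,
    chainVal_factorBoundary P e a x hx]

theorem factorVal_update_of_notMem (a : Fin n → A) {i : Fin n} (y : A) {b : List (List (Fin n))}
    (h : i ∉ b.flatten) : factorVal P (Function.update a i y) b = factorVal P a b := by
  rw [factorVal, factorVal]
  congr 1
  refine List.map_congr_left fun x hx => ?_
  rw [map_update_of_notMem]
  exact fun hi => h (List.mem_flatten.2 ⟨x, hx, hi⟩)

theorem tensorSign_congr {e e' : Fin n → ℤ} {w : Word n} (h : ∀ i ∈ w.flatten.flatten, e i = e' i) :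
    Word.tensorSign e w = Word.tensorSign e' w := by
  induction w with
  | nil => rfl
  | cons b w ih =>
    simp only [List.flatten_cons, List.flatten_append, List.mem_append] at h
    rw [Word.tensorSign, Word.tensorSign, ih fun i hi => h i (Or.inr hi),
      List.map_congr_left fun i hi => h i (Or.inl hi)]

theorem wordVal_update_of_notMem (e : Fin n → ℤ) (a : Fin n → A) {i : Fin n} (c : ℤ) (y : A)
    {w : Word n} (h : i ∉ w.flatten.flatten) :
    wordVal P (Function.update e i c) (Function.update a i y) w = wordVal P e a w := by
  rw [wordVal, wordVal, tensorSign_congr (e' := e)]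
  · congr 2
    refine List.map_congr_left fun b hb => factorVal_update_of_notMem P a y fun hi => h ?_
    rw [List.flatten_flatten]
    exact List.mem_flatten.2 ⟨_, List.mem_map.2 ⟨b, hb, rfl⟩, hi⟩
  · intro j hj
    exact Function.update_of_ne (fun hji : j = i => h (hji ▸ hj)) _ _

/-- Induction over the factors with the Leibniz rule in `B`; for a single factor it is the relation
of the morphism. What remains is to see that the tensor signs on the two sides agree. -/
theorem d_wordVal {e : Fin n → ℤ} {a : Fin n → A} (ha : DA.Homog e a) {L : List (Fin n)} {k : ℕ}
    {w : Word n} (hw : w ∈ wordsOn L k) (hL : L.Nodup) :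
    DB.d (wordVal P e a w) - (k : ℤ).negOnePow •
      orderedSum e (fun i => wordVal P (Function.update e i (e i + 1))
        (Function.update a i (DA.d (a i))) w) L =
    chainVal P e a (wordBoundary R w) := by
  induction w generalizing L k with
  | nil =>
    obtain ⟨rfl, -⟩ := hw
    simp [wordVal, nprod, orderedSum, wordBoundary]
  | cons b w ih =>
    obtain ⟨rfl, h1, h2, rfl⟩ := hw
    simp only [List.mem_cons, forall_eq_or_imp] at h1 h2
    have hw0 := mem_wordsOn_self h1.2 h2.2
    have hdim : Word.dim (b :: w) = b.length - 1 + Word.dim w := by simp [Word.dim]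
    rw [List.flatten_cons, List.flatten_append] at hL ⊢
    have hb := d_factorVal_eq (R := R) P ha h1.1 h2.1 hL.of_append_left
    rcases eq_or_ne w [] with rfl | hne
    · have hd0 : Word.dim ([] : Word n) = 0 := rfl
      simp only [wordVal_singleton, List.flatten_nil, List.append_nil, hdim, hd0, add_zero, hb,
        wordBoundary, map_zero, smul_zero, ← insertHom_apply]
      congr 1
      induction factorBoundary R b using chain_induction with
      | zero => simp
      | add x y hx hy => rw [map_add, ← hx, ← hy]
      | smul c x hx => rw [map_smul, ← hx]
      | single u => simp
    have hLw := flatten_ne_nil hw0 hne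
    have hLb : b.flatten ≠ [] := by
      rw [Ne, List.flatten_eq_nil_iff]
      intro h
      obtain ⟨x, hx⟩ := List.exists_mem_of_ne_nil b h1.1
      exact h2.1 x hx (h x hx)
    have hdisj := (List.nodup_append'.1 hL).2.2
    have ih := ih hw0 hL.of_append_right
    have hmem := factorVal_mem P ha h1.1 h2.1
    have hv (e : Fin n → ℤ) (a : Fin n → A) : wordVal P e a (b :: w) =
        ((Word.dim w : ℤ) * degSum e b.flatten).negOnePow •
          (factorVal P a b * wordVal P e a w) := by
      have := wordVal_append P e a (u := [b]) (by simp) hne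
      rwa [List.singleton_append, wordVal_singleton, List.flatten_singleton] at this
    have hr1 : chainVal P e a (insertHom R [] w (factorBoundary R b)) =
        ((Word.dim w : ℤ) * degSum e b.flatten).negOnePow •
          (chainVal P e a (factorBoundary R b) * wordVal P e a w) := by
      have hbl : 0 < b.length := List.length_pos_iff.2 h1.1
      rcases hl : b.length - 1 with _ | j
      · rw [factorBoundary_eq_zero (by omega)]
        simp
      · have hbl' : b.length = j + 2 := by omega
        exact chainVal_insertHom_nil_left P e a hne hLb (factorBoundary_mem hbl' h2.1)
    -- Lowering the dimension of `w` by one changes the tensor sign by the degree of the arguments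
    -- of `b`. Together with `(-1) ^ (b.length - 1)` this is the sign for moving `d` past the value
    -- of `b`.
    have hr2 : chainVal P e a ((-1 : R) ^ (b.length - 1) • insertHom R [b] [] (wordBoundary R w)) =
        (((Word.dim w : ℤ) * degSum e b.flatten).negOnePow *
          (degSum e b.flatten - (b.length - 1 : ℕ)).negOnePow) •
            (factorVal P a b * chainVal P e a (wordBoundary R w)) := by
      rw [map_smul, negOnePow_smul_eq]
      rcases hl : Word.dim w with _ | j
      · rw [hl] at hw0
        rw [wordBoundary_eq_zero hw0]
        simp
      · rw [hl] at hw0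
        rw [chainVal_insertHom_nil_right P e a b hLw (wordBoundary_mem hw0), smul_smul]
        congr 1
        rw [Int.negOnePow_sub]
        push_cast
        rw [add_mul, one_mul, Int.negOnePow_add]
        have := negOnePow_mul_self (degSum e b.flatten)
        calc _ = (((b.length - 1 : ℕ) : ℤ).negOnePow * ((j : ℤ) * degSum e b.flatten).negOnePow) *
              ((degSum e b.flatten).negOnePow * (degSum e b.flatten).negOnePow) := by
                rw [this, mul_one]
          _ = _ := by ac_rfl
    -- Differentiating an argument of `b` raises the degree that the maps in `w` must pass by one;
    -- hence the `+ 1` in the exponent.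
    have ho1 : orderedSum e (fun i => wordVal P (Function.update e i (e i + 1))
        (Function.update a i (DA.d (a i))) (b :: w)) b.flatten =
        ((Word.dim w : ℤ) * (degSum e b.flatten + 1)).negOnePow •
          (orderedSum e (fun i => factorVal P (Function.update a i (DA.d (a i))) b) b.flatten *
            wordVal P e a w) := by
      refine Eq.trans (orderedSum_congr e fun i hi => ?_) (map_orderedSum
        ((DistribSMul.toAddMonoidHom B
          ((Word.dim w : ℤ) * (degSum e b.flatten + 1)).negOnePow).comp
            (AddMonoidHom.mulRight (wordVal P e a w))) e _ b.flatten).symm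
      rw [hv, degSum_update e i 1 hL.of_append_left, if_pos hi,
        wordVal_update_of_notMem P e a _ _ fun h => hdisj hi h]
      rfl
    have ho2 : orderedSum e (fun i => wordVal P (Function.update e i (e i + 1))
        (Function.update a i (DA.d (a i))) (b :: w)) w.flatten.flatten =
        ((Word.dim w : ℤ) * degSum e b.flatten).negOnePow • (factorVal P a b *
          orderedSum e (fun i => wordVal P (Function.update e i (e i + 1))
            (Function.update a i (DA.d (a i))) w) w.flatten.flatten) := by
      refine Eq.trans (orderedSum_congr e fun i hi => ?_) (map_orderedSum
        ((DistribSMul.toAddMonoidHom B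
          ((Word.dim w : ℤ) * degSum e b.flatten).negOnePow).comp
            (AddMonoidHom.mulLeft (factorVal P a b))) e _ w.flatten.flatten).symm
      have hib : i ∉ b.flatten := fun h => hdisj h hi
      rw [hv, degSum_update e i 1 hL.of_append_left, if_neg hib, add_zero,
        factorVal_update_of_notMem P a _ hib]
      rfl
    have hc1 : ((Word.dim (b :: w) : ℕ) : ℤ).negOnePow *
        ((Word.dim w : ℤ) * (degSum e b.flatten + 1)).negOnePow =
        ((Word.dim w : ℤ) * degSum e b.flatten).negOnePow *
          ((b.length - 1 : ℕ) : ℤ).negOnePow := by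
      rw [hdim, Nat.cast_add, Int.negOnePow_add, mul_add, mul_one, Int.negOnePow_add]
      have := negOnePow_mul_self (Word.dim w : ℤ)
      calc _ = (((b.length - 1 : ℕ) : ℤ).negOnePow *
            ((Word.dim w : ℤ) * degSum e b.flatten).negOnePow) *
              ((Word.dim w : ℤ).negOnePow * (Word.dim w : ℤ).negOnePow) := by ac_rfl
        _ = _ := by rw [this, mul_one, mul_comm]
    have hc2 : ((Word.dim (b :: w) : ℕ) : ℤ).negOnePow * (degSum e b.flatten).negOnePow *
        ((Word.dim w : ℤ) * degSum e b.flatten).negOnePow =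
        ((Word.dim w : ℤ) * degSum e b.flatten).negOnePow *
          (degSum e b.flatten - (b.length - 1 : ℕ)).negOnePow * (Word.dim w : ℤ).negOnePow := by
      rw [hdim, Nat.cast_add, Int.negOnePow_add, Int.negOnePow_sub]
      ac_rfl
    rw [wordBoundary, ← insertHom_apply, ← insertHom_apply, map_add, hr1, hr2, ← hb, ← ih,
      orderedSum_append, ho1, ho2, hv, Units.smul_def, map_zsmul, ← Units.smul_def,
      DB.leibniz hmem, smul_add, smul_smul, smul_add, smul_smul, smul_smul, smul_smul, hc1, hc2,
      sub_mul, mul_sub, smul_sub, smul_sub, smul_mul_assoc, mul_smul_comm, smul_smul, smul_smul]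
    abel

end Differential

/-! ### Realizations are graded multilinear maps and intertwine the differentials -/

section Operations

variable {R : Type*} [CommRing R]
  {A : Type*} [NonUnitalRing A] [Module R A] [IsScalarTower R A A] [SMulCommClass R A A]
  {B : Type*} [NonUnitalRing B] [Module R B] [IsScalarTower R B B] [SMulCommClass R B B]
  {DA : DGCA R A} {DB : DGCA R B} {n : ℕ} (P : CInfMorphism DA DB)

/-- `CInfMorphism.realize` as a linear map. -/
def realizeHom (e : Fin n → ℤ) (a : Fin n → A) : Chain R n →ₗ[R] B :=
  Finsupp.linearCombination R fun w => P.realizeWord w e a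

theorem realizeHom_apply (e : Fin n → ℤ) (a : Fin n → A) (z : Chain R n) :
    realizeHom P e a z = P.realize z e a := rfl

@[simp] theorem realizeHom_single (e : Fin n → ℤ) (a : Fin n → A) (w : Word n) :
    realizeHom P e a (Finsupp.single w 1) = P.realizeWord w e a := by simp [realizeHom]

theorem realizeHom_eq (e : Fin n → ℤ) (a : Fin n → A) {L : List (Fin n)} {k : ℕ} {z : Chain R n}
    (hz : z ∈ Finsupp.supported R R (wordsOn L k)) :
    realizeHom P e a z = koszulSign e L • chainVal P e a z := by
  induction hz using supported_induction with
  | zero => simp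
  | add x y _ _ hx hy => simp only [map_add, hx, hy, smul_add]
  | smul c x _ hx => rw [map_smul, hx, map_smul, smul_comm]
  | single w hw => rw [realizeHom_single, realizeWord_eq, chainVal_single, hw.1]

theorem realizeHom_wordBoundary (e : Fin n → ℤ) (a : Fin n → A) {L : List (Fin n)} {k : ℕ}
    {w : Word n} (hw : w ∈ wordsOn L k) :
    realizeHom P e a (wordBoundary R w) = koszulSign e L • chainVal P e a (wordBoundary R w) := by
  rcases k with _ | k
  · rw [wordBoundary_eq_zero hw]
    simp
  · exact realizeHom_eq P e a (wordBoundary_mem hw)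

theorem sum_Iio_eq_degLT (e : Fin n → ℤ) (i : Fin n) :
    ∑ j ∈ Finset.Iio i, e j = degLT e i (List.finRange n) := by
  rw [sum_Iio_eq, degLT]
  have h (L : List (Fin n)) : ((L.filter (· < i)).map e).sum =
      (L.map fun j => if j < i then e j else 0).sum := by
    induction L with
    | nil => rfl
    | cons j L ih => by_cases h : j < i <;> simp [h, ih]
  rw [h, ← List.ofFn_eq_map, List.sum_ofFn]

/-- `sum_koszulSign_update` extracts the Koszul sign of the order `L` from the differential; the
boundary carries the same sign, so `d_wordVal` finishes. -/
theorem homDiff_realizeWord {e : Fin n → ℤ} {a : Fin n → A} (ha : DA.Homog e a)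
    {L : List (Fin n)} {k : ℕ} {w : Word n} (hw : w ∈ wordsOn L k)
    (hL : L.Perm (List.finRange n)) :
    homDiff DA DB (-k) (P.realizeWord w) e a = realizeHom P e a (wordBoundary R w) := by
  have hnd : L.Nodup := hL.nodup_iff.2 (List.nodup_finRange n)
  have h1 : ∑ i : Fin n, (∑ j ∈ Finset.Iio i, e j).negOnePow •
      P.realizeWord w (Function.update e i (e i + 1)) (Function.update a i (DA.d (a i))) =
      koszulSign e L • orderedSum e (fun i => wordVal P (Function.update e i (e i + 1))
        (Function.update a i (DA.d (a i))) w) L := by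
    rw [← sum_koszulSign_update e _ hnd, (hL.map _).sum_eq, ← List.ofFn_eq_map, List.sum_ofFn]
    refine Finset.sum_congr rfl fun i _ => ?_
    rw [realizeWord_eq, hw.1, sum_Iio_eq_degLT, degLT_perm e i hL]
  rw [homDiff, h1, realizeWord_eq, hw.1, Units.smul_def, map_zsmul, ← Units.smul_def,
    negOnePow_neg_natCast, smul_comm _ (koszulSign e L), ← smul_sub, d_wordVal P ha hw hnd,
    realizeHom_wordBoundary P e a hw]

theorem homDiff_realize {e : Fin n → ℤ} {a : Fin n → A} (ha : DA.Homog e a) {m k : ℕ}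
    {z : Chain R n} (hz : z ∈ builtFrom R n m k) :
    homDiff DA DB (-k) (P.realize z) e a = P.realize (boundary R n z) e a := by
  rw [← realizeHom_apply]
  have h (z : Chain R n) : homDiff DA DB (-k) (P.realize z) e a = DB.d (realizeHom P e a z) -
      (-(k : ℤ)).negOnePow • ∑ i : Fin n, (∑ j ∈ Finset.Iio i, e j).negOnePow •
        realizeHom P (Function.update e i (e i + 1)) (Function.update a i (DA.d (a i))) z := rfl
  induction hz using supported_induction with
  | zero => simp [h]
  | add x y _ _ hx hy =>
    rw [map_add, map_add, ← hx, ← hy, h, h, h]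
    simp only [map_add, smul_add, Finset.sum_add_distrib]
    abel
  | smul c x _ hx =>
    rw [map_smul, map_smul, ← hx, h, h]
    simp only [map_smul, smul_sub, Finset.smul_sum, smul_comm c]
  | single w hw =>
    have hw' := mem_wordsOn_self hw.1.2.1 hw.1.2.2
    rw [hw.2.1] at hw'
    rw [boundary_single, ← homDiff_realizeWord P ha hw' hw.1.1, h, homDiff]
    simp

theorem wordVal_mem {e : Fin n → ℤ} {a : Fin n → A} (ha : DA.Homog e a) {L : List (Fin n)} {k : ℕ}
    {w : Word n} (hw : w ∈ wordsOn L k) : wordVal P e a w ∈ DB.gr (degSum e L - k) := by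
  rw [wordVal, Units.smul_def]
  refine zsmul_mem ?_ _
  induction w generalizing L k with
  | nil => exact zero_mem _
  | cons b w ih =>
    obtain ⟨rfl, h1, h2, rfl⟩ := hw
    simp only [List.mem_cons, forall_eq_or_imp] at h1 h2
    have hw0 := mem_wordsOn_self h1.2 h2.2
    have hdim : Word.dim (b :: w) = b.length - 1 + Word.dim w := by simp [Word.dim]
    have hb := factorVal_mem P ha h1.1 h2.1
    rcases eq_or_ne w [] with rfl | hne
    · simpa [nprod, Word.dim] using hb
    · rw [List.map_cons, nprod_cons _ (by simpa using hne)]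
      convert DB.mul_mem hb (ih hw0) using 2
      rw [hdim, List.flatten_cons, List.flatten_append, degSum_append]
      push_cast
      ring

theorem exists_linear_nprod_map (R : Type*) [CommRing R] {A : Type*} [NonUnitalRing A] [Module R A]
    [IsScalarTower R A A] [SMulCommClass R A A] (a : Fin n → A) {i : Fin n} {L : List (Fin n)}
    (hi : i ∈ L) (hL : L.Nodup) :
    ∃ φ : A →ₗ[R] A, ∀ y, nprod (L.map (Function.update a i y)) = φ y := by
  obtain ⟨l, r, rfl⟩ := List.append_of_mem hi
  obtain ⟨φ, hφ⟩ := exists_linear_nprod R (l.map a) (r.map a)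
  refine ⟨φ, fun y => ?_⟩
  rw [List.nodup_middle, List.nodup_cons, List.mem_append, not_or] at hL
  rw [List.map_append, List.map_cons, map_update_of_notMem _ _ hL.1.1,
    map_update_of_notMem _ _ hL.1.2, Function.update_self, hφ]

theorem exists_linear_factorVal (a : Fin n → A) {i : Fin n} {b : List (List (Fin n))}
    (hi : i ∈ b.flatten) (hb : b.flatten.Nodup) :
    ∃ φ : A →ₗ[R] B, ∀ y, factorVal P (Function.update a i y) b = φ y := by
  obtain ⟨x, hx⟩ : ∃ x : Fin b.length → List (Fin n), b = List.ofFn x :=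
    ⟨b.get, (List.ofFn_get b).symm⟩
  obtain ⟨y, hy, hiy⟩ := List.mem_flatten.1 hi
  rw [hx, List.mem_ofFn] at hy
  obtain ⟨s, rfl⟩ := hy
  rw [hx, List.nodup_flatten, List.pairwise_ofFn] at hb
  obtain ⟨φ, hφ⟩ := exists_linear_nprod_map R a hiy (hb.1 (x s) (List.mem_ofFn.2 ⟨s, rfl⟩))
  refine ⟨(P.p b.length).toLinearMap (fun t => nprod ((x t).map a)) s ∘ₗ φ, fun y => ?_⟩
  have h (a : Fin n → A) : factorVal P a b = P.p b.length fun t => nprod ((x t).map a) := by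
    rw [← factorVal_ofFn, ← hx]
  rw [h, LinearMap.comp_apply, ← hφ]
  refine congrArg (P.p b.length) (funext fun t => ?_)
  by_cases hts : t = s
  · subst hts
    rw [Function.update_self]
  · rw [Function.update_of_ne hts, map_update_of_notMem]
    intro hit
    rcases lt_or_gt_of_ne hts with h' | h'
    · exact hb.2 h' hit hiy
    · exact hb.2 h' hiy hit

theorem exists_linear_wordVal (e : Fin n → ℤ) (a : Fin n → A) {i : Fin n} {w : Word n}
    (hi : i ∈ w.flatten.flatten) (hw : w.flatten.flatten.Nodup) :
    ∃ φ : A →ₗ[R] B, ∀ y, wordVal P e (Function.update a i y) w = φ y := by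
  obtain ⟨x, hx, hix⟩ := List.mem_flatten.1 hi
  obtain ⟨b, hb, hxb⟩ := List.mem_flatten.1 hx
  obtain ⟨u, v, rfl⟩ := List.append_of_mem hb
  have hib : i ∈ b.flatten := List.mem_flatten.2 ⟨x, hxb, hix⟩
  rw [List.flatten_append, List.flatten_cons, List.flatten_append, List.flatten_append,
    List.nodup_append', List.nodup_append'] at hw
  obtain ⟨φ, hφ⟩ := exists_linear_factorVal P a hib hw.2.1.1
  obtain ⟨ψ, hψ⟩ := exists_linear_nprod R (u.map (factorVal P a)) (v.map (factorVal P a))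
  have hmem {c : List (List (Fin n))} {u : Word n} (hc : c ∈ u) (h : i ∈ c.flatten) :
      i ∈ u.flatten.flatten := by
    rw [List.flatten_flatten]
    exact List.mem_flatten.2 ⟨_, List.mem_map.2 ⟨c, hc, rfl⟩, h⟩
  refine ⟨((Word.tensorSign e (u ++ b :: v) : ℤ) : R) • (ψ ∘ₗ φ), fun y => ?_⟩
  rw [wordVal, List.map_append, List.map_cons, hφ, Units.smul_def, LinearMap.smul_apply,
    Int.cast_smul_eq_zsmul, LinearMap.comp_apply, ← hψ]
  congr 3
  · refine List.map_congr_left fun c hc => factorVal_update_of_notMem P a y fun h => ?_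
    exact hw.2.2 (hmem hc h) (List.mem_append_left _ hib)
  · congr 1
    refine List.map_congr_left fun c hc => factorVal_update_of_notMem P a y fun h => ?_
    exact hw.2.1.2.2 hib (hmem hc h)

/-- Multilinearity is obtained one variable at a time. In a cell the variable lies in exactly one
argument of exactly one factor, so with the others fixed the value is a composite of linear maps. -/
theorem exists_linear_realize (e : Fin n → ℤ) (a : Fin n → A) (i : Fin n) {z : Chain R n}
    (hz : z ∈ cellChains R n) :
    ∃ φ : A →ₗ[R] B, ∀ y, P.realize z e (Function.update a i y) = φ y := by
  simp only [← realizeHom_apply]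
  induction hz using supported_induction with
  | zero => exact ⟨0, by simp⟩
  | add x y _ _ hx hy =>
    obtain ⟨φ, hφ⟩ := hx
    obtain ⟨ψ, hψ⟩ := hy
    exact ⟨φ + ψ, fun y => by rw [map_add, hφ, hψ]; rfl⟩
  | smul c x _ hx =>
    obtain ⟨φ, hφ⟩ := hx
    exact ⟨c • φ, fun y => by rw [map_smul, hφ]; rfl⟩
  | single w hw =>
    obtain ⟨φ, hφ⟩ := exists_linear_wordVal P e a (hw.1.mem_iff.2 (List.mem_finRange i))
      (hw.1.nodup_iff.2 (List.nodup_finRange n))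
    refine ⟨((koszulSign e w.flatten.flatten : ℤ) : R) • φ, fun y => ?_⟩
    rw [realizeHom_single, realizeWord_eq, hφ, LinearMap.smul_apply, Int.cast_smul_eq_zsmul]
    rfl

theorem isGradedMap_realize {m k : ℕ} {z : Chain R n} (hz : z ∈ builtFrom R n m k) :
    IsGradedMap DA DB (-k) (P.realize z) := by
  have hz' := builtFrom_le_cellChains m k hz
  refine fun e => ⟨?_, fun a ha => ?_⟩
  · have hcoe [inst : DecidableEq (Fin n)] (v : ∀ i, DA.gr (e i)) (i : Fin n) (x : DA.gr (e i)) :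
        (fun j => (Function.update v i x j : A)) = Function.update (fun j => (v j : A)) i x := by
      funext j
      by_cases h : j = i
      · subst h
        simp
      · simp [h]
    refine ⟨{ toFun := fun a => P.realize z e fun i => (a i : A)
              map_update_add' := ?_
              map_update_smul' := ?_ }, fun a => rfl⟩
    · intro inst v i x y
      obtain rfl : inst = instDecidableEqFin n := Subsingleton.elim _ _
      obtain ⟨φ, hφ⟩ := exists_linear_realize P e (fun j => (v j : A)) i hz'
      simp only [hcoe, hφ, Submodule.coe_add, map_add]
    · intro inst v i c x
      obtain rfl : inst = instDecidableEqFin n := Subsingleton.elim _ _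
      obtain ⟨φ, hφ⟩ := exists_linear_realize P e (fun j => (v j : A)) i hz'
      simp only [hcoe, hφ, Submodule.coe_smul, map_smul]
  · rw [← realizeHom_apply]
    induction hz using supported_induction with
    | zero => simp
    | add x y h1 h2 hx hy =>
      rw [map_add]
      exact add_mem (hx (builtFrom_le_cellChains m k h1)) (hy (builtFrom_le_cellChains m k h2))
    | smul c x h1 hx =>
      rw [map_smul]
      exact Submodule.smul_mem _ _ (hx (builtFrom_le_cellChains m k h1))
    | single w hw =>
      have hw' := mem_wordsOn_self hw.1.2.1 hw.1.2.2
      rw [hw.2.1] at hw'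
      rw [realizeHom_single, realizeWord_eq, Units.smul_def]
      refine zsmul_mem ?_ _
      convert wordVal_mem P ha hw' using 2
      rw [sub_eq_add_neg, degSum, (hw.1.1.map e).sum_eq, ← List.ofFn_eq_map, List.sum_ofFn]

end Operations

/-! ### Realizations respect the identifications -/

section Relators

variable {R : Type*} [CommRing R]
  {A : Type*} [NonUnitalRing A] [Module R A] [IsScalarTower R A A] [SMulCommClass R A A]
  {B : Type*} [NonUnitalRing B] [Module R B] [IsScalarTower R B B] [SMulCommClass R B B]
  {DA : DGCA R A} {DB : DGCA R B} {n : ℕ} (P : CInfMorphism DA DB)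

theorem exists_linear_app (l r : List A) : ∃ φ : A →ₗ[R] B, ∀ x, P.app (l ++ x :: r) = φ x := by
  refine ⟨(P.p (l ++ 0 :: r).length).toLinearMap (l ++ 0 :: r).get ⟨l.length, by simp⟩,
    fun x => app_eq P _ _ (by simp) fun i hi => ?_⟩
  rw [Function.update_apply]
  simp only [Fin.mk.injEq, List.get_eq_getElem]
  rcases lt_trichotomy i l.length with h | h | h
  · rw [if_neg h.ne, List.getElem_append_left h, List.getElem_append_left h]
  · subst h
    simp
  · rw [if_neg h.ne', List.getElem_append_right h.le, List.getElem_append_right h.le]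
    obtain ⟨j, rfl⟩ : ∃ j, i = l.length + 1 + j := ⟨i - l.length - 1, by omega⟩
    simp only [show l.length + 1 + j - l.length = j + 1 by omega, List.getElem_cons_succ]

theorem exists_linear_nprod_factorVal (a : Fin n → A) (u v : Word n) : ∃ φ : B →ₗ[R] B,
    ∀ b, nprod ((u ++ [b] ++ v).map (factorVal P a)) = φ (factorVal P a b) := by
  obtain ⟨φ, hφ⟩ := exists_linear_nprod R (u.map (factorVal P a)) (v.map (factorVal P a))
  exact ⟨φ, fun b => by rw [← hφ]; simp⟩

theorem tensorSign_middle (e : Fin n → ℤ) (u v : Word n) {b c : List (List (Fin n))}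
    (hl : b.length = c.length) (hd : degSum e b.flatten = degSum e c.flatten) :
    Word.tensorSign e (u ++ [b] ++ v) = Word.tensorSign e (u ++ [c] ++ v) := by
  simp only [tensorSign_append, Word.tensorSign, List.flatten_append, degSum_append,
    List.flatten_singleton, hd, Word.dim, List.map_cons, List.map_nil, hl, List.sum_nil,
    Nat.cast_zero, zero_mul]

theorem nprod_swap {e : Fin n → ℤ} {a : Fin n → A} (ha : DA.Homog e a) (s t : List (Fin n))
    (i j : Fin n) : nprod ((s ++ i :: j :: t).map a) =
      (e i * e j).negOnePow • nprod ((s ++ j :: i :: t).map a) := by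
  simp only [List.map_append, List.map_cons]
  rw [nprod_mul, nprod_mul, DA.comm (ha i) (ha j)]
  obtain ⟨φ, hφ⟩ := exists_linear_nprod R (s.map a) (t.map a)
  rw [hφ, hφ, Units.smul_def, map_zsmul, Units.smul_def]

theorem factorVal_swap {e : Fin n → ℤ} {a : Fin n → A} (ha : DA.Homog e a)
    (b c : List (List (Fin n))) (s t : List (Fin n)) (i j : Fin n) :
    factorVal P a (b ++ [s ++ i :: j :: t] ++ c) =
      (e i * e j).negOnePow • factorVal P a (b ++ [s ++ j :: i :: t] ++ c) := by
  obtain ⟨φ, hφ⟩ := exists_linear_app P (b.map fun x => nprod (x.map a))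
    (c.map fun x => nprod (x.map a))
  have h (x : List (Fin n)) : factorVal P a (b ++ [x] ++ c) = φ (nprod (x.map a)) := by
    rw [← hφ, factorVal]
    simp
  rw [h, h, nprod_swap ha, Units.smul_def, map_zsmul, Units.smul_def]

/-- The swap gives `(-1) ^ (e i * e j)` twice, from the Koszul sign and from graded commutativity in
`A`. -/
theorem realizeWord_commA {e : Fin n → ℤ} {a : Fin n → A} (ha : DA.Homog e a) (u v : Word n)
    (b c : List (List (Fin n))) (s t : List (Fin n)) (i j : Fin n)
    (hc : (u ++ [b ++ [s ++ i :: j :: t] ++ c] ++ v).IsCell) :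
    P.realizeWord (u ++ [b ++ [s ++ i :: j :: t] ++ c] ++ v) e a =
      P.realizeWord (u ++ [b ++ [s ++ j :: i :: t] ++ c] ++ v) e a := by
  obtain ⟨φ, hφ⟩ := exists_linear_nprod_factorVal P a u v
  have hflat (k l : Fin n) : (u ++ [b ++ [s ++ k :: l :: t] ++ c] ++ v).flatten.flatten =
      (u.flatten.flatten ++ b.flatten ++ s) ++ ([k] ++ [l]) ++
        (t ++ c.flatten ++ v.flatten.flatten) := by simp
  have hij : i ≠ j := by
    have h := hc.1.nodup_iff.2 (List.nodup_finRange n)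
    rw [hflat] at h
    have := (List.nodup_append'.1 h.of_append_left).2.1
    simpa using this
  have hsign := koszulSign_swap e (u.flatten.flatten ++ b.flatten ++ s)
    (t ++ c.flatten ++ v.flatten.flatten) [i] [j] (by simpa using hij.symm)
  rw [← hflat, ← hflat] at hsign
  have hdeg : degSum e [i] * degSum e [j] = e i * e j := by simp [degSum]
  rw [hdeg] at hsign
  rw [realizeWord_eq, realizeWord_eq, wordVal, wordVal, hφ, hφ, factorVal_swap P ha, hsign,
    tensorSign_middle e u v (b := b ++ [s ++ i :: j :: t] ++ c) (c := b ++ [s ++ j :: i :: t] ++ c)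
      (by simp) (by simp [degSum, add_left_comm]), Units.smul_def (e i * e j).negOnePow, map_zsmul,
    ← Units.smul_def, smul_smul, smul_smul, smul_smul]
  congr 1
  calc _ = ((e i * e j).negOnePow * (e i * e j).negOnePow) *
        (koszulSign e (u ++ [b ++ [s ++ j :: i :: t] ++ c] ++ v).flatten.flatten *
          Word.tensorSign e (u ++ [b ++ [s ++ j :: i :: t] ++ c] ++ v)) := by ac_rfl
    _ = _ := by rw [negOnePow_mul_self, one_mul]

/-- Commutativity in `B` involves the full degrees of the factor values, arguments minus dimension.
The Koszul and tensor signs absorb everything but the product of the dimensions. -/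
theorem realizeWord_commB {e : Fin n → ℤ} {a : Fin n → A} (ha : DA.Homog e a) (u v : Word n)
    (b c : List (List (Fin n))) (hc : (u ++ [b, c] ++ v).IsCell) :
    P.realizeWord (u ++ [b, c] ++ v) e a = (-1 : R) ^ ((b.length - 1) * (c.length - 1)) •
      P.realizeWord (u ++ [c, b] ++ v) e a := by
  obtain ⟨φ, hφ⟩ := exists_linear_nprod R (u.map (factorVal P a)) (v.map (factorVal P a))
  have hval (b c : List (List (Fin n))) : nprod ((u ++ [b, c] ++ v).map (factorVal P a)) =
      φ (factorVal P a b * factorVal P a c) := by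
    rw [← hφ, ← nprod_mul]
    simp
  have hflat (b c : List (List (Fin n))) : (u ++ [b, c] ++ v).flatten.flatten =
      u.flatten.flatten ++ (b.flatten ++ c.flatten) ++ v.flatten.flatten := by simp
  have hmem (d : List (List (Fin n))) (hd : d ∈ [b, c]) :
      factorVal P a d ∈ DB.gr (degSum e d.flatten - (d.length - 1 : ℕ)) :=
    have hd' : d ∈ u ++ [b, c] ++ v := List.mem_append_left _ (List.mem_append_right _ hd)
    factorVal_mem P ha (hc.2.1 d hd') (hc.2.2 d hd')
  have hdisj : b.flatten.Disjoint c.flatten := by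
    have h := hc.1.nodup_iff.2 (List.nodup_finRange n)
    rw [hflat] at h
    exact (List.nodup_append'.1 (List.nodup_append'.1 h.of_append_left).2.1).2.2
  have hsign := koszulSign_swap e u.flatten.flatten v.flatten.flatten b.flatten c.flatten hdisj
  rw [← hflat, ← hflat] at hsign
  have htens (b c : List (List (Fin n))) : Word.tensorSign e (u ++ [b, c] ++ v) =
      ((Word.dim v : ℤ) * degSum e (u ++ [b, c]).flatten.flatten).negOnePow *
        (((Word.dim [b, c] : ℤ) * degSum e u.flatten.flatten).negOnePow *
          (Word.tensorSign e u * (((c.length - 1 : ℕ) : ℤ) * degSum e b.flatten).negOnePow) *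
            Word.tensorSign e v) := by
    rw [tensorSign_append, tensorSign_append]
    simp [Word.tensorSign, Word.dim, degSum]
  have hdim : Word.dim [c, b] = Word.dim [b, c] := by simp [Word.dim, add_comm]
  have hdeg : degSum e (u ++ [c, b]).flatten.flatten = degSum e (u ++ [b, c]).flatten.flatten := by
    simp [degSum, add_comm]
  -- With `x`, `y` the degrees of the arguments and `s`, `t` the dimensions, this is `x y + t x + (x
  -- - s)(y - t) ≡ s t + s y` modulo 2.
  have hparity : (degSum e b.flatten * degSum e c.flatten).negOnePow *
      (((c.length - 1 : ℕ) : ℤ) * degSum e b.flatten).negOnePow *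
      ((degSum e b.flatten - (b.length - 1 : ℕ)) *
        (degSum e c.flatten - (c.length - 1 : ℕ))).negOnePow =
      (((b.length - 1) * (c.length - 1) : ℕ) : ℤ).negOnePow *
        (((b.length - 1 : ℕ) : ℤ) * degSum e c.flatten).negOnePow := by
    rw [← Int.negOnePow_add, ← Int.negOnePow_add, ← Int.negOnePow_add, Int.negOnePow_eq_iff]
    refine ⟨degSum e b.flatten * degSum e c.flatten -
      ((b.length - 1 : ℕ) : ℤ) * degSum e c.flatten, ?_⟩
    push_cast
    ring
  rw [realizeWord_eq, realizeWord_eq, wordVal, wordVal, hval, hval, hsign, htens b c, htens c b,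
    hdim, hdeg, DB.comm (hmem b (by simp)) (hmem c (by simp)), negOnePow_smul_eq,
    Units.smul_def ((degSum e b.flatten - _) * _).negOnePow, map_zsmul, ← Units.smul_def, smul_smul,
    smul_smul, smul_smul, smul_smul]
  congr 1
  calc _ = ((degSum e b.flatten * degSum e c.flatten).negOnePow *
      (((c.length - 1 : ℕ) : ℤ) * degSum e b.flatten).negOnePow *
      ((degSum e b.flatten - (b.length - 1 : ℕ)) *
        (degSum e c.flatten - (c.length - 1 : ℕ))).negOnePow) *
      (koszulSign e (u ++ [c, b] ++ v).flatten.flatten *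
        (((Word.dim v : ℤ) * degSum e (u ++ [b, c]).flatten.flatten).negOnePow *
          (((Word.dim [b, c] : ℤ) * degSum e u.flatten.flatten).negOnePow *
            Word.tensorSign e u * Word.tensorSign e v))) := by ac_rfl
    _ = _ := by rw [hparity]; ac_rfl

/-- By `koszulSign_eq_of_perm` the Koszul sign of each term is a common sign times that of permuting
the arguments as single elements. So the sum is a linear image of the shuffle relation of the
morphism. -/
theorem realizeWord_shuffle {e : Fin n → ℤ} {a : Fin n → A} (ha : DA.Homog e a) (u v : Word n)
    (q r : ℕ) (x : Fin (q + r) → List (Fin n)) (hq : 1 ≤ q) (hr : 1 ≤ r)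
    (hc : (u ++ [List.ofFn x] ++ v).IsCell) :
    ∑ σ ∈ shuffles q r, Equiv.Perm.sign σ •
      P.realizeWord (u ++ [List.ofFn fun i => x (σ⁻¹ i)] ++ v) e a = 0 := by
  obtain ⟨φ, hφ⟩ := exists_linear_nprod_factorVal P a u v
  have hx (s : Fin (q + r)) : x s ≠ [] :=
    hc.2.2 (List.ofFn x) (by simp) (x s) (List.mem_ofFn.2 ⟨s, rfl⟩)
  have hsh := P.shuffle q r hq hr (fun s => degSum e (x s)) (fun s => nprod ((x s).map a))
    fun s => nprod_mem DA ha (hx s)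
  have hflat (y : Fin (q + r) → List (Fin n)) : (u ++ [List.ofFn y] ++ v).flatten.flatten =
      u.flatten.flatten ++ (List.ofFn y).flatten ++ v.flatten.flatten := by simp
  have hnd : (List.ofFn x).flatten.Nodup := by
    have h := hc.1.nodup_iff.2 (List.nodup_finRange n)
    rw [hflat] at h
    exact (List.nodup_append'.1 h.of_append_left).2.1
  have hterm (σ : Equiv.Perm (Fin (q + r))) :
      Equiv.Perm.sign σ • P.realizeWord (u ++ [List.ofFn fun i => x (σ⁻¹ i)] ++ v) e a =
        (koszulSign e (u ++ [List.ofFn x] ++ v).flatten.flatten *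
          Word.tensorSign e (u ++ [List.ofFn x] ++ v)) •
        φ ((Equiv.Perm.sign σ * koszulSign (fun s => degSum e (x s)) (List.ofFn fun i => σ⁻¹ i)) •
          P.p (q + r) fun i => nprod ((x (σ⁻¹ i)).map a)) := by
    have hperm : (List.finRange (q + r)).Perm (List.ofFn fun i => σ⁻¹ i) := by
      rw [← List.ofFn_id]
      exact (Equiv.Perm.ofFn_comp_perm σ⁻¹ id).symm
    have hp' : (List.ofFn x).flatten.Perm (List.ofFn fun i => x (σ⁻¹ i)).flatten :=
      ((Equiv.Perm.ofFn_comp_perm σ⁻¹ x).symm).flatten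
    have hk := koszulSign_eq_of_perm e x hperm (by rwa [← List.ofFn_eq_map])
      (List.nodup_finRange _) u.flatten.flatten v.flatten.flatten
    rw [koszulSign_finRange, one_mul, ← List.ofFn_eq_map, ← hflat, List.map_ofFn] at hk
    have hk' : koszulSign e (u ++ [List.ofFn fun i => x (σ⁻¹ i)] ++ v).flatten.flatten =
        koszulSign (fun s => degSum e (x s)) (List.ofFn fun i => σ⁻¹ i) *
          koszulSign e (u ++ [List.ofFn x] ++ v).flatten.flatten := by
      rw [hk, ← mul_assoc, Int.units_mul_self, one_mul, hflat]
      rfl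
    rw [realizeWord_eq, wordVal, hφ, factorVal_ofFn, hk',
      tensorSign_middle e u v (b := List.ofFn fun i => x (σ⁻¹ i)) (c := List.ofFn x) (by simp)
        ((hp'.map e).sum_eq).symm, Units.smul_def (_ * _) (P.p (q + r) _), map_zsmul,
      ← Units.smul_def, smul_smul, smul_smul, smul_smul]
    congr 1
    ac_rfl
  rw [Finset.sum_congr rfl fun σ _ => hterm σ, ← Finset.smul_sum, ← map_sum, hsh, map_zero,
    smul_zero]

theorem realize_eq_zero {e : Fin n → ℤ} {a : Fin n → A} (ha : DA.Homog e a) {z : Chain R n}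
    (hz : z ∈ relations R n) : P.realize z e a = 0 := by
  rw [← realizeHom_apply]
  induction hz using Submodule.span_induction with
  | mem z h =>
    cases h with
    | commA u v b c s t i j hc =>
      rw [map_sub, realizeHom_single, realizeHom_single, realizeWord_commA P ha u v b c s t i j hc,
        sub_self]
    | commB u v b c hc =>
      rw [map_sub, map_smul, realizeHom_single, realizeHom_single,
        realizeWord_commB (R := R) P ha u v b c hc, sub_self]
    | shuffle u v q r x hq hr hc =>
      rw [map_sum, ← realizeWord_shuffle P ha u v q r x hq hr hc]
      refine Finset.sum_congr rfl fun σ _ => ?_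
      rw [Units.smul_def, map_zsmul, realizeHom_single, Units.smul_def]
  | zero => simp
  | add x y _ _ hx hy => rw [map_add, hx, hy, add_zero]
  | smul c x _ hx => rw [map_smul, hx, smul_zero]

theorem realize_eq_of_same {e : Fin n → ℤ} {a : Fin n → A} (ha : DA.Homog e a) {z z' : Chain R n}
    (h : Same R z z') : P.realize z e a = P.realize z' e a := by
  have := realize_eq_zero P ha h
  rwa [← realizeHom_apply, map_sub, sub_eq_zero] at this

theorem tensorSign_eq_one (e : Fin n → ℤ) {w : Word n} (h : Word.dim w = 0) :
    Word.tensorSign e w = 1 := by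
  induction w with
  | nil => rfl
  | cons b w ih =>
    have hdim : Word.dim (b :: w) = b.length - 1 + Word.dim w := by simp [Word.dim]
    have hw : Word.dim w = 0 := by omega
    rw [Word.tensorSign, ih hw, hw]
    simp

theorem realize_cumulantChain {p : A → B} (hp : ∀ x, P.p 1 (fun _ => x) = p x)
    (e : Fin n → ℤ) (a : Fin n → A) : P.realize (cumulantChain R n) e a = cumulant p n e a := by
  rw [← realizeHom_apply, cumulantChain, cumulant, map_sum]
  refine Finset.sum_congr rfl fun π _ => ?_
  obtain ⟨h1, -, -, h2⟩ := blocks_mem_wordsOn π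
  rw [map_zsmul, realizeHom_single, realizeWord_eq, wordVal, h1, tensorSign_eq_one e h2, one_smul,
    List.map_map]
  congr 4
  funext b
  rw [Function.comp_apply, factorVal, ← hp]
  exact app_eq P _ _ rfl (by simp)

theorem isNullHomotopy_realize {m k : ℕ} {w z : Chain R n} (hw : w ∈ builtFrom R n m k)
    {f : Operation n A B} (h : Same R (boundary R n w) z) (hf : Agree DA (P.realize z) f) :
    IsNullHomotopy DA DB (-k) (P.realize w) f :=
  ⟨isGradedMap_realize P hw, fun e a ha => by
    rw [homDiff_realize P ha hw, realize_eq_of_same P ha h, hf e a ha]⟩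

end Relators

/-! ### The second cumulant -/

section CumulantTwo

theorem univ_finpartition_two :
    (Finset.univ : Finset (Finpartition (Finset.univ : Finset (Fin 2)))) = {⊤, ⊥} := by
  decide

theorem blocks_top_two :
    blocks (⊤ : Finpartition (Finset.univ : Finset (Fin 2))) = [[0, 1]] := by
  have h1 : (List.finRange 2).filter (fun i => ∀ j ∈
      (⊤ : Finpartition (Finset.univ : Finset (Fin 2))).part i, i ≤ j) = [0] := by decide
  have h2 : (⊤ : Finpartition (Finset.univ : Finset (Fin 2))).part 0 = Finset.univ := by decide
  rw [blocks, h1, List.map_singleton, h2, Fin.sort_univ]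
  rfl

theorem blocks_bot_two :
    blocks (⊥ : Finpartition (Finset.univ : Finset (Fin 2))) = [[0], [1]] := by
  have h1 : (List.finRange 2).filter (fun i => ∀ j ∈
      (⊥ : Finpartition (Finset.univ : Finset (Fin 2))).part i, i ≤ j) = [0, 1] := by decide
  have h2 : (⊥ : Finpartition (Finset.univ : Finset (Fin 2))).part 0 = {0} := by decide
  have h3 : (⊥ : Finpartition (Finset.univ : Finset (Fin 2))).part 1 = {1} := by decide
  rw [blocks, h1, List.map_cons, List.map_singleton, h2, h3, Finset.sort_singleton,
    Finset.sort_singleton]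

variable {R : Type*} [CommRing R]
  {A : Type*} [NonUnitalRing A] [Module R A] [IsScalarTower R A A] [SMulCommClass R A A]
  {B : Type*} [NonUnitalRing B] [Module R B] [IsScalarTower R B B] [SMulCommClass R B B]
  {DA : DGCA R A} {DB : DGCA R B} (P : CInfMorphism DA DB)

theorem cumulant_two (p : A → B) (e : Fin 2 → ℤ) (a : Fin 2 → A) :
    cumulant p 2 e a = p (a 0 * a 1) - p (a 0) * p (a 1) := by
  have hne : (⊤ : Finpartition (Finset.univ : Finset (Fin 2))) ≠ ⊥ := by decide
  have h1 : (⊤ : Finpartition (Finset.univ : Finset (Fin 2))).parts.card = 1 := by decide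
  have h2 : (⊥ : Finpartition (Finset.univ : Finset (Fin 2))).parts.card = 2 := by decide
  have hk : koszulSign e [0, 1] = 1 := koszulSign_finRange e
  rw [cumulant, univ_finpartition_two, Finset.sum_pair hne, blocks_top_two, blocks_bot_two,
    cumulantCoeff, cumulantCoeff, h1, h2]
  simp [hk, nprod, sub_eq_add_neg]

theorem isNullHomotopy_p_two {p : A → B} (hp : ∀ x, P.p 1 (fun _ => x) = p x) :
    IsNullHomotopy DA DB (-1) (fun _ a => P.p 2 a) (cumulant p 2) := by
  refine ⟨fun e => ⟨⟨(P.p 2).compLinearMap fun i => (DA.gr (e i)).subtype, fun a => rfl⟩,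
    fun a ha => ?_⟩, fun e a ha => ?_⟩
  · convert P.map_mem 2 (by norm_num) e a ha using 2
    norm_num
  -- `relation` is indexed so that `1` concerns `p 2`; its sum has a single term, with trivial
  -- signs.
  · have h := P.relation 1 e a ha
    rw [cumulant_two, ← hp, ← hp, ← hp]
    refine Eq.trans ?_ (h.trans ?_)
    · rfl
    · rw [Fin.sum_univ_one]
      simp only [Fin.val_zero, Nat.cast_zero, Int.negOnePow_zero, one_smul, Nat.cast_one, sub_zero,
        sub_self, zero_mul]
      congr 1
      · congr 1
        funext i
        rw [Subsingleton.elim i 0]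
        simp [Fin.contractNth]
      · congr 2
        · funext i
          congr 1
          simp
        · funext i
          congr 1
          simp

end CumulantTwo

end
end CInf

/-! ### The main theorem -/

open CInf in
theorem mainTheorem1 {R : Type*} [CommRing R]
    {A : Type*} [NonUnitalRing A] [Module R A] [IsScalarTower R A A] [SMulCommClass R A A]
    {B : Type*} [NonUnitalRing B] [Module R B] [IsScalarTower R B B] [SMulCommClass R B B]
    (DA : DGCA R A) (DB : DGCA R B) (P : CInfMorphism DA DB)
    (p : A →ₗ[R] B) (hp : ∀ x, P.p 1 (fun _ => x) = p x) :
    -- chains denote operations, compatibly with the identifications and the differentials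
    (∀ n : ℕ, 1 ≤ n →
      (∀ z ∈ relations R n, Agree DA (P.realize z) 0) ∧
      (∀ m k : ℕ, ∀ z ∈ builtFrom R n m k,
        IsGradedMap DA DB (-k) (P.realize z) ∧
        Agree DA (homDiff DA DB (-k) (P.realize z)) (P.realize (boundary R n z))) ∧
      Agree DA (P.realize (cumulantChain R n)) (cumulant p n)) ∧
    -- (i)
    IsNullHomotopy DA DB (-1) (fun _ a => P.p 2 a) (cumulant p 2) ∧
    (∀ n : ℕ, 2 ≤ n → ∃ h ∈ builtFrom R n 2 1,
      Same R (boundary R n h) (cumulantChain R n) ∧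
      IsNullHomotopy DA DB (-1) (P.realize h) (cumulant p n)) ∧
    -- (ii)
    (∀ n : ℕ, 2 ≤ n → ∀ h ∈ builtFrom R n 2 1, ∀ h' ∈ builtFrom R n 2 1,
      Same R (boundary R n h) (cumulantChain R n) →
      Same R (boundary R n h') (cumulantChain R n) →
      ∃ g ∈ builtFrom R n 3 2,
        Same R (boundary R n g) (h - h') ∧
        IsNullHomotopy DA DB (-2) (P.realize g) (P.realize h - P.realize h')) ∧
    -- (iii)
    (∀ n : ℕ, 1 ≤ n → ∀ m k : ℕ, ∀ z ∈ builtFrom R n m k, IsCycle R k z →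
      ∃ w ∈ builtFrom R n (m + 1) (k + 1),
        Same R (boundary R n w) z ∧
        IsNullHomotopy DA DB (-(k + 1)) (P.realize w) (P.realize z)) := by
  refine ⟨fun n _ => ⟨fun z hz e a ha => realize_eq_zero P ha hz, fun m k z hz =>
    ⟨isGradedMap_realize P hz, fun e a ha => homDiff_realize P ha hz⟩,
    fun e a _ => realize_cumulantChain P hp e a⟩, isNullHomotopy_p_two P hp, fun n hn => ?_,
    fun n _ h hh h' hh' hb hb' => ?_, fun n _ m k z hz hcyc => ?_⟩
  -- The cumulant consists of vertices built from `p_1` alone, so this is the case `m = 1`, `k = 0`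
  -- of (iii).
  · obtain ⟨h, hh, hb⟩ := exists_boundary_same (cumulantChain_mem R n) (isCycle_cumulantChain R hn)
    have hnull := isNullHomotopy_realize P hh hb fun e a _ => realize_cumulantChain P hp e a
    exact ⟨h, hh, hb, by simpa using hnull⟩
  -- Both null-homotopies have the cumulant as boundary, so their difference is a cycle; in positive
  -- dimension the augmentation condition is void.
  · have hcyc : IsCycle R 1 (h - h') := by
      refine ⟨?_, fun h0 => absurd h0 one_ne_zero⟩
      rw [Same, sub_zero, map_sub]
      simpa [Same] using sub_mem hb hb'
    obtain ⟨g, hg, hgb⟩ := exists_boundary_same (sub_mem hh hh') hcyc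
    have hnull := isNullHomotopy_realize P hg hgb (f := P.realize h - P.realize h')
      fun e a _ => map_sub (realizeHom P e a) h h'
    exact ⟨g, hg, hgb, by simpa using hnull⟩
  · obtain ⟨w, hw, hb⟩ := exists_boundary_same hz hcyc
    have hnull := isNullHomotopy_realize P hw hb fun e a _ => rfl
    exact ⟨w, hw, hb, by simpa using hnull⟩
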